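/- Let $d\in\mathbb N$, and let $\mathbb R^d$ act on a probability space $(\Omega,\mathbb P)$ by measure-preserving transformations. Let $M(\mathbb R^d)$ be the space of signed Radon measures on $\mathbb R^d$ (differences of two locally finite Borel measures, acting as functionals on bounded Borel functions that vanish outside a compact set), with the smallest $\sigma$-algebra that makes all linear statistics $\mu\mapsto\mu(f)$ measurable, where $f$ is a bounded Borel function vanishing outside a compact set. Let $p:\Omega\to M(\mathbb R^d)$, $\omega\mapsto p_\omega$, be a locally square-integrable invariant random measure, i.e. a measurable $\mathbb R^d$-equivariant map with $\mathbb E[|p_\omega|(B)^2]<\infty$ for every bounded Borel set $B$, where $|\cdot|$ is the total variation (for non-negative $p$ this says $\mathbb E[p_\omega(B)^2]<\infty$). Let $i(p)$ be the intensity, $\mathbb E[p_\omega(A)]=i(p)\,\mathrm{Vol}_d(A)$, let $M^2_p(F)=\mathbb E[(p_\omega\otimes p_\omega)(F)]$ be the second moment measure, and let $$\eta^+_p(f)=\int f(x-y)\rho(y)\,dM_p^2(x,y),\qquad \eta_p(f)=\eta_p^+(f)-i(p)^2\int_{\mathbb R^d}f(x)\,dx$$ be the autocorrelation and the centered autocorrelation;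 here $\rho\ge0$ is any bounded Borel function with bounded support and $\int\rho=1$, and $\eta_p^+$ does not depend on $\rho$. The centered diffraction $\widehat\eta_p$ is the Fourier transform of the positive-definite measure $\eta_p$, i.e. the positive Radon measure on $\mathbb R^d$ with $\int|\widehat f|^2\,d\widehat\eta_p=\eta_p(f*f^*)$ for all $f\in C_c(\mathbb R^d)$, where $\widehat f(\xi)=\int f(x)e^{-2\pi i\langle x,\xi\rangle}dx$ and $f^*(x)=\overline{f(-x)}$. Let $\mathrm{Var}_p(A)$ be the variance of $\omega\mapsto p_\omega(A)$. For bounded Borel sets $V,W\subset\mathbb R^d$, call $p$ *geometrically hyperuniform with respect to $V$* if $\lim_{t\to\infty}t^{-d}\,\mathrm{Var}_p(tV)=0$, and *spectrally hyperuniform with respect to $W$* if $\lim_{t\to0^+}t^{-d}\,\widehat\eta_p(tW)=0$; omit the set when it is the Euclidean unit ball. Call $V$ *Fourier smooth* if there are $\vartheta>0$ and $C$ with $|\widehat{\chi}_V(\xi)|\le C(1+\|\xi\|)^{-(d+\vartheta)/2}$ for all $\xi\in\mathbb R^d$. Then: (i) If $p$ is geometrically hyperuniform with respect to some bounded Borel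 set $V$ of positive Lebesgue measure (for example a bounded Borel neighbourhood of $0$), then $p$ is spectrally hyperuniform. (ii) If $p$ is spectrally hyperuniform with respect to some bounded Borel set $W$ with $0$ in its interior, then it is spectrally hyperuniform with respect to every such set, and in particular spectrally hyperuniform. (iii) If $p$ is spectrally hyperuniform, then it is geometrically hyperuniform with respect to every Fourier smooth bounded Borel set $V$. In particular, $p$ is geometrically hyperuniform if and only if it is spectrally hyperuniform. -/

import Mathlib

open MeasureTheory Filter Topology
open scoped Pointwise FourierTransform

noncomputable section

namespace Hyperuniformity

/-- A signed Radon measure on `ℝ^d` (not necessarily of finite total variation), given by its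
Jordan decomposition: two mutually singular locally finite Borel measures. -/
structure SignedRadonMeasure (d : ℕ) where
  /-- the positive part -/
  pos : Measure (EuclideanSpace ℝ (Fin d))
  /-- the negative part -/
  neg : Measure (EuclideanSpace ℝ (Fin d))
  locallyFinite_pos : IsLocallyFiniteMeasure pos
  locallyFinite_neg : IsLocallyFiniteMeasure neg
  mutuallySingular : pos ⟂ₘ neg

/-- Bounded complex-valued Borel functions on `ℝ^d` vanishing outside a compact set. -/
def IsBoundedCompactBorel {d : ℕ} (f : EuclideanSpace ℝ (Fin d) → ℂ) : Prop :=
  Measurable f ∧ (∃ C : ℝ, ∀ x, ‖f x‖ ≤ C) ∧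
    ∃ K : Set (EuclideanSpace ℝ (Fin d)), IsCompact K ∧ ∀ x ∉ K, f x = 0

namespace SignedRadonMeasure

variable {d : ℕ}

/-- The integral `μ(f) = ∫ f dμ` against a signed Radon measure. -/
def integral (μ : SignedRadonMeasure d) (f : EuclideanSpace ℝ (Fin d) → ℂ) : ℂ :=
  (∫ x, f x ∂μ.pos) - ∫ x, f x ∂μ.neg

/-- The value `μ(B)` on a bounded Borel set. -/
def value (μ : SignedRadonMeasure d) (B : Set (EuclideanSpace ℝ (Fin d))) : ℝ :=
  μ.pos.real B - μ.neg.real B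

/-- The total variation measure `|μ|`. -/
def totalVariation (μ : SignedRadonMeasure d) : Measure (EuclideanSpace ℝ (Fin d)) :=
  μ.pos + μ.neg

/-- The integral of a function of two variables against the product `μ ⊗ μ`. -/
def integralProd (μ : SignedRadonMeasure d)
    (F : EuclideanSpace ℝ (Fin d) → EuclideanSpace ℝ (Fin d) → ℂ) : ℂ :=
  μ.integral fun x => μ.integral fun y => F x y

/-- The smallest `σ`-algebra for which all linear statistics `μ ↦ μ(f)` are measurable, where `f`
runs over the bounded Borel functions vanishing outside a compact set. -/
instance : MeasurableSpace (SignedRadonMeasure d) :=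
  ⨆ f : {f : EuclideanSpace ℝ (Fin d) → ℂ // IsBoundedCompactBorel f},
    MeasurableSpace.comap (fun μ => μ.integral f.1) (borel ℂ)

theorem isLocallyFiniteMeasure_map_add {d : ℕ} (g : EuclideanSpace ℝ (Fin d))
    (μ : Measure (EuclideanSpace ℝ (Fin d))) [IsLocallyFiniteMeasure μ] :
    IsLocallyFiniteMeasure (μ.map (fun x => g + x)) := by
  have hm : Measurable (fun x : EuclideanSpace ℝ (Fin d) => g + x) := measurable_const_add g
  refine ⟨fun x => ?_⟩
  obtain ⟨U, hxU, hU, hfin⟩ := μ.exists_isOpen_measure_lt_top (-g + x)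
  have hc : Continuous (fun y : EuclideanSpace ℝ (Fin d) => -g + y) := by fun_prop
  refine ⟨(fun y => -g + y) ⁻¹' U, (hU.preimage hc).mem_nhds hxU, ?_⟩
  rw [Measure.map_apply hm (hU.preimage hc).measurableSet]
  simpa [Set.preimage_preimage] using hfin

/-- The translate `g · μ` of a signed Radon measure, that is, its image under `x ↦ g + x`. -/
def translate (g : EuclideanSpace ℝ (Fin d)) (μ : SignedRadonMeasure d) :
    SignedRadonMeasure d where
  pos := μ.pos.map (fun x => g + x)
  neg := μ.neg.map (fun x => g + x)
  locallyFinite_pos := by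
    have := μ.locallyFinite_pos
    exact isLocallyFiniteMeasure_map_add g _
  locallyFinite_neg := by
    have := μ.locallyFinite_neg
    exact isLocallyFiniteMeasure_map_add g _
  mutuallySingular := by
    obtain ⟨s, hs, h1, h2⟩ := μ.mutuallySingular
    have hm : Measurable (fun x : EuclideanSpace ℝ (Fin d) => g + x) := measurable_const_add g
    have hm' : Measurable (fun x : EuclideanSpace ℝ (Fin d) => -g + x) := measurable_const_add (-g)
    refine ⟨(fun x => -g + x) ⁻¹' s, hm' hs, ?_, ?_⟩
    · rw [Measure.map_apply hm (hm' hs)]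
      simpa [Set.preimage_preimage] using h1
    · rw [Measure.map_apply hm (hm' hs).compl]
      simpa [← Set.preimage_compl, Set.preimage_preimage] using h2

end SignedRadonMeasure

/-- An invariant random measure on `ℝ^d`: a measurable equivariant map from a space `Ω` on which
`ℝ^d` acts to the space of signed Radon measures. (That the action preserves the probability
measure on `Ω` is required where that measure is introduced.) -/
structure InvariantRandomMeasure (d : ℕ) (Ω : Type*) [MeasurableSpace Ω]
    [AddAction (EuclideanSpace ℝ (Fin d)) Ω] where
  /-- the underlying map `ω ↦ p_ω` -/
  toFun : Ω → SignedRadonMeasure d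
  measurable_toFun : Measurable toFun
  equivariant : ∀ (g : EuclideanSpace ℝ (Fin d)) (ω : Ω),
    toFun (g +ᵥ ω) = (toFun ω).translate g

section Statistics

variable {d : ℕ} {Ω : Type*} [MeasurableSpace Ω] [AddAction (EuclideanSpace ℝ (Fin d)) Ω]

/-- Local square-integrability: `𝔼[|p_ω|(B)²] < ∞` for all bounded Borel sets `B`. For random
measures that are non-negative this is `𝔼[p_ω(B)²] < ∞`. -/
def LocallySquareIntegrable (p : InvariantRandomMeasure d Ω) (P : Measure Ω) : Prop :=
  ∀ B : Set (EuclideanSpace ℝ (Fin d)), Bornology.IsBounded B → MeasurableSet B →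
    MemLp (fun ω => (p.toFun ω).totalVariation.real B) 2 P

/-- The number variance `Var_p(A)`: the variance of `ω ↦ p_ω(A)`. -/
def numberVariance (p : InvariantRandomMeasure d Ω) (P : Measure Ω)
    (A : Set (EuclideanSpace ℝ (Fin d))) : ℝ :=
  ProbabilityTheory.variance (fun ω => (p.toFun ω).value A) P

/-- The intensity `i(p)`: the constant with `𝔼[p_ω(A)] = i(p) * vol(A)`, evaluated at the unit
ball. -/
def intensity (p : InvariantRandomMeasure d Ω) (P : Measure Ω) : ℝ :=
  (∫ ω, (p.toFun ω).value (Metric.ball 0 1) ∂P) /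
    (volume : Measure (EuclideanSpace ℝ (Fin d))).real (Metric.ball 0 1)

/-- The second moment measure `M²_p(F) = 𝔼[(p_ω ⊗ p_ω)(F)]`, as a functional on functions `F` of
two variables. -/
def secondMoment (p : InvariantRandomMeasure d Ω) (P : Measure Ω)
    (F : EuclideanSpace ℝ (Fin d) → EuclideanSpace ℝ (Fin d) → ℂ) : ℂ :=
  ∫ ω, (p.toFun ω).integralProd F ∂P

/-- The normalized indicator function of the unit ball; its integral is `1`. -/
def ballDensity (d : ℕ) : EuclideanSpace ℝ (Fin d) → ℂ :=
  (Metric.ball 0 1).indicator fun _ =>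
    ((((volume : Measure (EuclideanSpace ℝ (Fin d))).real (Metric.ball 0 1))⁻¹ : ℝ) : ℂ)

/-- The autocorrelation measure `η⁺_p`, as a functional on bounded Borel functions with bounded
support: `η⁺_p(f) = ∫ f(x - y) ρ(y) dM²_p(x, y)`, where `ρ` is a probability density with bounded
support (the value does not depend on its choice, as `M²_p` is invariant). -/
def autocorrelation (p : InvariantRandomMeasure d Ω) (P : Measure Ω)
    (f : EuclideanSpace ℝ (Fin d) → ℂ) : ℂ :=
  secondMoment p P fun x y => f (x - y) * ballDensity d y

/-- The centered autocorrelation measure `η_p(f) = η⁺_p(f) - i(p)² ∫ f`. -/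
def centeredAutocorrelation (p : InvariantRandomMeasure d Ω) (P : Measure Ω)
    (f : EuclideanSpace ℝ (Fin d) → ℂ) : ℂ :=
  autocorrelation p P f - ((intensity p P : ℝ) : ℂ) ^ 2 * ∫ x, f x

end Statistics

/-- The function `f * f^*`, where `f^*(x) = conj (f (-x))`. -/
def autoconvolution {d : ℕ} (f : EuclideanSpace ℝ (Fin d) → ℂ) : EuclideanSpace ℝ (Fin d) → ℂ :=
  fun x => ∫ y, f y * (starRingEnd ℂ) (f (-(x - y)))

/-- `ν` is the Fourier transform of the positive-definite signed Radon measure `η` (given as a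
functional): the positive Radon measure with `ν(|f̂|²) = η(f * f^*)` for all continuous compactly
supported `f`. -/
def IsFourierTransformOf {d : ℕ} (ν : Measure (EuclideanSpace ℝ (Fin d)))
    (η : (EuclideanSpace ℝ (Fin d) → ℂ) → ℂ) : Prop :=
  IsLocallyFiniteMeasure ν ∧
    ∀ f : EuclideanSpace ℝ (Fin d) → ℂ, Continuous f → HasCompactSupport f →
      Integrable (fun ξ => ‖𝓕 f ξ‖ ^ 2) ν ∧
        ((∫ ξ, ‖𝓕 f ξ‖ ^ 2 ∂ν : ℝ) : ℂ) = η (autoconvolution f)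

open Classical in
/-- The Fourier transform of a positive-definite signed Radon measure (`0` if there is none). -/
def fourierTransform {d : ℕ} (η : (EuclideanSpace ℝ (Fin d) → ℂ) → ℂ) :
    Measure (EuclideanSpace ℝ (Fin d)) :=
  if h : ∃ ν, IsFourierTransformOf ν η then h.choose else 0

section Hyperuniform

variable {d : ℕ} {Ω : Type*} [MeasurableSpace Ω] [AddAction (EuclideanSpace ℝ (Fin d)) Ω]

/-- The centered diffraction: the Fourier transform of the centered autocorrelation. -/
def centeredDiffraction (p : InvariantRandomMeasure d Ω) (P : Measure Ω) :
    Measure (EuclideanSpace ℝ (Fin d)) :=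
  fourierTransform (centeredAutocorrelation p P)

/-- Spectral hyperuniformity with respect to `W`. -/
def SpectrallyHyperuniformWrt (p : InvariantRandomMeasure d Ω) (P : Measure Ω)
    (W : Set (EuclideanSpace ℝ (Fin d))) : Prop :=
  Tendsto (fun t : ℝ => (centeredDiffraction p P).real (t • W) / t ^ d) (𝓝[>] 0) (𝓝 0)

/-- Spectral hyperuniformity (with respect to the Euclidean unit ball). -/
def SpectrallyHyperuniform (p : InvariantRandomMeasure d Ω) (P : Measure Ω) : Prop :=
  SpectrallyHyperuniformWrt p P (Metric.ball 0 1)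

/-- Geometric hyperuniformity with respect to `V`. -/
def GeometricallyHyperuniformWrt (p : InvariantRandomMeasure d Ω) (P : Measure Ω)
    (V : Set (EuclideanSpace ℝ (Fin d))) : Prop :=
  Tendsto (fun t : ℝ => numberVariance p P (t • V) / t ^ d) atTop (𝓝 0)

/-- Geometric hyperuniformity (with respect to the Euclidean unit ball). -/
def GeometricallyHyperuniform (p : InvariantRandomMeasure d Ω) (P : Measure Ω) : Prop :=
  GeometricallyHyperuniformWrt p P (Metric.ball 0 1)

end Hyperuniform

/-- Fourier smoothness of a set `V`: for some exponent `ϑ > 0` the Fourier transform of its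
indicator function is `O((1 + ‖ξ‖)^(-(d + ϑ) / 2))`, uniformly in `ξ`. -/
def FourierSmooth {d : ℕ} (V : Set (EuclideanSpace ℝ (Fin d))) : Prop :=
  ∃ ϑ : ℝ, 0 < ϑ ∧ ∃ C : ℝ, ∀ ξ : EuclideanSpace ℝ (Fin d),
    ‖𝓕 (V.indicator fun _ => (1 : ℂ)) ξ‖ ≤ C * (1 + ‖ξ‖) ^ (-((d : ℝ) + ϑ) / 2)

end Hyperuniformity

end

/-! Everything rests on the spectral formula `Var_p(A) = ∫ |χ̂_A|² dη̂_p` for bounded Borel `A`.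
Since `χ̂_{tV}(ξ) = t^d χ̂_V(tξ)`, it gives `t^{-d} Var_p(tV) = t^d ∫ |χ̂_V(tξ)|² dη̂_p(ξ)`, and
both hyperuniformity conditions become statements about the mass of `η̂_p` near the origin.

For (i), `χ̂_V` is continuous with `χ̂_V(0) = vol V > 0`, hence bounded below on some ball of radius
`r`; restricting the integral to `‖tξ‖ < r` bounds `t^d η̂_p(B_{r/t})` by a multiple of `t^{-d}
Var_p(tV)` (`tendsto_measure_ball_of_tendsto_integral`). Statement (ii) is a comparison of dilates
of bounded neighbourhoods of the origin. For (iii), the decay of `χ̂_V` and a dyadic decomposition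
bound `t^{-d} Var_p(tV)` by a constant times `∑ 2^{-kϑ} η̂_p(B_{2^k/t}) / (2^k/t)^d`. Each term
tends to zero, and the ratios are bounded uniformly because `η̂_p(B_r) = O(r^d)` for `r ≥ 1`;
dominated convergence finishes (`tendsto_integral_of_tendsto_measure_ball`). The ball is Fourier
smooth with `ϑ = 1`, by the decay of Bessel functions (`fourierSmooth_ball`).

The spectral formula has a probabilistic and an analytic half. By stationarity the second moment
measure is a product in the coordinates `(x - y, y)`, so `η_p(f * f^*) = 𝔼|p(f)|² - |𝔼 p(f)|²`
(`pairing_autoconvolution`); in particular `η_p` is positive definite. The Bochner–Schwartz theorem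
then provides `η̂_p` (`IsPosDefPairing.exists_isSmoothFourierTransform`), and since `f ↦ f * f^*` is
continuous from `L²` to the uniform norm, the defining formula extends from smooth test functions to
indicator functions (`IsSmoothFourierTransform.integral_eq`). -/

namespace Hyperuniformity

/-! ### Autoconvolutions of square-integrable functions -/

open scoped ContDiff ENNReal ComplexConjugate

/-- Euclidean space of dimension `d`. -/
abbrev Space (d : ℕ) := EuclideanSpace ℝ (Fin d)

variable {d : ℕ}

/-- The cross-correlation `x ↦ ∫ f(x + v) conj (g v) dv`. -/
noncomputable def crossCorrelation (f g : Space d → ℂ) (x : Space d) : ℂ :=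
  ∫ v, f (x + v) * conj (g v)

theorem autoconvolution_eq (f : Space d → ℂ) : autoconvolution f = crossCorrelation f f := by
  ext x
  rw [autoconvolution, crossCorrelation,
    ← integral_add_left_eq_self (fun y => f y * conj (f (-(x - y)))) x]
  simp

/-- The `L²` norm of a function with respect to Lebesgue measure. -/
noncomputable def l2norm (f : Space d → ℂ) : ℝ := (eLpNorm f 2 volume).toReal

theorem l2norm_nonneg (f : Space d → ℂ) : 0 ≤ l2norm f := ENNReal.toReal_nonneg

theorem integral_mul_norm_le {f g : Space d → ℂ} (hf : MemLp f 2) (hg : MemLp g 2) :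
    ‖∫ v, f v * g v‖ ≤ l2norm f * l2norm g := by
  rw [l2norm, l2norm, ← ENNReal.toReal_mul, ← toReal_enorm]
  apply ENNReal.toReal_mono (ENNReal.mul_ne_top hf.eLpNorm_ne_top hg.eLpNorm_ne_top)
  refine (enorm_integral_le_lintegral_enorm _).trans ?_
  rw [← eLpNorm_one_eq_lintegral_enorm]
  exact eLpNorm_smul_le_mul_eLpNorm (p := 2) (q := 2) (r := 1) (f := g) (φ := f) hg.1 hf.1

theorem memLp_comp_add {f : Space d → ℂ} (hf : MemLp f 2) (x : Space d) :
    MemLp (fun v => f (x + v)) 2 :=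
  hf.comp_measurePreserving (measurePreserving_add_left volume x)

theorem l2norm_comp_add {f : Space d → ℂ} (hf : MemLp f 2) (x : Space d) :
    l2norm (fun v => f (x + v)) = l2norm f := by
  rw [l2norm, l2norm]
  congr 1
  exact eLpNorm_comp_measurePreserving hf.1 (measurePreserving_add_left volume x)

theorem memLp_conj {f : Space d → ℂ} (hf : MemLp f 2) : MemLp (fun v => conj (f v)) 2 :=
  hf.star

theorem l2norm_conj (f : Space d → ℂ) : l2norm (fun v => conj (f v)) = l2norm f := by
  rw [l2norm, l2norm]
  congr 1
  exact eLpNorm_congr_norm_ae (by simp)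

theorem integrable_crossCorrelation {f g : Space d → ℂ} (hf : MemLp f 2) (hg : MemLp g 2)
    (x : Space d) : Integrable (fun v => f (x + v) * conj (g v)) :=
  (memLp_comp_add hf x).integrable_mul (memLp_conj hg)

theorem norm_crossCorrelation_le {f g : Space d → ℂ} (hf : MemLp f 2) (hg : MemLp g 2)
    (x : Space d) : ‖crossCorrelation f g x‖ ≤ l2norm f * l2norm g := by
  have := integral_mul_norm_le (memLp_comp_add hf x) (memLp_conj hg)
  rwa [l2norm_comp_add hf, l2norm_conj] at this

theorem crossCorrelation_sub_left {f f' g : Space d → ℂ} (hf : MemLp f 2) (hf' : MemLp f' 2)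
    (hg : MemLp g 2) (x : Space d) :
    crossCorrelation (f - f') g x = crossCorrelation f g x - crossCorrelation f' g x := by
  rw [crossCorrelation, crossCorrelation, crossCorrelation,
    ← integral_sub (integrable_crossCorrelation hf hg x) (integrable_crossCorrelation hf' hg x)]
  simp [sub_mul]

theorem crossCorrelation_sub_right {f g g' : Space d → ℂ} (hf : MemLp f 2) (hg : MemLp g 2)
    (hg' : MemLp g' 2) (x : Space d) :
    crossCorrelation f (g - g') x = crossCorrelation f g x - crossCorrelation f g' x := by
  rw [crossCorrelation, crossCorrelation, crossCorrelation,
    ← integral_sub (integrable_crossCorrelation hf hg x) (integrable_crossCorrelation hf hg' x)]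
  simp [mul_sub]

theorem norm_autoconvolution_le {f : Space d → ℂ} (hf : MemLp f 2) (x : Space d) :
    ‖autoconvolution f x‖ ≤ l2norm f ^ 2 := by
  rw [autoconvolution_eq, sq]
  exact norm_crossCorrelation_le hf hf x

/-- Telescoping: `f * f^* - g * g^*` is the correlation of `f - g` with `f` plus that of `g` with `f
- g`, and Cauchy–Schwarz bounds each. This `L²`-to-uniform continuity is what later carries the
Fourier formula over to indicator functions. -/
theorem norm_autoconvolution_sub_le {f g : Space d → ℂ} (hf : MemLp f 2) (hg : MemLp g 2)
    (x : Space d) : ‖autoconvolution f x - autoconvolution g x‖ ≤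
      l2norm (f - g) * (l2norm f + l2norm g) := by
  have h : autoconvolution f x - autoconvolution g x =
      crossCorrelation (f - g) f x + crossCorrelation g (f - g) x := by
    rw [crossCorrelation_sub_left hf hg hf, crossCorrelation_sub_right hg hf hg,
      autoconvolution_eq, autoconvolution_eq]
    ring
  rw [h, mul_add, mul_comm (l2norm (f - g)) (l2norm g)]
  exact (norm_add_le _ _).trans (add_le_add (norm_crossCorrelation_le (hf.sub hg) hf x)
    (norm_crossCorrelation_le hg (hf.sub hg) x))

theorem l2norm_le_add {f g : Space d → ℂ} (hf : MemLp f 2) (hg : MemLp g 2) :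
    l2norm g ≤ l2norm f + l2norm (f - g) := by
  rw [l2norm, l2norm, l2norm, ← ENNReal.toReal_add hf.eLpNorm_ne_top (hf.sub hg).eLpNorm_ne_top]
  apply ENNReal.toReal_mono
    (ENNReal.add_ne_top.2 ⟨hf.eLpNorm_ne_top, (hf.sub hg).eLpNorm_ne_top⟩)
  have h : g = f - (f - g) := by simp
  conv_lhs => rw [h]
  exact eLpNorm_sub_le hf.1 (hf.sub hg).1 (by norm_num)

theorem tendstoUniformly_autoconvolution {f : Space d → ℂ} {g : ℕ → Space d → ℂ}
    (hf : MemLp f 2) (hg : ∀ n, MemLp (g n) 2)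
    (h : Tendsto (fun n => l2norm (f - g n)) atTop (𝓝 0)) :
    TendstoUniformly (fun n => autoconvolution (g n)) (autoconvolution f) atTop := by
  rw [Metric.tendstoUniformly_iff]
  intro ε hε
  have h1 : Tendsto (fun n => l2norm (f - g n) * (l2norm f + (l2norm f + l2norm (f - g n)))) atTop
      (𝓝 (0 * (l2norm f + (l2norm f + 0)))) :=
    h.mul (tendsto_const_nhds.add (tendsto_const_nhds.add h))
  rw [zero_mul] at h1
  filter_upwards [h1.eventually (gt_mem_nhds hε)] with n hn x
  rw [dist_eq_norm]
  refine (norm_autoconvolution_sub_le hf (hg n) x).trans_lt (lt_of_le_of_lt ?_ hn)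
  exact mul_le_mul_of_nonneg_left (add_le_add le_rfl (l2norm_le_add hf (hg n)))
    (l2norm_nonneg _)

/-- Vanishing outside the closed ball of radius `R`. -/
def VanishesOutside (f : Space d → ℂ) (R : ℝ) : Prop := ∀ x, R < ‖x‖ → f x = 0

theorem VanishesOutside.mono {f : Space d → ℂ} {R R' : ℝ} (h : VanishesOutside f R)
    (hR : R ≤ R') : VanishesOutside f R' := fun x hx => h x (hR.trans_lt hx)

theorem VanishesOutside.hasCompactSupport {f : Space d → ℂ} {R : ℝ} (h : VanishesOutside f R) :
    HasCompactSupport f :=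
  HasCompactSupport.intro (isCompact_closedBall 0 R) fun x hx => h x (by simpa using hx)

theorem exists_vanishesOutside {f : Space d → ℂ} (hf : HasCompactSupport f) :
    ∃ R > 0, VanishesOutside f R := by
  obtain ⟨R, hR⟩ := hf.isBounded.subset_closedBall (0 : Space d)
  refine ⟨max R 1, by positivity, fun x hx => image_eq_zero_of_notMem_tsupport fun h => ?_⟩
  have := hR h
  simp only [Metric.mem_closedBall, dist_zero_right] at this
  exact absurd (this.trans (le_max_left R 1)) (not_le.2 hx)

theorem VanishesOutside.crossCorrelation {f g : Space d → ℂ} {R S : ℝ}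
    (hf : VanishesOutside f R) (hg : VanishesOutside g S) :
    VanishesOutside (crossCorrelation f g) (R + S) := by
  intro x hx
  rw [Hyperuniformity.crossCorrelation]
  refine integral_eq_zero_of_ae (ae_of_all _ fun v => ?_)
  simp only [Pi.zero_apply]
  by_cases hv : S < ‖v‖
  · simp [hg v hv]
  · rw [hf (x + v), zero_mul]
    have : ‖x‖ ≤ ‖x + v‖ + ‖v‖ := by
      have := norm_sub_le (x + v) v
      simpa using this
    linarith [not_lt.1 hv]

theorem VanishesOutside.autoconvolution {f : Space d → ℂ} {R : ℝ}
    (hf : VanishesOutside f R) : VanishesOutside (autoconvolution f) (2 * R) := by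
  rw [autoconvolution_eq, two_mul]
  exact hf.crossCorrelation hf

theorem autoconvolution_eq_convolution (f : Space d → ℂ) :
    autoconvolution f =
      convolution f (fun x => conj (f (-x))) (ContinuousLinearMap.mul ℂ ℂ) volume := by
  ext x
  rfl

theorem memLp_of_continuous {f : Space d → ℂ} (hf : Continuous f) (hs : HasCompactSupport f)
    (q : ℝ≥0∞) : MemLp f q :=
  hf.memLp_of_hasCompactSupport hs

theorem continuous_autoconvolution_of_continuous {f : Space d → ℂ} (hf : Continuous f)
    (hs : HasCompactSupport f) : Continuous (autoconvolution f) := by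
  rw [autoconvolution_eq_convolution]
  refine HasCompactSupport.continuous_convolution_right _ ?_ hf.locallyIntegrable ?_
  · obtain ⟨R, -, hR⟩ := exists_vanishesOutside hs
    exact VanishesOutside.hasCompactSupport (R := R) fun x hx => by simp [hR (-x) (by simpa)]
  · fun_prop

/-- Smooth `L²` approximants are cut off by a bump equal to one on the ball of radius `R`. As the
bump is at most one and `f` vanishes where it differs from one, the cutoff does not increase the
error, and all approximants live in one common ball. -/
theorem exists_smooth_approx {f : Space d → ℂ} (hf : MemLp f 2) {R : ℝ} (hR : 0 < R)
    (hs : VanishesOutside f R) :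
    ∃ g : ℕ → Space d → ℂ, (∀ n, ContDiff ℝ ∞ (g n)) ∧ (∀ n, VanishesOutside (g n) (R + 1)) ∧
      Tendsto (fun n => l2norm (f - g n)) atTop (𝓝 0) := by
  let b : ContDiffBump (0 : Space d) := ⟨R, R + 1, hR, by linarith⟩
  have key : ∀ n : ℕ, ∃ g : Space d → ℂ, ContDiff ℝ ∞ g ∧ VanishesOutside g (R + 1) ∧
      l2norm (f - g) ≤ 1 / ((n : ℝ) + 1) := by
    intro n
    obtain ⟨g, hg, hg', hfg⟩ := hf.exist_eLpNorm_sub_le (by norm_num) (by norm_num)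
      (ε := 1 / ((n : ℝ) + 1)) (by positivity)
    refine ⟨fun x => (b x : ℂ) * g x, ?_, fun x hx => ?_, ?_⟩
    · exact (Complex.ofRealCLM.contDiff.comp b.contDiff).mul hg'
    · have h0 : b x = 0 := b.zero_of_le_dist (by simpa using! hx.le)
      simp [h0]
    · rw [l2norm]
      refine ENNReal.toReal_le_of_le_ofReal (by positivity) ((eLpNorm_mono fun x => ?_).trans hfg)
      by_cases hx : R < ‖x‖
      · simp only [Pi.sub_apply, hs x hx, zero_sub, norm_neg, norm_mul, Complex.norm_real]
        exact mul_le_of_le_one_left (norm_nonneg _)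
          (by rw [Real.norm_of_nonneg b.nonneg]; exact b.le_one)
      · rw [Pi.sub_apply, b.one_of_mem_closedBall (by simpa using not_lt.1 hx)]
        simp
  choose g hg1 hg2 hg3 using key
  exact ⟨g, hg1, hg2, squeeze_zero (fun n => l2norm_nonneg _) hg3
    tendsto_one_div_add_atTop_nhds_zero_nat⟩

theorem continuous_autoconvolution {f : Space d → ℂ} (hf : MemLp f 2) {R : ℝ} (hR : 0 < R)
    (hs : VanishesOutside f R) : Continuous (autoconvolution f) := by
  obtain ⟨g, hg, hgs, hfg⟩ := exists_smooth_approx hf hR hs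
  refine (tendstoUniformly_autoconvolution hf
    (fun n => memLp_of_continuous (hg n).continuous (hgs n).hasCompactSupport 2) hfg).continuous
    (Frequently.of_forall fun n => ?_)
  exact continuous_autoconvolution_of_continuous (hg n).continuous (hgs n).hasCompactSupport

/-! ### Plane waves and the Fourier transform -/

/-- The plane wave `x ↦ exp(2πi ⟨x, ξ⟩)`. -/
noncomputable def wave (ξ x : Space d) : ℂ :=
  Complex.exp (((2 * Real.pi * inner ℝ x ξ : ℝ) : ℂ) * Complex.I)

@[simp] theorem norm_wave (ξ x : Space d) : ‖wave ξ x‖ = 1 :=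
  Complex.norm_exp_ofReal_mul_I _

@[simp] theorem wave_zero (x : Space d) : wave 0 x = 1 := by simp [wave]

theorem wave_add (ξ x y : Space d) : wave ξ (x + y) = wave ξ x * wave ξ y := by
  rw [wave, wave, wave, ← Complex.exp_add, inner_add_left]
  congr 1
  push_cast
  ring

theorem wave_comm (ξ x : Space d) : wave ξ x = wave x ξ := by
  rw [wave, wave, real_inner_comm]

theorem conj_wave (ξ x : Space d) : conj (wave ξ x) = wave (-ξ) x := by
  rw [wave, wave, ← Complex.exp_conj, inner_neg_right, map_mul, Complex.conj_ofReal, Complex.conj_I]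
  simp

theorem wave_neg_neg (ξ x : Space d) : wave (-ξ) (-x) = wave ξ x := by
  simp [wave]

@[fun_prop] theorem Continuous.wave {X : Type*} [TopologicalSpace X] {f g : X → Space d}
    (hf : Continuous f) (hg : Continuous g) : Continuous fun x => wave (f x) (g x) := by
  unfold Hyperuniformity.wave
  fun_prop

theorem fourier_eq_wave (f : Space d → ℂ) (ξ : Space d) :
    𝓕 f ξ = ∫ v, wave (-ξ) v * f v := by
  rw [Real.fourier_eq']
  congr 1
  ext v
  simp [wave]

theorem fourierInv_eq_wave (f : Space d → ℂ) (ξ : Space d) :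
    𝓕⁻ f ξ = ∫ v, wave ξ v * f v := by
  rw [Real.fourierInv_eq']
  congr 1

theorem fourier_conj_neg (f : Space d → ℂ) (ξ : Space d) :
    𝓕 (fun x => conj (f (-x))) ξ = conj (𝓕 f ξ) := by
  rw [fourier_eq_wave, fourier_eq_wave, ← integral_conj,
    ← integral_neg_eq_self (fun v => conj (wave (-ξ) v * f v))]
  congr 1
  ext v
  rw [map_mul, conj_wave, ← wave_neg_neg, neg_neg]

theorem fourier_autoconvolution {f : Space d → ℂ} (hf : Integrable f) (ξ : Space d) :
    𝓕 (autoconvolution f) ξ = ((‖𝓕 f ξ‖ ^ 2 : ℝ) : ℂ) := by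
  have hf' : Integrable (fun x => conj (f (-x))) := by
    exact (LinearIsometryEquiv.integrable_comp_iff Complex.conjLIE).2 hf.comp_neg
  rw [autoconvolution_eq_convolution, Real.fourier_mul_convolution_eq hf hf', fourier_conj_neg,
    Complex.mul_conj, Complex.normSq_eq_norm_sq]

theorem integrable_of_vanishesOutside {f : Space d → ℂ} (hf : MemLp f 2) {R : ℝ}
    (hs : VanishesOutside f R) : Integrable f := by
  have h : MemLp f 2 (volume.restrict (Metric.closedBall 0 R)) := hf.restrict _
  have : IsFiniteMeasure (volume.restrict (Metric.closedBall (0 : Space d) R)) :=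
    ⟨by simpa using measure_closedBall_lt_top⟩
  have h1 : IntegrableOn f (Metric.closedBall 0 R) := h.integrable (by norm_num)
  rwa [integrableOn_iff_integrable_of_support_subset] at h1
  intro x hx
  by_contra hx'
  exact hx (hs x (by simpa using hx'))

/-- Cauchy–Schwarz against the indicator of the supporting ball. On a fixed support, `L²`
convergence thus forces pointwise convergence of Fourier transforms. -/
theorem norm_fourier_le {f : Space d → ℂ} (hf : MemLp f 2) {R : ℝ}
    (hs : VanishesOutside f R) (ξ : Space d) :
    ‖𝓕 f ξ‖ ≤ l2norm ((Metric.closedBall (0 : Space d) R).indicator fun _ => (1 : ℂ)) *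
      l2norm f := by
  have h1 : MemLp ((Metric.closedBall (0 : Space d) R).indicator fun _ => (1 : ℂ)) 2 :=
    memLp_indicator_const _ measurableSet_closedBall _ (Or.inr measure_closedBall_lt_top.ne)
  have h2 : MemLp (fun v => wave (-ξ) v * f v) 2 := by
    refine hf.of_le ?_ (ae_of_all _ fun v => by simp)
    exact (Continuous.aestronglyMeasurable (by fun_prop)).mul hf.1
  have h3 : l2norm (fun v => wave (-ξ) v * f v) =
      l2norm f := by
    rw [l2norm, l2norm, eLpNorm_congr_norm_ae (g := f) (ae_of_all _ fun v => by simp)]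
  rw [← h3]
  refine le_trans (le_of_eq ?_) (integral_mul_norm_le h1 h2)
  rw [fourier_eq_wave]
  congr 2
  ext v
  by_cases hv : R < ‖v‖
  · simp [hs v hv]
  · simp [Set.indicator_of_mem (show v ∈ Metric.closedBall (0 : Space d) R by
      simpa using not_lt.1 hv)]

theorem fourier_sub {f g : Space d → ℂ} (hf : Integrable f) (hg : Integrable g) (ξ : Space d) :
    𝓕 (f - g) ξ = 𝓕 f ξ - 𝓕 g ξ := by
  rw [Real.fourier_eq, Real.fourier_eq, Real.fourier_eq, ← integral_sub]
  · simp [smul_sub]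
  · exact (Real.fourierIntegral_convergent_iff ξ).2 hf
  · exact (Real.fourierIntegral_convergent_iff ξ).2 hg

theorem tendsto_fourier {f : Space d → ℂ} {g : ℕ → Space d → ℂ}
    (hf : MemLp f 2) (hg : ∀ n, MemLp (g n) 2) {R : ℝ} (hfs : VanishesOutside f R)
    (hgs : ∀ n, VanishesOutside (g n) R)
    (h : Tendsto (fun n => l2norm (f - g n)) atTop (𝓝 0)) (ξ : Space d) :
    Tendsto (fun n => 𝓕 (g n) ξ) atTop (𝓝 (𝓕 f ξ)) := by
  rw [tendsto_iff_norm_sub_tendsto_zero]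
  have h1 := h.const_mul
    (l2norm ((Metric.closedBall (0 : Space d) R).indicator fun _ => (1 : ℂ)))
  rw [mul_zero] at h1
  refine squeeze_zero (fun n => norm_nonneg _) (fun n => ?_) h1
  rw [norm_sub_rev, ← fourier_sub (integrable_of_vanishesOutside hf hfs)
    (integrable_of_vanishesOutside (hg n) (hgs n))]
  exact norm_fourier_le (hf.sub (hg n)) (fun x hx => by simp [hfs x hx, hgs n x hx]) ξ

theorem continuous_fourier {f : Space d → ℂ} (hf : Integrable f) : Continuous (𝓕 f) :=
  VectorFourier.fourierIntegral_continuous Real.continuous_fourierChar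
    (by exact continuous_inner) hf

/-- Dilation and modulation of an autoconvolution. -/
theorem autoconvolution_dilate_modulate (f : Space d → ℂ) {t : ℝ} (ht : 0 < t) (ξ x : Space d) :
    autoconvolution (fun y => wave ξ y * f (t⁻¹ • y)) x =
      (t : ℂ) ^ d * (wave ξ x * autoconvolution f (t⁻¹ • x)) := by
  rw [autoconvolution_eq, autoconvolution_eq, crossCorrelation, crossCorrelation]
  have h := Measure.integral_comp_inv_smul (volume : Measure (Space d))
    (fun v => f (t⁻¹ • x + v) * conj (f v)) t
  rw [finrank_euclideanSpace_fin, abs_of_pos (pow_pos ht d)] at h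
  have h2 : ∀ v : Space d, wave ξ (x + v) * f (t⁻¹ • (x + v)) *
      conj (wave ξ v * f (t⁻¹ • v)) =
      wave ξ x * (f (t⁻¹ • x + t⁻¹ • v) * conj (f (t⁻¹ • v))) := by
    intro v
    have h3 : wave ξ v * conj (wave ξ v)
        = 1 := by
      rw [Complex.mul_conj, Complex.normSq_eq_norm_sq]; simp
    rw [wave_add, smul_add, map_mul]
    linear_combination wave ξ x * f (t⁻¹ • x + t⁻¹ • v) *
      conj (f (t⁻¹ • v)) * h3
  simp_rw [h2]
  rw [integral_const_mul, h]
  simp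
  ring

end Hyperuniformity

/-! ### Vague limits of sequences of densities -/

namespace Hyperuniformity

open scoped ContDiff ENNReal ComplexConjugate CompactlySupported

variable {d : ℕ}

theorem exists_tendsto_ultrafilter {u : ℕ → ℝ} {C : ℝ} (h : ∀ n, |u n| ≤ C)
    (𝒰 : Ultrafilter ℕ) : ∃ a, Tendsto u 𝒰 (𝓝 a) := by
  have h1 : (𝒰.map u : Filter ℝ) ≤ 𝓟 (Set.Icc (-C) C) := by
    rw [le_principal_iff]
    exact Filter.mem_map.2 (univ_mem' fun n => abs_le.1 (h n))
  obtain ⟨a, -, ha⟩ := isCompact_Icc.ultrafilter_le_nhds (𝒰.map u) h1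
  exact ⟨a, ha⟩

theorem tendsto_limUnder_ultrafilter {u : ℕ → ℝ} {C : ℝ} (h : ∀ n, |u n| ≤ C)
    (𝒰 : Ultrafilter ℕ) : Tendsto u 𝒰 (𝓝 (limUnder 𝒰 u)) :=
  tendsto_nhds_limUnder (exists_tendsto_ultrafilter h 𝒰)

/-- A vaguely bounded sequence of absolutely continuous measures converges vaguely along a free
ultrafilter. -/
theorem exists_vague_limit (w : ℕ → Space d → ℝ) (hw : ∀ n, Continuous (w n))
    (hw0 : ∀ n ξ, 0 ≤ w n ξ)
    (hb : ∀ g : Space d → ℝ, Continuous g → HasCompactSupport g →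
      ∃ C, ∀ n, |∫ ξ, g ξ * w n ξ| ≤ C) :
    ∃ ν : Measure (Space d), IsLocallyFiniteMeasure ν ∧
      ∀ g : Space d → ℝ, Continuous g → HasCompactSupport g →
        Tendsto (fun n => ∫ ξ, g ξ * w n ξ) (hyperfilter ℕ) (𝓝 (∫ ξ, g ξ ∂ν)) := by
  have hint : ∀ (g : Space d → ℝ) (n : ℕ), Continuous g → HasCompactSupport g →
      Integrable fun ξ => g ξ * w n ξ := fun g n hg hgs =>
    (hg.mul (hw n)).integrable_of_hasCompactSupport hgs.mul_right
  have hlim : ∀ g : Space d → ℝ, Continuous g → HasCompactSupport g →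
      Tendsto (fun n => ∫ ξ, g ξ * w n ξ) (hyperfilter ℕ)
        (𝓝 (limUnder (hyperfilter ℕ : Filter ℕ) fun n => ∫ ξ, g ξ * w n ξ)) := by
    intro g hg hgs
    obtain ⟨C, hC⟩ := hb g hg hgs
    exact tendsto_limUnder_ultrafilter hC _
  -- Along an ultrafilter every bounded sequence converges, so the limits exist for all test
  -- functions at once, without a diagonal argument. The limit functional is linear and positive;
  -- Riesz–Markov–Kakutani represents it by a measure.
  let L : C_c(Space d, ℝ) →ₗ[ℝ] ℝ :=
    { toFun := fun g => limUnder (hyperfilter ℕ : Filter ℕ) fun n => ∫ ξ, g ξ * w n ξ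
      map_add' := by
        intro f g
        refine tendsto_nhds_unique
          (hlim _ (f + g).continuous (f + g).hasCompactSupport) ?_
        refine ((hlim _ f.continuous f.hasCompactSupport).add
          (hlim _ g.continuous g.hasCompactSupport)).congr fun n => ?_
        refine (integral_add (hint f n f.continuous f.hasCompactSupport)
          (hint g n g.continuous g.hasCompactSupport)).symm.trans ?_
        simp [add_mul]
      map_smul' := by
        intro c f
        refine tendsto_nhds_unique
          (hlim _ (c • f).continuous (c • f).hasCompactSupport) ?_
        refine ((hlim _ f.continuous f.hasCompactSupport).const_mul c).congr fun n => ?_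
        rw [← integral_const_mul]
        simp [mul_assoc] }
  let Λ : C_c(Space d, ℝ) →ₚ[ℝ] ℝ := PositiveLinearMap.mk₀ L fun g hg =>
    ge_of_tendsto (hlim _ g.continuous g.hasCompactSupport) (Eventually.of_forall fun n =>
      integral_nonneg fun ξ => mul_nonneg (hg ξ) (hw0 n ξ))
  refine ⟨RealRMK.rieszMeasure Λ, inferInstance, fun g hg hgs => ?_⟩
  have := RealRMK.integral_rieszMeasure Λ ⟨⟨g, hg⟩, hgs⟩
  have h2 := hlim g hg hgs
  exact this ▸ h2

/-- Passing to a vague limit for a function with a uniformly bounded second moment. -/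
theorem integral_eq_of_vague_limit {w : ℕ → Space d → ℝ} (hw : ∀ n, Continuous (w n))
    (hw0 : ∀ n ξ, 0 ≤ w n ξ) {ν : Measure (Space d)}
    (hν : ∀ g : Space d → ℝ, Continuous g → HasCompactSupport g →
      Tendsto (fun n => ∫ ξ, g ξ * w n ξ) (hyperfilter ℕ) (𝓝 (∫ ξ, g ξ ∂ν)))
    [IsLocallyFiniteMeasure ν]
    {F : Space d → ℝ} (hF : Continuous F) (hF0 : ∀ ξ, 0 ≤ F ξ)
    (hFi : ∀ n, Integrable fun ξ => F ξ * w n ξ)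
    (hFi2 : ∀ n, Integrable fun ξ => ‖ξ‖ ^ 2 * F ξ * w n ξ) {C : ℝ}
    (hC : ∀ n, ∫ ξ, ‖ξ‖ ^ 2 * F ξ * w n ξ ≤ C) {q : ℝ}
    (hq : Tendsto (fun n => ∫ ξ, F ξ * w n ξ) atTop (𝓝 q)) :
    Integrable F ν ∧ ∫ ξ, F ξ ∂ν = q := by
  let b : ℕ → ContDiffBump (0 : Space d) := fun k => ⟨k + 1, k + 2, by positivity, by linarith⟩
  have hbc : ∀ k, Continuous fun ξ => b k ξ * F ξ := fun k => (b k).continuous.mul hF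
  have hbs : ∀ k, HasCompactSupport fun ξ => b k ξ * F ξ := fun k =>
    (b k).hasCompactSupport.mul_right
  have hqU : Tendsto (fun n => ∫ ξ, F ξ * w n ξ) (hyperfilter ℕ) (𝓝 q) :=
    hq.mono_left Nat.hyperfilter_le_atTop
  have hbi : ∀ k n, Integrable fun ξ => b k ξ * F ξ * w n ξ := fun k n =>
    ((hbc k).mul (hw n)).integrable_of_hasCompactSupport (hbs k).mul_right
  -- The cut-off functions `b k * F` are compactly supported, so the vague limit applies to them;
  -- they lie below `F`.
  have hupper : ∀ k, ∫ ξ, b k ξ * F ξ ∂ν ≤ q := by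
    intro k
    refine le_of_tendsto_of_tendsto' (hν _ (hbc k) (hbs k)) hqU fun n => ?_
    refine integral_mono (hbi k n) (hFi n) fun ξ => ?_
    exact mul_le_mul_of_nonneg_right (mul_le_of_le_one_left (hF0 ξ) (b k).le_one) (hw0 n ξ)
  -- Tightness by Chebyshev: where `b k` differs from one, `1 ≤ ‖ξ‖² / (k + 1)²`, so the second
  -- moment bounds the mass lost by the cutoff, uniformly in `n`.
  have hlower : ∀ k : ℕ, q - C / ((k : ℝ) + 1) ^ 2 ≤ ∫ ξ, b k ξ * F ξ ∂ν := by
    intro k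
    refine le_of_tendsto_of_tendsto' (hqU.sub_const _) (hν _ (hbc k) (hbs k)) fun n => ?_
    have h1 : ∫ ξ, F ξ * w n ξ ≤ ∫ ξ, (b k ξ * F ξ * w n ξ +
        (((k : ℝ) + 1) ^ 2)⁻¹ * (‖ξ‖ ^ 2 * F ξ * w n ξ)) := by
      refine integral_mono (hFi n) ((hbi k n).add ((hFi2 n).const_mul _)) fun ξ => ?_
      have hFw := mul_nonneg (hF0 ξ) (hw0 n ξ)
      have hk : (0 : ℝ) < ((k : ℝ) + 1) ^ 2 := by positivity
      by_cases hξ : ‖ξ‖ ≤ (k : ℝ) + 1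
      · have hb1 : b k ξ = 1 := (b k).one_of_mem_closedBall (by simpa using! hξ)
        simp only [hb1, one_mul]
        have : 0 ≤ (((k : ℝ) + 1) ^ 2)⁻¹ * (‖ξ‖ ^ 2 * F ξ * w n ξ) := by
          rw [mul_assoc]; positivity
        linarith
      · have hb0 : 0 ≤ b k ξ * F ξ * w n ξ := by
          rw [mul_assoc]; exact mul_nonneg (b k).nonneg hFw
        have h2 : 1 ≤ (((k : ℝ) + 1) ^ 2)⁻¹ * ‖ξ‖ ^ 2 := by
          rw [inv_mul_eq_div, one_le_div hk]
          gcongr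
          exact (not_le.1 hξ).le
        have h3 := mul_le_mul_of_nonneg_right h2 hFw
        dsimp only
        nlinarith
    rw [integral_add (hbi k n) ((hFi2 n).const_mul _), integral_const_mul] at h1
    have h2 : (((k : ℝ) + 1) ^ 2)⁻¹ * ∫ ξ, ‖ξ‖ ^ 2 * F ξ * w n ξ ≤ C / ((k : ℝ) + 1) ^ 2 := by
      rw [div_eq_inv_mul]
      exact mul_le_mul_of_nonneg_left (hC n) (by positivity)
    linarith
  have hpt : ∀ ξ, Tendsto (fun k => b k ξ * F ξ) atTop (𝓝 (F ξ)) := by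
    intro ξ
    refine tendsto_const_nhds.congr' ?_
    filter_upwards [eventually_ge_atTop ⌈‖ξ‖⌉₊] with k hk
    have hb1 : b k ξ = 1 := (b k).one_of_mem_closedBall (by
      have : ‖ξ‖ ≤ k := Nat.ceil_le.1 hk
      simpa using! this.trans (by simp : (k : ℝ) ≤ k + 1))
    simp [hb1]
  -- Fatou's lemma along the cutoffs, using the upper bound `q`.
  have hFint : Integrable F ν := by
    refine ⟨hF.aestronglyMeasurable, ?_⟩
    rw [hasFiniteIntegral_iff_ofReal (ae_of_all _ hF0)]
    have h1 : ∀ k, ∫⁻ ξ, ENNReal.ofReal (b k ξ * F ξ) ∂ν ≤ ENNReal.ofReal q := by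
      intro k
      rw [← ofReal_integral_eq_lintegral_ofReal
        ((hbc k).integrable_of_hasCompactSupport (hbs k))
        (ae_of_all _ fun ξ => mul_nonneg (b k).nonneg (hF0 ξ))]
      exact ENNReal.ofReal_le_ofReal (hupper k)
    have h2 : ∫⁻ ξ, ENNReal.ofReal (F ξ) ∂ν ≤
        liminf (fun k => ∫⁻ ξ, ENNReal.ofReal (b k ξ * F ξ) ∂ν) atTop := by
      refine le_trans (le_of_eq ?_) (lintegral_liminf_le fun k =>
        (hbc k).measurable.ennreal_ofReal)
      refine lintegral_congr fun ξ => ?_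
      exact ((ENNReal.continuous_ofReal.tendsto _).comp (hpt ξ)).liminf_eq.symm
    refine lt_of_le_of_lt (h2.trans ?_) (ENNReal.ofReal_lt_top (r := q))
    exact liminf_le_of_le (by isBoundedDefault) fun a ha => by
      obtain ⟨k, hk⟩ := ha.exists
      exact hk.trans (h1 k)
  refine ⟨hFint, ?_⟩
  have h1 : Tendsto (fun k => ∫ ξ, b k ξ * F ξ ∂ν) atTop (𝓝 (∫ ξ, F ξ ∂ν)) := by
    refine tendsto_integral_of_dominated_convergence F
      (fun k => (hbc k).aestronglyMeasurable) hFint (fun k => ae_of_all _ fun ξ => ?_)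
      (ae_of_all _ hpt)
    rw [Real.norm_of_nonneg (mul_nonneg (b k).nonneg (hF0 ξ))]
    exact mul_le_of_le_one_left (hF0 ξ) (b k).le_one
  have h2 : Tendsto (fun k : ℕ => q - C / ((k : ℝ) + 1) ^ 2) atTop (𝓝 (q - 0)) := by
    refine tendsto_const_nhds.sub (Tendsto.const_div_atTop ?_ C)
    exact (tendsto_pow_atTop (by norm_num)).comp
      (tendsto_atTop_add_const_right _ _ tendsto_natCast_atTop_atTop)
  rw [sub_zero] at h2
  exact tendsto_nhds_unique h1 (tendsto_of_tendsto_of_tendsto_of_le_of_le h2 tendsto_const_nhds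
    hlower hupper)

end Hyperuniformity

/-! ### Pairings with differences of measures, and test functions -/

namespace Hyperuniformity

open scoped ContDiff ENNReal ComplexConjugate

variable {d : ℕ}

/-- The integral against the difference of two measures. -/
noncomputable def pairing (α β : Measure (Space d)) (f : Space d → ℂ) : ℂ :=
  (∫ x, f x ∂α) - ∫ x, f x ∂β

theorem pairing_const_mul (α β : Measure (Space d)) (c : ℂ) (f : Space d → ℂ) :
    pairing α β (fun x => c * f x) = c * pairing α β f := by
  simp [pairing, integral_const_mul, mul_sub]

theorem norm_integral_le_of_vanishesOutside {f : Space d → ℂ} {R c : ℝ}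
    (hs : VanishesOutside f R) (hc : ∀ x, ‖f x‖ ≤ c) (μ : Measure (Space d))
    [IsLocallyFiniteMeasure μ] : ‖∫ x, f x ∂μ‖ ≤ c * μ.real (Metric.closedBall 0 R) := by
  rw [← setIntegral_eq_integral_of_forall_compl_eq_zero (s := Metric.closedBall 0 R)
    fun x hx => hs x (by simpa using hx)]
  exact norm_setIntegral_le_of_norm_le_const measure_closedBall_lt_top fun x _ => hc x

theorem tendsto_integral_of_vanishesOutside {f : ℕ → Space d → ℂ} {g : Space d → ℂ} {R c : ℝ}
    (hf : ∀ n, Continuous (f n))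
    (hs : ∀ n, VanishesOutside (f n) R) (hc : ∀ n x, ‖f n x‖ ≤ c)
    (h : ∀ x, Tendsto (fun n => f n x) atTop (𝓝 (g x))) (μ : Measure (Space d))
    [IsLocallyFiniteMeasure μ] : Tendsto (fun n => ∫ x, f n x ∂μ) atTop (𝓝 (∫ x, g x ∂μ)) := by
  refine tendsto_integral_of_dominated_convergence
    ((Metric.closedBall 0 R).indicator fun _ => c) (fun n => (hf n).aestronglyMeasurable) ?_
    (fun n => ae_of_all _ fun x => ?_) (ae_of_all _ h)
  · rw [integrable_indicator_iff measurableSet_closedBall]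
    exact integrableOn_const measure_closedBall_lt_top.ne
  · by_cases hx : R < ‖x‖
    · simp [hs n x hx, hx]
    · rw [Set.indicator_of_mem (by simpa using not_lt.1 hx)]
      exact hc n x

section

variable {α β : Measure (Space d)} [IsLocallyFiniteMeasure α] [IsLocallyFiniteMeasure β]

theorem norm_pairing_le {f : Space d → ℂ} {R c : ℝ}
    (hs : VanishesOutside f R) (hc : ∀ x, ‖f x‖ ≤ c) : ‖pairing α β f‖ ≤
      c * (α.real (Metric.closedBall 0 R) + β.real (Metric.closedBall 0 R)) := by
  rw [mul_add]
  exact (norm_sub_le _ _).trans (add_le_add (norm_integral_le_of_vanishesOutside hs hc α)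
    (norm_integral_le_of_vanishesOutside hs hc β))

theorem tendsto_pairing {f : ℕ → Space d → ℂ} {g : Space d → ℂ} {R c : ℝ}
    (hf : ∀ n, Continuous (f n))
    (hs : ∀ n, VanishesOutside (f n) R) (hc : ∀ n x, ‖f n x‖ ≤ c)
    (h : ∀ x, Tendsto (fun n => f n x) atTop (𝓝 (g x))) :
    Tendsto (fun n => pairing α β (f n)) atTop (𝓝 (pairing α β g)) :=
  (tendsto_integral_of_vanishesOutside hf hs hc h α).sub
    (tendsto_integral_of_vanishesOutside hf hs hc h β)

end

/-- Fubini for the Fourier transform of a measure with a compactly supported density. -/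
theorem integral_mul_integral_wave {φ k : Space d → ℂ} (hφ : Integrable φ) (hk : Continuous k)
    (hks : HasCompactSupport k) (μ : Measure (Space d)) [IsLocallyFiniteMeasure μ] :
    ∫ ξ, φ ξ * (∫ x, wave ξ x * k x ∂μ) = ∫ x, k x * 𝓕⁻ φ x ∂μ := by
  have hki : Integrable k μ := hk.integrable_of_hasCompactSupport hks
  simp_rw [← integral_const_mul]
  rw [integral_integral_swap]
  · refine integral_congr_ae (ae_of_all _ fun x => ?_)
    simp only [fourierInv_eq_wave]
    rw [← integral_const_mul]
    refine integral_congr_ae (ae_of_all _ fun ξ => ?_)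
    simp only [wave_comm ξ x]
    ring
  · refine (hφ.mul_prod hki).mono ?_ (ae_of_all _ fun z => ?_)
    · refine hφ.1.comp_fst.mul (Continuous.aestronglyMeasurable ?_)
      fun_prop
    · simp [Function.uncurry]

theorem continuous_integral_wave {k : Space d → ℂ} (hk : Continuous k)
    (hks : HasCompactSupport k) (μ : Measure (Space d)) [IsLocallyFiniteMeasure μ] :
    Continuous fun ξ => ∫ x, wave ξ x * k x ∂μ := by
  have hki : Integrable k μ := hk.integrable_of_hasCompactSupport hks
  refine continuous_of_dominated (bound := fun x => ‖k x‖)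
    (fun ξ => Continuous.aestronglyMeasurable (by fun_prop))
    (fun ξ => ae_of_all _ fun x => by simp) hki.norm (ae_of_all _ fun x => by fun_prop)

theorem integrable_fourier_smooth {f : Space d → ℂ} (hf : ContDiff ℝ ∞ f)
    (hs : HasCompactSupport f) : Integrable (fun ξ => ‖𝓕 f ξ‖ ^ 2) := by
  have h := (𝓕 (hs.toSchwartzMap hf)).memLp 2 (volume : Measure (Space d))
  rw [SchwartzMap.fourier_coe] at h
  exact h.integrable_norm_pow (by norm_num)

/-- Fourier inversion for the autoconvolution, whose transform is `|𝓕 f|²`. Smoothness of `f` makes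
`𝓕 f` a Schwartz function, which gives the integrability that inversion needs. -/
theorem fourierInv_norm_fourier_sq {f : Space d → ℂ} (hf : ContDiff ℝ ∞ f)
    (hs : HasCompactSupport f) :
    𝓕⁻ (fun ξ => ((‖𝓕 f ξ‖ ^ 2 : ℝ) : ℂ)) = autoconvolution f := by
  have hf2 := memLp_of_continuous hf.continuous hs 2
  obtain ⟨R, hR, hfR⟩ := exists_vanishesOutside hs
  have h1 : 𝓕 (autoconvolution f) = fun ξ => ((‖𝓕 f ξ‖ ^ 2 : ℝ) : ℂ) :=
    funext fun ξ => fourier_autoconvolution (hf.continuous.integrable_of_hasCompactSupport hs) ξ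
  have hc := continuous_autoconvolution_of_continuous hf.continuous hs
  rw [← h1]
  refine hc.fourierInv_fourier_eq
    (hc.integrable_of_hasCompactSupport hfR.autoconvolution.hasCompactSupport) ?_
  rw [h1]
  exact (integrable_fourier_smooth hf hs).ofReal

/-- A bump normalized in `L²`, since the autoconvolution at zero is the squared `L²` norm. Dilates
of this autoconvolution form an approximate unit of positive-definite functions. -/
theorem exists_autoconvolution_zero_eq_one (d : ℕ) : ∃ h : Space d → ℂ, Continuous h ∧
    HasCompactSupport h ∧ autoconvolution h 0 = 1 := by
  let b : ContDiffBump (0 : Space d) := ⟨1, 2, by norm_num, by norm_num⟩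
  have hs : 0 < ∫ x, b x ^ 2 := by
    refine Continuous.integral_pos_of_hasCompactSupport_nonneg_nonzero (x := 0)
      (b.continuous.pow 2) ?_ (fun x => sq_nonneg _) ?_
    · have : (fun x => b x ^ 2) = fun x => b x * b x := by ext; ring
      rw [this]
      exact b.hasCompactSupport.mul_right
    · rw [b.one_of_mem_closedBall (by simpa using b.rIn_pos.le)]
      norm_num
  refine ⟨fun x => (((√(∫ x, b x ^ 2))⁻¹ * b x : ℝ) : ℂ), ?_, ?_, ?_⟩
  · exact Complex.continuous_ofReal.comp (continuous_const.mul b.continuous)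
  · have h1 : HasCompactSupport fun x => (√(∫ x, b x ^ 2))⁻¹ * b x := b.hasCompactSupport.mul_left
    exact h1.comp_left (g := fun r : ℝ => (r : ℂ)) (by simp)
  · rw [autoconvolution_eq, crossCorrelation]
    simp only [zero_add, Complex.conj_ofReal]
    simp_rw [← Complex.ofReal_mul]
    rw [integral_complex_ofReal]
    have : ∀ x, (√(∫ x, b x ^ 2))⁻¹ * b x * ((√(∫ x, b x ^ 2))⁻¹ * b x) =
        (∫ x, b x ^ 2)⁻¹ * b x ^ 2 := by
      intro x
      have h2 : (√(∫ x, b x ^ 2))⁻¹ * (√(∫ x, b x ^ 2))⁻¹ = (∫ x, b x ^ 2)⁻¹ := by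
        rw [← mul_inv, Real.mul_self_sqrt hs.le]
      rw [← h2]
      ring
    simp_rw [this]
    rw [integral_const_mul, inv_mul_cancel₀ hs.ne']
    simp

/-- A nonnegative function whose Fourier transform is at least one on a ball. -/
theorem one_le_norm_fourier {φ : Space d → ℝ} (h0 : ∀ x, 0 ≤ φ x) (hi : Integrable φ)
    (h2 : ∫ x, φ x = 2) {R : ℝ} (hR : 0 < R)
    (hs : ∀ x, 1 / (2 * Real.pi * (2 * R)) < ‖x‖ → φ x = 0) {ξ : Space d} (hξ : ‖ξ‖ ≤ R) :
    1 ≤ ‖𝓕 (fun x => (φ x : ℂ)) ξ‖ := by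
  have hwi : Integrable fun v => wave (-ξ) v * (φ v : ℂ) :=
    hi.ofReal.bdd_mul (c := 1) (Continuous.aestronglyMeasurable (by fun_prop))
      (ae_of_all _ fun x => by simp)
  -- The support radius `1 / (4πR)` keeps the phase `2π|⟨v, ξ⟩|` at most `1/2`, so replacing the
  -- wave by one changes the total mass `2` by at most `1`.
  have h3 : ‖𝓕 (fun x => (φ x : ℂ)) ξ - 2‖ ≤ 1 := by
    have h4 : 𝓕 (fun x => (φ x : ℂ)) ξ - 2 = ∫ v, (wave (-ξ) v - 1) * (φ v : ℂ) := by
      have h5 : (2 : ℂ) = ∫ v, (φ v : ℂ) := by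
        rw [integral_complex_ofReal, h2]; simp
      rw [fourier_eq_wave, h5]
      refine (integral_sub hwi hi.ofReal).symm.trans ?_
      simp [sub_mul]
    rw [h4]
    have h6 : (1 : ℝ) = ∫ v, 1 / 2 * φ v := by
      rw [integral_const_mul, h2]; norm_num
    rw [h6]
    refine norm_integral_le_of_norm_le (hi.const_mul _) (ae_of_all _ fun v => ?_)
    rw [norm_mul, Complex.norm_real, Real.norm_of_nonneg (h0 v)]
    by_cases hv : 1 / (2 * Real.pi * (2 * R)) < ‖v‖
    · simp [hs v hv]
    · refine mul_le_mul_of_nonneg_right ?_ (h0 v)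
      have h7 := Real.norm_exp_I_mul_ofReal_sub_one_le (x := 2 * Real.pi * inner ℝ v (-ξ))
      rw [wave, mul_comm _ Complex.I]
      refine h7.trans ?_
      rw [Real.norm_eq_abs, abs_mul, abs_of_pos (by positivity : 0 < 2 * Real.pi),
        inner_neg_right, abs_neg]
      have h8 : |inner ℝ v ξ| ≤ 1 / (2 * Real.pi * (2 * R)) * R :=
        (abs_real_inner_le_norm v ξ).trans (mul_le_mul (not_lt.1 hv) hξ (norm_nonneg _)
          (by positivity))
      calc 2 * Real.pi * |inner ℝ v ξ| ≤ 2 * Real.pi * (1 / (2 * Real.pi * (2 * R)) * R) := by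
            gcongr
        _ = 1 / 2 := by field_simp
  have h9 := norm_sub_norm_le (2 : ℂ) (𝓕 (fun x => (φ x : ℂ)) ξ)
  rw [norm_sub_rev] at h9
  have : ‖(2 : ℂ)‖ = 2 := by simp
  linarith

/-- Supplies the majorant `c |𝓕 φ|²` of an arbitrary compactly supported function, by which bounds
on `∫ |𝓕 φ|² w` become vague bounds on `w`. -/
theorem exists_smooth_one_le_norm_fourier (d : ℕ) {R : ℝ} (hR : 0 < R) :
    ∃ φ : Space d → ℂ, ContDiff ℝ ∞ φ ∧ HasCompactSupport φ ∧ ∀ ξ, ‖ξ‖ ≤ R → 1 ≤ ‖𝓕 φ ξ‖ := by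
  have hr : 0 < 1 / (2 * Real.pi * (2 * R)) := by positivity
  let b : ContDiffBump (0 : Space d) :=
    ⟨1 / (2 * Real.pi * (2 * R)) / 2, 1 / (2 * Real.pi * (2 * R)), by positivity, half_lt_self hr⟩
  refine ⟨fun x => ((2 * b.normed volume x : ℝ) : ℂ), ?_, ?_, fun ξ hξ => ?_⟩
  · exact Complex.ofRealCLM.contDiff.comp (contDiff_const.mul b.contDiff_normed)
  · have h1 : HasCompactSupport fun x => 2 * b.normed volume x :=
      b.hasCompactSupport_normed.mul_left
    exact h1.comp_left (g := fun r : ℝ => (r : ℂ)) (by simp)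
  · refine one_le_norm_fourier (φ := fun x => 2 * b.normed volume x)
      (fun x => mul_nonneg zero_le_two (b.nonneg_normed x)) (b.integrable_normed.const_mul 2)
      (by rw [integral_const_mul, b.integral_normed]; norm_num) hR (fun x hx => ?_) hξ
    have : b.normed volume x = 0 := by
      rw [← Function.notMem_support, b.support_normed_eq, Metric.mem_ball, dist_zero_right]
      exact hx.le.not_gt
    simp [this]

/-- Differentiation multiplies the transform by a coordinate. The point is that `‖ξ‖² |𝓕 f|²` is
again a combination of functions `|𝓕 g|²` with `g` a test function, which yields the second moment
bound needed for tightness. -/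
theorem norm_sq_mul_norm_fourier_sq {f : Space d → ℂ} (hf : ContDiff ℝ ∞ f)
    (hs : HasCompactSupport f) (ξ : Space d) :
    (2 * Real.pi) ^ 2 * (‖ξ‖ ^ 2 * ‖𝓕 f ξ‖ ^ 2) =
      ∑ i, ‖𝓕 (fun x => fderiv ℝ f x (EuclideanSpace.single i 1)) ξ‖ ^ 2 := by
  have hfi := hf.continuous.integrable_of_hasCompactSupport hs (μ := volume)
  have hc : Continuous (fderiv ℝ f) := hf.continuous_fderiv (by simp)
  have hf'i := hc.integrable_of_hasCompactSupport (hs.fderiv ℝ) (μ := volume)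
  have h1 : ∀ i, 𝓕 (fun x => fderiv ℝ f x (EuclideanSpace.single i 1)) ξ =
      2 * Real.pi * Complex.I * ξ i * 𝓕 f ξ := by
    intro i
    rw [← Real.fourier_continuousLinearMap_apply hf'i,
      Real.fourier_fderiv hfi (hf.differentiable (by simp)) hf'i]
    have h2 : innerSL ℝ ξ (EuclideanSpace.single i 1) = ξ i := by
      rw [innerSL_apply_apply, EuclideanSpace.inner_single_right]
      simp
    rw [VectorFourier.fourierSMulRight_apply, _root_.neg_apply, _root_.neg_apply, h2]
    simp
    ring
  simp_rw [h1]
  rw [EuclideanSpace.norm_sq_eq ξ, Finset.sum_mul, Finset.mul_sum]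
  refine Finset.sum_congr rfl fun i _ => ?_
  simp [mul_pow, abs_of_pos Real.pi_pos]
  ring

end Hyperuniformity

/-! ### Existence of the Fourier transform (Bochner–Schwartz) -/

namespace Hyperuniformity

open scoped ContDiff ENNReal ComplexConjugate

variable {d : ℕ}

/-- Positive definiteness of the difference of two measures. -/
def IsPosDefPairing (α β : Measure (Space d)) : Prop :=
  ∀ f : Space d → ℂ, Continuous f → HasCompactSupport f →
    ∃ r : ℝ, 0 ≤ r ∧ pairing α β (autoconvolution f) = r

/-- The formula characterizing a Fourier transform, for smooth functions. -/
def IsSmoothFourierTransform (ν α β : Measure (Space d)) : Prop :=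
  ∀ f : Space d → ℂ, ContDiff ℝ ∞ f → HasCompactSupport f →
    Integrable (fun ξ => ‖𝓕 f ξ‖ ^ 2) ν ∧
      ((∫ ξ, ‖𝓕 f ξ‖ ^ 2 ∂ν : ℝ) : ℂ) = pairing α β (autoconvolution f)

section

variable {α β : Measure (Space d)} [IsLocallyFiniteMeasure α] [IsLocallyFiniteMeasure β]

theorem norm_pairing_autoconvolution_le {f : Space d → ℂ} (hf : MemLp f 2) {R : ℝ}
    (hs : VanishesOutside f R) : ‖pairing α β (autoconvolution f)‖ ≤ l2norm f ^ 2 *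
      (α.real (Metric.closedBall 0 (2 * R)) + β.real (Metric.closedBall 0 (2 * R))) :=
  norm_pairing_le hs.autoconvolution (norm_autoconvolution_le hf)

/-- A positive-definite signed Radon measure has a positive Fourier transform. -/
theorem IsPosDefPairing.exists_isSmoothFourierTransform (hpos : IsPosDefPairing α β) :
    ∃ ν : Measure (Space d), IsLocallyFiniteMeasure ν ∧ IsSmoothFourierTransform ν α β := by
  obtain ⟨h, hh, hhs, hh0⟩ := exists_autoconvolution_zero_eq_one d
  obtain ⟨S, hS, hhS⟩ := exists_vanishesOutside hhs
  have hk : Continuous (autoconvolution h) := continuous_autoconvolution_of_continuous hh hhs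
  -- Compactly supported regularization: `k n` tends to one pointwise and boundedly, and multiplying
  -- the pairing by it makes the transform a genuine continuous function `D n`.
  set k : ℕ → Space d → ℂ := fun n x => autoconvolution h (((n : ℝ) + 1)⁻¹ • x) with hkdef
  have hkc : ∀ n, Continuous (k n) := fun n => hk.comp (continuous_const_smul _)
  have hks : ∀ n, HasCompactSupport (k n) := fun n =>
    hhS.autoconvolution.hasCompactSupport.comp_smul (by positivity)
  have hkb : ∀ n x, ‖k n x‖ ≤ l2norm h ^ 2 := fun n x =>
    norm_autoconvolution_le (memLp_of_continuous hh hhs 2) _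
  have hk1 : ∀ x, Tendsto (fun n => k n x) atTop (𝓝 1) := by
    intro x
    rw [← hh0]
    refine (hk.tendsto 0).comp ?_
    have h1 : Tendsto (fun n : ℕ => ((n : ℝ) + 1)⁻¹ • x) atTop (𝓝 ((0 : ℝ) • x)) :=
      (tendsto_inv_atTop_zero.comp
        (tendsto_atTop_add_const_right _ _ tendsto_natCast_atTop_atTop)).smul_const x
    rwa [zero_smul] at h1
  set D : ℕ → Space d → ℂ := fun n ξ => pairing α β fun x => wave ξ x * k n x with hDdef
  -- Up to the positive factor `(n + 1)^d`, `wave ξ * k n` is the autoconvolution of a modulated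
  -- dilate of `h`, so positive definiteness makes the density nonnegative.
  have hD0 : ∀ n ξ, ∃ r : ℝ, 0 ≤ r ∧ D n ξ = r := by
    intro n ξ
    have hn : (0 : ℝ) < (n : ℝ) + 1 := by positivity
    obtain ⟨r, hr, hr'⟩ := hpos (fun y => wave ξ y * h (((n : ℝ) + 1)⁻¹ • y)) (by fun_prop)
      (hhs.comp_smul (by positivity)).mul_left
    refine ⟨(((n : ℝ) + 1) ^ d)⁻¹ * r, by positivity, ?_⟩
    have h1 : autoconvolution (fun y => wave ξ y * h (((n : ℝ) + 1)⁻¹ • y)) =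
        fun x => ((((n : ℝ) + 1 : ℝ) : ℂ) ^ d) * (wave ξ x * k n x) :=
      funext fun x => autoconvolution_dilate_modulate h hn ξ x
    rw [h1, pairing_const_mul] at hr'
    have h2 : ((((n : ℝ) + 1 : ℝ) : ℂ) ^ d) ≠ 0 := pow_ne_zero _ (Complex.ofReal_ne_zero.2 hn.ne')
    rw [Complex.ofReal_mul, ← hr', Complex.ofReal_inv, Complex.ofReal_pow, inv_mul_cancel_left₀ h2]
  set w : ℕ → Space d → ℝ := fun n ξ => (D n ξ).re with hwdef
  have hwD : ∀ n ξ, (w n ξ : ℂ) = D n ξ := by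
    intro n ξ
    obtain ⟨r, -, hr⟩ := hD0 n ξ
    simp [hwdef, hr]
  have hw0 : ∀ n ξ, 0 ≤ w n ξ := by
    intro n ξ
    obtain ⟨r, hr0, hr⟩ := hD0 n ξ
    simpa [hwdef, hr] using hr0
  have hDc : ∀ n, Continuous (D n) := fun n =>
    (continuous_integral_wave (hkc n) (hks n) α).sub (continuous_integral_wave (hkc n) (hks n) β)
  have hwc : ∀ n, Continuous (w n) := fun n => Complex.continuous_re.comp (hDc n)
  have hwb : ∀ n, ∃ c, ∀ ξ, ‖w n ξ‖ ≤ c := by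
    intro n
    obtain ⟨T, -, hT⟩ := exists_vanishesOutside (hks n)
    refine ⟨_, fun ξ => (Complex.abs_re_le_norm _).trans (norm_pairing_le (R := T)
      (c := l2norm h ^ 2) (fun x hx => by simp [hT x hx]) fun x => ?_)⟩
    simpa using hkb n x
  have hint : ∀ (F : Space d → ℝ) n, Integrable F → Integrable fun ξ => F ξ * w n ξ := by
    intro F n hF
    obtain ⟨c, hc⟩ := hwb n
    exact hF.mul_bdd (hwc n).aestronglyMeasurable (ae_of_all _ hc)
  -- Fubini moves the wave integral onto `|𝓕 f|²`, and inversion turns that into the autoconvolution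
  -- of `f`.
  have hmain : ∀ f : Space d → ℂ, ContDiff ℝ ∞ f → HasCompactSupport f → ∀ n,
      ((∫ ξ, ‖𝓕 f ξ‖ ^ 2 * w n ξ : ℝ) : ℂ) = pairing α β fun x => k n x * autoconvolution f x := by
    intro f hf hfs n
    have hi : Integrable fun ξ => ((‖𝓕 f ξ‖ ^ 2 : ℝ) : ℂ) := (integrable_fourier_smooth hf hfs).ofReal
    have hb : ∀ μ : Measure (Space d), IsLocallyFiniteMeasure μ →
        Integrable fun ξ => ((‖𝓕 f ξ‖ ^ 2 : ℝ) : ℂ) * ∫ x, wave ξ x * k n x ∂μ := by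
      intro μ hμ
      obtain ⟨T, -, hT⟩ := exists_vanishesOutside (hks n)
      exact hi.mul_bdd (continuous_integral_wave (hkc n) (hks n) μ).aestronglyMeasurable
        (ae_of_all _ fun ξ => norm_integral_le_of_vanishesOutside (R := T)
          (c := l2norm h ^ 2) (fun x hx => by simp [hT x hx]) (fun x => by simpa using hkb n x) μ)
    rw [← integral_complex_ofReal]
    simp_rw [Complex.ofReal_mul, hwD, hDdef, pairing, mul_sub]
    rw [integral_sub (hb α inferInstance) (hb β inferInstance),
      integral_mul_integral_wave hi (hkc n) (hks n), integral_mul_integral_wave hi (hkc n) (hks n),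
      fourierInv_norm_fourier_sq hf hfs]
  have hconv : ∀ f : Space d → ℂ, ContDiff ℝ ∞ f → HasCompactSupport f →
      Tendsto (fun n => ∫ ξ, ‖𝓕 f ξ‖ ^ 2 * w n ξ) atTop
        (𝓝 (pairing α β (autoconvolution f)).re) := by
    intro f hf hfs
    obtain ⟨R, hR, hfR⟩ := exists_vanishesOutside hfs
    have hfc := continuous_autoconvolution_of_continuous hf.continuous hfs
    have hf2 := memLp_of_continuous hf.continuous hfs 2
    have h1 : Tendsto (fun n => pairing α β fun x => k n x * autoconvolution f x) atTop
        (𝓝 (pairing α β (autoconvolution f))) := by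
      refine tendsto_pairing (R := 2 * R) (c := l2norm h ^ 2 * l2norm f ^ 2)
        (fun n => (hkc n).mul hfc) (fun n x hx => by simp [hfR.autoconvolution x hx])
        (fun n x => ?_) fun x => ?_
      · rw [norm_mul]
        exact mul_le_mul (hkb n x) (norm_autoconvolution_le hf2 x) (norm_nonneg _) (by positivity)
      · simpa using (hk1 x).mul_const (autoconvolution f x)
    refine ((Complex.continuous_re.tendsto _).comp h1).congr fun n => ?_
    rw [Function.comp_apply, ← hmain f hf hfs n, Complex.ofReal_re]
  have hbdd : ∀ f : Space d → ℂ, ContDiff ℝ ∞ f → HasCompactSupport f →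
      ∃ C, ∀ n, ∫ ξ, ‖𝓕 f ξ‖ ^ 2 * w n ξ ≤ C := by
    intro f hf hfs
    obtain ⟨C, hC⟩ := (hconv f hf hfs).bddAbove_range
    exact ⟨C, fun n => hC ⟨n, rfl⟩⟩
  -- Vague boundedness: `g` is dominated by `c |𝓕 φ|²` for a test function `φ` with `|𝓕 φ| ≥ 1` on
  -- its support, and the integrals of `|𝓕 φ|² w n` converge, hence are bounded.
  obtain ⟨ν, hν, hlim⟩ := exists_vague_limit w hwc hw0 (by
    intro g hg hgs
    obtain ⟨c, hc⟩ := hgs.exists_bound_of_continuous hg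
    obtain ⟨R, hR⟩ := hgs.isBounded.subset_closedBall (0 : Space d)
    obtain ⟨φ, hφ, hφs, hφ1⟩ := exists_smooth_one_le_norm_fourier d
      (R := max R 1) (by positivity)
    obtain ⟨C, hC⟩ := hbdd φ hφ hφs
    have hc0 : 0 ≤ c := (norm_nonneg _).trans (hc 0)
    refine ⟨c * C, fun n => ?_⟩
    calc |∫ ξ, g ξ * w n ξ| ≤ ∫ ξ, c * (‖𝓕 φ ξ‖ ^ 2 * w n ξ) := by
          rw [← Real.norm_eq_abs]
          refine norm_integral_le_of_norm_le
            ((hint _ n (integrable_fourier_smooth hφ hφs)).const_mul c) (ae_of_all _ fun ξ => ?_)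
          rw [norm_mul, Real.norm_of_nonneg (hw0 n ξ), ← mul_assoc]
          refine mul_le_mul_of_nonneg_right ?_ (hw0 n ξ)
          by_cases hξ : ξ ∈ tsupport g
          · have h1 := hφ1 ξ ((by simpa using hR hξ : ‖ξ‖ ≤ R).trans (le_max_left R 1))
            calc ‖g ξ‖ ≤ c * 1 := by simpa using hc ξ
              _ ≤ c * ‖𝓕 φ ξ‖ ^ 2 := mul_le_mul_of_nonneg_left (one_le_pow₀ h1) hc0
          · rw [image_eq_zero_of_notMem_tsupport hξ, norm_zero]
            positivity
      _ ≤ c * C := by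
          rw [integral_const_mul]
          exact mul_le_mul_of_nonneg_left (hC n) hc0)
  refine ⟨ν, hν, fun f hf hfs => ?_⟩
  -- The partial derivatives of `f` control the second moment of `|𝓕 f|² w n`, so no mass escapes to
  -- infinity in the vague limit.
  set f' : Fin d → Space d → ℂ := fun i x => fderiv ℝ f x (EuclideanSpace.single i 1) with hf'def
  have hf' : ∀ i, ContDiff ℝ ∞ (f' i) := fun i =>
    (hf.fderiv_right (m := ∞) (by simp)).clm_apply contDiff_const
  have hf's : ∀ i, HasCompactSupport (f' i) := fun i => (hfs.fderiv ℝ).comp_left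
    (g := fun L : Space d →L[ℝ] ℂ => L (EuclideanSpace.single i 1)) (by simp)
  have hsum : ∀ ξ, ‖ξ‖ ^ 2 * ‖𝓕 f ξ‖ ^ 2 = ((2 * Real.pi) ^ 2)⁻¹ * ∑ i, ‖𝓕 (f' i) ξ‖ ^ 2 := by
    intro ξ
    rw [← norm_sq_mul_norm_fourier_sq hf hfs, inv_mul_cancel_left₀ (by positivity)]
  have hsumw : ∀ n ξ, ‖ξ‖ ^ 2 * ‖𝓕 f ξ‖ ^ 2 * w n ξ =
      ((2 * Real.pi) ^ 2)⁻¹ * ∑ i, ‖𝓕 (f' i) ξ‖ ^ 2 * w n ξ := by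
    intro n ξ
    rw [hsum, mul_assoc, Finset.sum_mul]
  have hi' : ∀ n i, Integrable fun ξ => ‖𝓕 (f' i) ξ‖ ^ 2 * w n ξ := fun n i =>
    hint _ n (integrable_fourier_smooth (hf' i) (hf's i))
  choose C hC using fun i => hbdd (f' i) (hf' i) (hf's i)
  have hFc : Continuous (𝓕 f) :=
    continuous_fourier (hf.continuous.integrable_of_hasCompactSupport hfs)
  obtain ⟨h1, h2⟩ := integral_eq_of_vague_limit hwc hw0 hlim (F := fun ξ => ‖𝓕 f ξ‖ ^ 2)
    (by fun_prop) (fun ξ => by positivity)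
    (fun n => hint _ n (integrable_fourier_smooth hf hfs))
    (fun n => by
      simp_rw [hsumw]
      exact (integrable_finsetSum _ fun i _ => hi' n i).const_mul _)
    (C := ((2 * Real.pi) ^ 2)⁻¹ * ∑ i, C i)
    (fun n => by
      simp_rw [hsumw]
      rw [integral_const_mul, integral_finsetSum _ fun i _ => hi' n i]
      gcongr with i
      exact hC i n)
    (hconv f hf hfs)
  refine ⟨h1, ?_⟩
  obtain ⟨r, -, hr⟩ := hpos f hf.continuous hfs
  rw [h2, hr, Complex.ofReal_re]

end

end Hyperuniformity

/-! ### Extension of the Fourier formula to `L²` functions, and growth of the transform -/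

namespace Hyperuniformity

open scoped ContDiff ENNReal ComplexConjugate

variable {d : ℕ}

section

variable {α β ν : Measure (Space d)} [IsLocallyFiniteMeasure α] [IsLocallyFiniteMeasure β]

theorem tendsto_pairing_autoconvolution {f : Space d → ℂ} {g : ℕ → Space d → ℂ}
    (hf : MemLp f 2) (hg : ∀ n, Continuous (g n)) {R : ℝ}
    (hgs : ∀ n, VanishesOutside (g n) R)
    (h : Tendsto (fun n => l2norm (f - g n)) atTop (𝓝 0)) :
    Tendsto (fun n => pairing α β (autoconvolution (g n))) atTop
      (𝓝 (pairing α β (autoconvolution f))) := by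
  have hg2 : ∀ n, MemLp (g n) 2 := fun n =>
    memLp_of_continuous (hg n) (hgs n).hasCompactSupport 2
  obtain ⟨c, hc⟩ := h.bddAbove_range
  have hc' : ∀ n, l2norm (g n) ≤ l2norm f + c := fun n =>
    (l2norm_le_add hf (hg2 n)).trans (add_le_add le_rfl (hc ⟨n, rfl⟩))
  refine tendsto_pairing (R := 2 * R) (c := (l2norm f + c) ^ 2)
    (fun n => continuous_autoconvolution_of_continuous (hg n) (hgs n).hasCompactSupport)
    (fun n => (hgs n).autoconvolution) (fun n x => ?_) fun x => ?_
  · exact (norm_autoconvolution_le (hg2 n) x).trans (pow_le_pow_left₀ (l2norm_nonneg _) (hc' n) 2)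
  · exact (tendstoUniformly_autoconvolution hf hg2 h).tendsto_at x

/-- Fatou along smooth approximants gives one inequality. It already implies integrability, and
applied to the error `f - g n` it yields the reverse inequality. -/
theorem IsSmoothFourierTransform.lintegral_le (hν : IsSmoothFourierTransform ν α β)
    {f : Space d → ℂ} (hf : MemLp f 2) {R : ℝ} (hR : 0 < R) (hs : VanishesOutside f R) :
    ∫⁻ ξ, ENNReal.ofReal (‖𝓕 f ξ‖ ^ 2) ∂ν ≤
      ENNReal.ofReal (pairing α β (autoconvolution f)).re := by
  obtain ⟨g, hg, hgs, hfg⟩ := exists_smooth_approx hf hR hs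
  have hg2 : ∀ n, MemLp (g n) 2 := fun n =>
    memLp_of_continuous (hg n).continuous (hgs n).hasCompactSupport 2
  have h1 : ∀ n, ∫⁻ ξ, ENNReal.ofReal (‖𝓕 (g n) ξ‖ ^ 2) ∂ν =
      ENNReal.ofReal (pairing α β (autoconvolution (g n))).re := by
    intro n
    obtain ⟨hi, he⟩ := hν (g n) (hg n) (hgs n).hasCompactSupport
    rw [← he, Complex.ofReal_re, ofReal_integral_eq_lintegral_ofReal hi
      (ae_of_all _ fun ξ => by positivity)]
  have h2 : Tendsto (fun n => ENNReal.ofReal (pairing α β (autoconvolution (g n))).re) atTop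
      (𝓝 (ENNReal.ofReal (pairing α β (autoconvolution f)).re)) :=
    (ENNReal.continuous_ofReal.tendsto _).comp ((Complex.continuous_re.tendsto _).comp
      (tendsto_pairing_autoconvolution hf (fun n => (hg n).continuous) hgs hfg))
  rw [← h2.liminf_eq]
  simp_rw [← h1]
  refine le_trans (le_of_eq (lintegral_congr fun ξ => ?_)) (lintegral_liminf_le fun n => ?_)
  · have := tendsto_fourier hf hg2 (hs.mono (by linarith)) hgs hfg ξ
    exact (((ENNReal.continuous_ofReal.tendsto _).comp (this.norm.pow 2)).liminf_eq).symm
  · have := continuous_fourier (integrable_of_vanishesOutside (hg2 n) (hgs n))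
    exact (ENNReal.continuous_ofReal.comp (this.norm.pow 2)).measurable

/-- The Fourier transform formula extends from smooth functions to compactly supported
square-integrable functions. -/
theorem IsSmoothFourierTransform.integral_eq (hν : IsSmoothFourierTransform ν α β)
    {f : Space d → ℂ} (hf : MemLp f 2) {R : ℝ} (hR : 0 < R) (hs : VanishesOutside f R) :
    Integrable (fun ξ => ‖𝓕 f ξ‖ ^ 2) ν ∧
      ((∫ ξ, ‖𝓕 f ξ‖ ^ 2 ∂ν : ℝ) : ℂ) = pairing α β (autoconvolution f) := by
  obtain ⟨g, hg, hgs, hfg⟩ := exists_smooth_approx hf hR hs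
  have hg2 : ∀ n, MemLp (g n) 2 := fun n =>
    memLp_of_continuous (hg n).continuous (hgs n).hasCompactSupport 2
  have hs' : VanishesOutside f (R + 1) := hs.mono (by linarith)
  have hsub : ∀ n, VanishesOutside (f - g n) (R + 1) := fun n x hx => by
    simp [hs' x hx, hgs n x hx]
  have hint : ∀ h : Space d → ℂ, MemLp h 2 → VanishesOutside h (R + 1) →
      Integrable (fun ξ => ‖𝓕 h ξ‖ ^ 2) ν ∧
        ∫ ξ, ‖𝓕 h ξ‖ ^ 2 ∂ν ≤ ‖pairing α β (autoconvolution h)‖ := by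
    intro h hh hhs
    have h1 := hν.lintegral_le hh (by linarith) hhs
    have hc := continuous_fourier (integrable_of_vanishesOutside hh hhs)
    have h2 : Integrable (fun ξ => ‖𝓕 h ξ‖ ^ 2) ν := by
      refine ⟨(hc.norm.pow 2).aestronglyMeasurable, ?_⟩
      rw [hasFiniteIntegral_iff_ofReal (ae_of_all _ fun ξ => by positivity)]
      exact h1.trans_lt ENNReal.ofReal_lt_top
    refine ⟨h2, ?_⟩
    rw [← ofReal_integral_eq_lintegral_ofReal h2 (ae_of_all _ fun ξ => by positivity)] at h1
    exact (ENNReal.ofReal_le_ofReal_iff (norm_nonneg _)).1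
      (h1.trans (ENNReal.ofReal_le_ofReal (Complex.re_le_norm _)))
  obtain ⟨hi, -⟩ := hint f hf hs'
  have hlim := tendsto_pairing_autoconvolution (α := α) (β := β) hf
    (fun n => (hg n).continuous) hgs hfg
  have him : (pairing α β (autoconvolution f)).im = 0 := by
    refine tendsto_nhds_unique ((Complex.continuous_im.tendsto _).comp hlim)
      (tendsto_const_nhds.congr fun n => ?_)
    obtain ⟨-, he⟩ := hν (g n) (hg n) (hgs n).hasCompactSupport
    simp [← he]
  have hre0 : ∀ n, 0 ≤ (pairing α β (autoconvolution (g n))).re := by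
    intro n
    obtain ⟨-, he⟩ := hν (g n) (hg n) (hgs n).hasCompactSupport
    rw [← he, Complex.ofReal_re]
    positivity
  have hrelim := (Complex.continuous_re.tendsto _).comp hlim
  have hq0 : 0 ≤ (pairing α β (autoconvolution f)).re := ge_of_tendsto' hrelim hre0
  have hupper : ∫ ξ, ‖𝓕 f ξ‖ ^ 2 ∂ν ≤ (pairing α β (autoconvolution f)).re := by
    have h1 := hν.lintegral_le hf hR hs
    rw [← ofReal_integral_eq_lintegral_ofReal hi (ae_of_all _ fun ξ => by positivity)] at h1
    exact (ENNReal.ofReal_le_ofReal_iff hq0).1 h1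
  -- From `|a - b|² ≤ (1 + δ)|a|² + (1 + δ⁻¹)|b|²` with `b = 𝓕 (f - g n)`. The error term is at most
  -- a constant times the squared `L²` norm of `f - g n`: it vanishes as `n → ∞` for fixed `δ`,
  -- after which `δ → 0`.
  have hlower : ∀ δ : ℝ, 0 < δ → (pairing α β (autoconvolution f)).re ≤
      (1 + δ) * ∫ ξ, ‖𝓕 f ξ‖ ^ 2 ∂ν := by
    intro δ hδ
    set K := α.real (Metric.closedBall 0 (2 * (R + 1))) + β.real (Metric.closedBall 0 (2 * (R + 1)))
    have h1 : ∀ n, (pairing α β (autoconvolution (g n))).re ≤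
        (1 + δ) * ∫ ξ, ‖𝓕 f ξ‖ ^ 2 ∂ν + (1 + δ⁻¹) * (l2norm (f - g n) ^ 2 * K) := by
      intro n
      obtain ⟨hgi, he⟩ := hν (g n) (hg n) (hgs n).hasCompactSupport
      obtain ⟨hfgi, hfgle⟩ := hint (f - g n) (hf.sub (hg2 n)) (hsub n)
      have h3 := hfgle.trans (norm_pairing_autoconvolution_le (hf.sub (hg2 n)) (hsub n))
      rw [← he, Complex.ofReal_re]
      calc ∫ ξ, ‖𝓕 (g n) ξ‖ ^ 2 ∂ν ≤
          ∫ ξ, ((1 + δ) * ‖𝓕 f ξ‖ ^ 2 + (1 + δ⁻¹) * ‖𝓕 (f - g n) ξ‖ ^ 2) ∂ν := by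
            refine integral_mono hgi ((hi.const_mul _).add (hfgi.const_mul _)) fun ξ => ?_
            have h4 : 𝓕 (g n) ξ = 𝓕 f ξ - 𝓕 (f - g n) ξ := by
              rw [fourier_sub (integrable_of_vanishesOutside hf hs)
                (integrable_of_vanishesOutside (hg2 n) (hgs n))]
              ring
            have h5 : ‖𝓕 (g n) ξ‖ ≤ ‖𝓕 f ξ‖ + ‖𝓕 (f - g n) ξ‖ := by
              rw [h4]; exact norm_sub_le _ _
            refine (pow_le_pow_left₀ (norm_nonneg _) h5 2).trans ?_
            have h6 : 0 ≤ δ⁻¹ * (δ * ‖𝓕 f ξ‖ - ‖𝓕 (f - g n) ξ‖) ^ 2 := by positivity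
            have h7 : δ⁻¹ * (δ * ‖𝓕 f ξ‖ - ‖𝓕 (f - g n) ξ‖) ^ 2 = δ * ‖𝓕 f ξ‖ ^ 2 -
                2 * ‖𝓕 f ξ‖ * ‖𝓕 (f - g n) ξ‖ + δ⁻¹ * ‖𝓕 (f - g n) ξ‖ ^ 2 := by
              field_simp
              ring
            nlinarith
        _ = (1 + δ) * ∫ ξ, ‖𝓕 f ξ‖ ^ 2 ∂ν + (1 + δ⁻¹) * ∫ ξ, ‖𝓕 (f - g n) ξ‖ ^ 2 ∂ν := by
            rw [integral_add (hi.const_mul _) (hfgi.const_mul _), integral_const_mul,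
              integral_const_mul]
        _ ≤ _ := by
            gcongr
    have h2 := (hfg.pow 2).mul_const K |>.const_mul (1 + δ⁻¹) |>.const_add
      ((1 + δ) * ∫ ξ, ‖𝓕 f ξ‖ ^ 2 ∂ν)
    simp only [ne_eq, OfNat.ofNat_ne_zero, not_false_eq_true, zero_pow, zero_mul, mul_zero,
      add_zero] at h2
    exact le_of_tendsto_of_tendsto' hrelim h2 h1
  have hlower' : (pairing α β (autoconvolution f)).re ≤ ∫ ξ, ‖𝓕 f ξ‖ ^ 2 ∂ν := by
    have h1 : Tendsto (fun δ : ℝ => (1 + δ) * ∫ ξ, ‖𝓕 f ξ‖ ^ 2 ∂ν) (𝓝[>] 0)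
        (𝓝 ((1 + 0) * ∫ ξ, ‖𝓕 f ξ‖ ^ 2 ∂ν)) := by
      refine Tendsto.mono_left ?_ nhdsWithin_le_nhds
      exact (tendsto_id.const_add 1).mul_const _
    rw [add_zero, one_mul] at h1
    exact ge_of_tendsto h1 (eventually_mem_nhdsWithin.mono fun δ hδ => hlower δ hδ)
  refine ⟨hi, ?_⟩
  rw [le_antisymm hupper hlower']
  exact Complex.ext (by simp) (by simp [him])

/-- The Fourier transform of a signed Radon measure charges balls of radius `r ≥ 1` with at most
a constant multiple of `r ^ d`. -/
theorem IsSmoothFourierTransform.exists_measure_ball_le (hν : IsSmoothFourierTransform ν α β)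
    [IsLocallyFiniteMeasure ν] :
    ∃ A, ∀ r : ℝ, 1 ≤ r → ν.real (Metric.ball 0 r) ≤ A * r ^ d := by
  set K := α.real (Metric.closedBall 0 (2 * 1)) + β.real (Metric.closedBall 0 (2 * 1))
  set v : ℝ := (volume : Measure (Space d)).real (Metric.ball 0 1)
  have hv : 0 < v := ENNReal.toReal_pos (Metric.measure_ball_pos volume 0 one_pos).ne'
    measure_ball_lt_top.ne
  refine ⟨4 * (4 * Real.pi) ^ d / v * K, fun r hr => ?_⟩
  have hr0 : 0 < r := by linarith
  -- The test function is a multiple of the indicator of the ball of radius `ρ = 1 / (4πr)`, of mass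
  -- `2`, so its transform is at least one in modulus on the ball of radius `r`. Its support stays
  -- in the unit ball, so `K` does not depend on `r`; its squared `L²` norm is of order `ρ^{-d}`,
  -- hence `r^d`.
  set ρ : ℝ := 1 / (2 * Real.pi * (2 * r)) with hρdef
  have hρ : 0 < ρ := by positivity
  have hρ1 : ρ ≤ 1 := by
    rw [hρdef, div_le_one (by positivity)]
    nlinarith [Real.pi_gt_three]
  have hvol : (volume : Measure (Space d)).real (Metric.closedBall 0 ρ) = ρ ^ d * v := by
    rw [measureReal_def, Measure.addHaar_closedBall _ _ hρ.le, finrank_euclideanSpace_fin,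
      ENNReal.toReal_mul, ENNReal.toReal_ofReal (by positivity)]
    rfl
  set φ : Space d → ℝ := (Metric.closedBall 0 ρ).indicator fun _ => 2 / (ρ ^ d * v) with hφ
  have hφ0 : ∀ x, 0 ≤ φ x := fun x => Set.indicator_nonneg (fun _ _ => by positivity) x
  have hφi : Integrable φ := (integrable_indicator_iff measurableSet_closedBall).2
    (integrableOn_const measure_closedBall_lt_top.ne)
  have hφ2 : ∫ x, φ x = 2 := by
    rw [hφ, integral_indicator_const _ measurableSet_closedBall, hvol, smul_eq_mul]
    field_simp
  have hφs : ∀ x, ρ < ‖x‖ → φ x = 0 := fun x hx => by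
    rw [hφ, Set.indicator_of_notMem (by simpa using hx)]
  set f : Space d → ℂ := fun x => (φ x : ℂ) with hf
  have hf' : f = (Metric.closedBall 0 ρ).indicator fun _ => ((2 / (ρ ^ d * v) : ℝ) : ℂ) := by
    ext x
    by_cases hx : x ∈ Metric.closedBall (0 : Space d) ρ <;> simp [hf, hφ, hx]
  have hf2 : MemLp f 2 := by
    rw [hf']
    exact memLp_indicator_const _ measurableSet_closedBall _ (Or.inr measure_closedBall_lt_top.ne)
  have hfs : VanishesOutside f 1 := fun x hx => by simp [hf, hφs x (hρ1.trans_lt hx)]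
  have hfn : l2norm f ^ 2 = 4 / (ρ ^ d * v) := by
    rw [l2norm, hf', eLpNorm_indicator_const measurableSet_closedBall (by norm_num) (by norm_num),
      ENNReal.toReal_mul, ← ENNReal.toReal_rpow, ← measureReal_def, hvol, toReal_enorm,
      Complex.norm_real, Real.norm_of_nonneg (by positivity), mul_pow, ENNReal.toReal_ofNat,
      ← Real.sqrt_eq_rpow, Real.sq_sqrt (by positivity)]
    field_simp
    norm_num
  obtain ⟨hi, he⟩ := hν.integral_eq hf2 one_pos hfs
  have h1 : ∫ ξ, ‖𝓕 f ξ‖ ^ 2 ∂ν ≤ 4 / (ρ ^ d * v) * K := by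
    rw [← hfn]
    refine le_trans ?_ (norm_pairing_autoconvolution_le hf2 hfs)
    rw [← he, Complex.norm_real]
    exact le_abs_self _
  have h2 : ν.real (Metric.ball 0 r) ≤ ∫ ξ, ‖𝓕 f ξ‖ ^ 2 ∂ν := by
    have h3 : ν.real (Metric.ball 0 r) = ∫ ξ, (Metric.ball 0 r).indicator (fun _ => (1 : ℝ)) ξ ∂ν := by
      rw [integral_indicator_const _ measurableSet_ball]; simp
    rw [h3]
    refine integral_mono ((integrable_indicator_iff measurableSet_ball).2
      (integrableOn_const measure_ball_lt_top.ne)) hi fun ξ => ?_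
    by_cases hξ : ξ ∈ Metric.ball (0 : Space d) r
    · rw [Set.indicator_of_mem hξ]
      exact one_le_pow₀ (one_le_norm_fourier hφ0 hφi hφ2 hr0 hφs (by simpa using! (Metric.mem_ball.1 hξ).le))
    · rw [Set.indicator_of_notMem hξ]
      positivity
  refine (h2.trans h1).trans (le_of_eq ?_)
  have h4 : ρ ^ d = 1 / ((4 * Real.pi) ^ d * r ^ d) := by
    rw [hρdef, ← mul_pow, one_div_pow]
    congr 2
    ring
  rw [h4]
  field_simp

end

end Hyperuniformity

/-! ### Variance integrals against spectral mass near the origin -/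

namespace Hyperuniformity

open scoped ContDiff ENNReal ComplexConjugate

variable {d : ℕ}

/-- The complex-valued indicator function of a set. -/
noncomputable def indicatorOne (V : Set (Space d)) : Space d → ℂ := V.indicator fun _ => 1

theorem fourier_indicatorOne_smul (V : Set (Space d)) {t : ℝ} (ht : 0 < t) (ξ : Space d) :
    𝓕 (indicatorOne (t • V)) ξ = (t : ℂ) ^ d * 𝓕 (indicatorOne V) (t • ξ) := by
  rw [fourier_eq_wave, fourier_eq_wave]
  have h := Measure.integral_comp_inv_smul (volume : Measure (Space d))
    (fun v => wave (-(t • ξ)) v * indicatorOne V v) t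
  rw [finrank_euclideanSpace_fin, abs_of_pos (pow_pos ht d)] at h
  have h1 : ∀ v, wave (-(t • ξ)) (t⁻¹ • v) * indicatorOne V (t⁻¹ • v) =
      wave (-ξ) v * indicatorOne (t • V) v := by
    intro v
    have h2 : wave (-(t • ξ)) (t⁻¹ • v) = wave (-ξ) v := by
      simp only [wave, inner_neg_right, inner_smul_left, inner_smul_right]
      congr 4
      simp [ht.ne']
    have h3 : indicatorOne V (t⁻¹ • v) = indicatorOne (t • V) v := by
      by_cases hv : v ∈ t • V
      · rw [indicatorOne, indicatorOne, Set.indicator_of_mem hv,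
          Set.indicator_of_mem ((Set.mem_smul_set_iff_inv_smul_mem₀ ht.ne' _ _).1 hv)]
      · rw [indicatorOne, indicatorOne, Set.indicator_of_notMem hv,
          Set.indicator_of_notMem (fun h => hv ((Set.mem_smul_set_iff_inv_smul_mem₀ ht.ne' _ _).2 h))]
    rw [h2, h3]
  simp_rw [h1] at h
  rw [h, Complex.real_smul, Complex.ofReal_pow]

theorem memLp_indicatorOne {V : Set (Space d)} (hV : Bornology.IsBounded V)
    (hVm : MeasurableSet V) : MemLp (indicatorOne V) 2 :=
  memLp_indicator_const _ hVm _ (Or.inr hV.measure_lt_top.ne)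

theorem exists_vanishesOutside_indicatorOne {V : Set (Space d)} (hV : Bornology.IsBounded V) :
    ∃ R > 0, VanishesOutside (indicatorOne V) R := by
  obtain ⟨R, hR⟩ := hV.subset_closedBall (0 : Space d)
  refine ⟨max R 1, by positivity, fun x hx => Set.indicator_of_notMem (fun h => ?_) _⟩
  have h1 : ‖x‖ ≤ R := by simpa using hR h
  exact absurd (h1.trans (le_max_left R 1)) (not_le.2 hx)

theorem integrable_indicatorOne {V : Set (Space d)} (hV : Bornology.IsBounded V)
    (hVm : MeasurableSet V) : Integrable (indicatorOne V) := by
  obtain ⟨R, -, hR⟩ := exists_vanishesOutside_indicatorOne hV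
  exact integrable_of_vanishesOutside (memLp_indicatorOne hV hVm) hR

/-- The spectral form of the variance in dilated windows controls the mass near the origin. -/
theorem tendsto_measure_ball_of_tendsto_integral {ν : Measure (Space d)} [IsLocallyFiniteMeasure ν]
    {V : Set (Space d)} (hV : Bornology.IsBounded V) (hVm : MeasurableSet V) (hV0 : 0 < volume V)
    (hi : ∀ t : ℝ, 0 < t → Integrable (fun ξ => ‖𝓕 (indicatorOne (t • V)) ξ‖ ^ 2) ν)
    (h : Tendsto (fun t : ℝ => (∫ ξ, ‖𝓕 (indicatorOne (t • V)) ξ‖ ^ 2 ∂ν) / t ^ d) atTop (𝓝 0)) :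
    Tendsto (fun t : ℝ => ν.real (Metric.ball 0 t) / t ^ d) (𝓝[>] 0) (𝓝 0) := by
  have hc : Continuous (fun ξ => ‖𝓕 (indicatorOne V) ξ‖ ^ 2) :=
    (continuous_fourier (integrable_indicatorOne hV hVm)).norm.pow 2
  have h0 : 0 < ‖𝓕 (indicatorOne V) 0‖ ^ 2 := by
    have h1 : 𝓕 (indicatorOne V) 0 = volume.real V := by
      rw [fourier_eq_wave, indicatorOne]
      simp only [neg_zero, wave_zero, one_mul]
      rw [integral_indicator_const _ hVm]
      simp
    rw [h1]
    have := ENNReal.toReal_pos hV0.ne' hV.measure_lt_top.ne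
    have h2 : 0 < volume.real V := this
    rw [Complex.norm_real]
    exact pow_pos (norm_pos_iff.2 h2.ne') 2
  -- Half the value `vol(V)²` at the origin; continuity keeps `|𝓕 χ_V|²` above it on a ball of
  -- radius `r`.
  set c := ‖𝓕 (indicatorOne V) 0‖ ^ 2 / 2 with hcdef
  have hc0 : 0 < c := by positivity
  obtain ⟨r, hr, hball⟩ := Metric.eventually_nhds_iff_ball.1
    (hc.continuousAt.eventually (lt_mem_nhds (half_lt_self h0)))
  -- The window scale `r / s` sends the frequency ball of radius `s` onto the ball of radius `r`,
  -- where the lower bound `c` holds.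
  have key : ∀ s : ℝ, 0 < s → ν.real (Metric.ball 0 s) / s ^ d ≤
      (c * r ^ d)⁻¹ * ((∫ ξ, ‖𝓕 (indicatorOne ((r / s) • V)) ξ‖ ^ 2 ∂ν) / (r / s) ^ d) := by
    intro s hs
    have ht : 0 < r / s := by positivity
    have h1 : ((r / s) ^ d) ^ 2 * c * ν.real (Metric.ball 0 s) ≤
        ∫ ξ, ‖𝓕 (indicatorOne ((r / s) • V)) ξ‖ ^ 2 ∂ν := by
      have h3 : ((r / s) ^ d) ^ 2 * c * ν.real (Metric.ball 0 s) =
          ∫ ξ, (Metric.ball 0 s).indicator (fun _ => ((r / s) ^ d) ^ 2 * c) ξ ∂ν := by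
        rw [integral_indicator_const _ measurableSet_ball, smul_eq_mul, mul_comm]
      rw [h3]
      refine integral_mono ((integrable_indicator_iff measurableSet_ball).2
        (integrableOn_const measure_ball_lt_top.ne)) (hi _ ht) fun ξ => ?_
      by_cases hξ : ξ ∈ Metric.ball (0 : Space d) s
      · rw [Set.indicator_of_mem hξ]
        simp only [fourier_indicatorOne_smul V ht, norm_mul, mul_pow]
        have h4 : ‖((r / s : ℝ) : ℂ) ^ d‖ = (r / s) ^ d := by
          rw [norm_pow, Complex.norm_real, Real.norm_of_nonneg ht.le]
        rw [h4]
        refine mul_le_mul_of_nonneg_left (hball _ ?_).le (by positivity)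
        have hξ' : ‖ξ‖ < s := by simpa using hξ
        rw [Metric.mem_ball, dist_zero_right, norm_smul, Real.norm_of_nonneg ht.le]
        calc r / s * ‖ξ‖ < r / s * s := by gcongr
          _ = r := by field_simp
      · rw [Set.indicator_of_notMem hξ]
        positivity
    have h2 := div_le_div_of_nonneg_right h1 (pow_pos ht d).le
    have h3 := mul_le_mul_of_nonneg_left h2 (by positivity : 0 ≤ (c * r ^ d)⁻¹)
    refine le_trans (le_of_eq ?_) h3
    rw [div_pow]
    field_simp
  have hlim : Tendsto (fun s : ℝ => (c * r ^ d)⁻¹ *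
      ((∫ ξ, ‖𝓕 (indicatorOne ((r / s) • V)) ξ‖ ^ 2 ∂ν) / (r / s) ^ d)) (𝓝[>] 0) (𝓝 0) := by
    have h1 : Tendsto (fun s : ℝ => r / s) (𝓝[>] 0) atTop := by
      simp_rw [div_eq_mul_inv]
      exact tendsto_inv_nhdsGT_zero.const_mul_atTop hr
    simpa using (h.comp h1).const_mul ((c * r ^ d)⁻¹)
  refine tendsto_of_tendsto_of_tendsto_of_le_of_le' tendsto_const_nhds hlim ?_ ?_
  · exact eventually_mem_nhdsWithin.mono fun s hs =>
      div_nonneg measureReal_nonneg (pow_pos hs d).le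
  · exact eventually_mem_nhdsWithin.mono fun s hs => key s hs

/-- Three ranges: the limit handles small radii, the growth bound handles `r ≥ 1`, and in between
the mass is at most that of the unit ball while `r^d ≥ δ^d`. The result is the dominating constant
for the dyadic series. -/
theorem exists_measure_ball_le_of_tendsto {ν : Measure (Space d)} [IsLocallyFiniteMeasure ν]
    {A : ℝ} (hA : ∀ r : ℝ, 1 ≤ r → ν.real (Metric.ball 0 r) ≤ A * r ^ d)
    (h : Tendsto (fun t : ℝ => ν.real (Metric.ball 0 t) / t ^ d) (𝓝[>] 0) (𝓝 0)) :
    ∃ A', ∀ r : ℝ, 0 < r → ν.real (Metric.ball 0 r) / r ^ d ≤ A' := by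
  obtain ⟨δ, hδ, hδ'⟩ := (nhdsGT_basis (0 : ℝ)).eventually_iff.1 (h.eventually (gt_mem_nhds one_pos))
  have hA0 : 0 ≤ A := by simpa using measureReal_nonneg.trans (hA 1 le_rfl)
  refine ⟨max 1 (max A (A / δ ^ d)), fun r hr => ?_⟩
  rcases lt_or_ge r δ with h1 | h1
  · exact (hδ' ⟨hr, h1⟩).le.trans (le_max_left _ _)
  · rcases lt_or_ge r 1 with h2 | h2
    · refine le_trans ?_ ((le_max_right A _).trans (le_max_right 1 _))
      have h3 : ν.real (Metric.ball 0 r) ≤ A := by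
        have := hA 1 le_rfl
        rw [one_pow, mul_one] at this
        exact (measureReal_mono (Metric.ball_subset_ball h2.le) measure_ball_lt_top.ne).trans this
      gcongr
    · refine le_trans ?_ ((le_max_left A _).trans (le_max_right 1 _))
      rw [div_le_iff₀ (by positivity)]
      exact hA r h2

/-- A decaying function is dominated by a dyadic sum of indicator functions of balls. -/
theorem one_add_rpow_neg_le_tsum {a : ℝ} (ha : 0 < a) {x : ℝ} (hx : 0 ≤ x) :
    ENNReal.ofReal ((1 + x) ^ (-a)) ≤
      ∑' k : ℕ, (if x < 2 ^ k then ENNReal.ofReal (2 ^ a * ((2 : ℝ) ^ (-a)) ^ k) else 0) := by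
  have hex : ∃ k : ℕ, x < 2 ^ k := pow_unbounded_of_one_lt x one_lt_two
  classical
  -- Only the term of the first `k` with `x < 2^k` is kept. For `k > 0` minimality gives `x ≥
  -- 2^(k-1)`, and the factor `2^a` pays for this shift by one; for `k = 0` the left side is at most
  -- one.
  refine le_trans ?_ (ENNReal.le_tsum (Nat.find hex))
  rw [if_pos (Nat.find_spec hex)]
  apply ENNReal.ofReal_le_ofReal
  rcases hk : Nat.find hex with _ | k
  · rw [pow_zero, mul_one]
    calc (1 + x) ^ (-a) ≤ 1 := Real.rpow_le_one_of_one_le_of_nonpos (by linarith) (by linarith)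
      _ ≤ 2 ^ a := Real.one_le_rpow (by norm_num) ha.le
  · have h1 : ¬ x < 2 ^ k := Nat.find_min hex (by omega)
    have h2 : (2 : ℝ) ^ a * ((2 : ℝ) ^ (-a)) ^ (k + 1) = ((2 : ℝ) ^ k) ^ (-a) := by
      rw [pow_succ, Real.rpow_neg (by norm_num), mul_comm, mul_assoc,
        inv_mul_cancel₀ (by positivity), mul_one, inv_pow, ← Real.rpow_natCast (2 ^ a),
        ← Real.rpow_mul (by norm_num), Real.rpow_neg (by positivity), ← Real.rpow_natCast 2 k,
        ← Real.rpow_mul (by norm_num), mul_comm]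
    rw [h2]
    exact Real.rpow_le_rpow_of_nonpos (by positivity) (by linarith [not_lt.1 h1]) (by linarith)

/-- Spectral smallness near the origin controls the spectral form of the variance in dilated
Fourier smooth windows. -/
theorem tendsto_integral_of_tendsto_measure_ball {ν : Measure (Space d)} [IsLocallyFiniteMeasure ν]
    {A : ℝ} (hA : ∀ r : ℝ, 1 ≤ r → ν.real (Metric.ball 0 r) ≤ A * r ^ d)
    (h : Tendsto (fun t : ℝ => ν.real (Metric.ball 0 t) / t ^ d) (𝓝[>] 0) (𝓝 0))
    {V : Set (Space d)} (hV : FourierSmooth V) :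
    Tendsto (fun t : ℝ => (∫ ξ, ‖𝓕 (indicatorOne (t • V)) ξ‖ ^ 2 ∂ν) / t ^ d) atTop (𝓝 0) := by
  obtain ⟨ϑ, hϑ, C, hC⟩ := hV
  obtain ⟨B, hB⟩ := exists_measure_ball_le_of_tendsto hA h
  have hB0 : ∀ r : ℝ, 0 < r → 0 ≤ ν.real (Metric.ball 0 r) / r ^ d := fun r hr => by positivity
  have ha : 0 < (d : ℝ) + ϑ := by positivity
  set a : ℝ := (d : ℝ) + ϑ with hadef
  have h2a : (2 : ℝ) ^ (-a) * 2 ^ d = 2 ^ (-ϑ) := by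
    rw [← Real.rpow_natCast, ← Real.rpow_add (by norm_num)]
    congr 1
    simp [hadef]
  -- The dyadic terms after division by `t^d`: rewriting `ν(B)` as its ratio to `(2^k / t)^d` turns
  -- the decay `2^{-ka}` into `2^{-kϑ}`, which is where `ϑ > 0` makes the series summable.
  set u : ℝ → ℕ → ℝ := fun t k => C ^ 2 * 2 ^ a * ((2 : ℝ) ^ (-ϑ)) ^ k *
    (ν.real (Metric.ball 0 (2 ^ k / t)) / (2 ^ k / t) ^ d) with hu
  have hgeo : Summable fun k : ℕ => C ^ 2 * 2 ^ a * ((2 : ℝ) ^ (-ϑ)) ^ k * B := by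
    refine Summable.mul_right _ (Summable.mul_left _ (summable_geometric_of_lt_one (by positivity) ?_))
    exact Real.rpow_lt_one_of_one_lt_of_neg (by norm_num) (by linarith)
  have hu0 : ∀ t, 0 < t → ∀ k, 0 ≤ u t k := fun t ht k => by
    have := hB0 (2 ^ k / t) (by positivity)
    positivity
  have hub : ∀ t, 0 < t → ∀ k, u t k ≤ C ^ 2 * 2 ^ a * ((2 : ℝ) ^ (-ϑ)) ^ k * B := fun t ht k =>
    mul_le_mul_of_nonneg_left (hB _ (by positivity)) (by positivity)
  have hus : ∀ t, 0 < t → Summable (u t) := fun t ht =>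
    Summable.of_nonneg_of_le (hu0 t ht) (hub t ht) hgeo
  -- Dominated convergence for series: for fixed `k` the radius `2^k / t` shrinks to zero, and the
  -- geometric series dominates uniformly in `t`.
  have hlim : Tendsto (fun t => ∑' k, u t k) atTop (𝓝 0) := by
    rw [← tsum_zero (α := ℝ) (β := ℕ)]
    refine tendsto_tsum_of_dominated_convergence hgeo (fun k => ?_) ?_
    · have h1 : Tendsto (fun t : ℝ => (2 : ℝ) ^ k / t) atTop (𝓝[>] 0) := by
        rw [tendsto_nhdsWithin_iff]
        refine ⟨tendsto_const_nhds.div_atTop tendsto_id, ?_⟩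
        filter_upwards [eventually_gt_atTop (0 : ℝ)] with t ht
        exact div_pos (by positivity) ht
      simpa using (h.comp h1).const_mul (C ^ 2 * 2 ^ a * ((2 : ℝ) ^ (-ϑ)) ^ k)
    · filter_upwards [eventually_gt_atTop (0 : ℝ)] with t ht k
      rw [Real.norm_of_nonneg (hu0 t ht k)]
      exact hub t ht k
  refine tendsto_of_tendsto_of_tendsto_of_le_of_le' tendsto_const_nhds hlim ?_ ?_
  · filter_upwards [eventually_gt_atTop (0 : ℝ)] with t ht
    exact div_nonneg (integral_nonneg fun ξ => by positivity) (by positivity)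
  filter_upwards [eventually_gt_atTop (0 : ℝ)] with t ht
  have hdecay : ∀ ξ, ‖𝓕 (indicatorOne V) ξ‖ ^ 2 ≤ C ^ 2 * (1 + ‖ξ‖) ^ (-a) := by
    intro ξ
    refine (pow_le_pow_left₀ (norm_nonneg _) (hC ξ) 2).trans (le_of_eq ?_)
    rw [mul_pow, ← Real.rpow_natCast ((1 + ‖ξ‖) ^ _), ← Real.rpow_mul (by positivity)]
    congr 2
    push_cast
    ring
  have hlint : ∫⁻ ξ, ENNReal.ofReal (‖𝓕 (indicatorOne (t • V)) ξ‖ ^ 2) ∂ν ≤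
      ENNReal.ofReal (t ^ d * ∑' k, u t k) := by
    have h1 : ∀ ξ, ENNReal.ofReal (‖𝓕 (indicatorOne (t • V)) ξ‖ ^ 2) ≤
        ENNReal.ofReal ((t ^ d) ^ 2 * C ^ 2) * ∑' k : ℕ,
          (if ‖t • ξ‖ < 2 ^ k then ENNReal.ofReal (2 ^ a * ((2 : ℝ) ^ (-a)) ^ k) else 0) := by
      intro ξ
      refine le_trans ?_ (mul_le_mul_right (one_add_rpow_neg_le_tsum ha (norm_nonneg (t • ξ))) _)
      rw [← ENNReal.ofReal_mul (by positivity)]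
      apply ENNReal.ofReal_le_ofReal
      rw [fourier_indicatorOne_smul V ht, norm_mul, mul_pow, norm_pow, Complex.norm_real,
        Real.norm_of_nonneg ht.le, mul_assoc]
      exact mul_le_mul_of_nonneg_left (hdecay _) (by positivity)
    have hset : ∀ k : ℕ, {ξ : Space d | ‖t • ξ‖ < 2 ^ k} = Metric.ball 0 (2 ^ k / t) := by
      intro k
      ext ξ
      rw [Set.mem_ofPred_eq, Metric.mem_ball, dist_zero_right, norm_smul, Real.norm_of_nonneg ht.le,
        lt_div_iff₀ ht, mul_comm]
    calc ∫⁻ ξ, ENNReal.ofReal (‖𝓕 (indicatorOne (t • V)) ξ‖ ^ 2) ∂ν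
        ≤ ∫⁻ ξ, ENNReal.ofReal ((t ^ d) ^ 2 * C ^ 2) * ∑' k : ℕ, {ξ : Space d | ‖t • ξ‖ < 2 ^ k}.indicator
          (fun _ => ENNReal.ofReal (2 ^ a * ((2 : ℝ) ^ (-a)) ^ k)) ξ ∂ν := by
          refine lintegral_mono fun ξ => (h1 ξ).trans (le_of_eq ?_)
          simp only [Set.indicator_apply, Set.mem_ofPred_eq]
      _ = ENNReal.ofReal ((t ^ d) ^ 2 * C ^ 2) * ∑' k : ℕ,
          ENNReal.ofReal (2 ^ a * ((2 : ℝ) ^ (-a)) ^ k) * ν (Metric.ball 0 (2 ^ k / t)) := by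
          simp_rw [hset]
          rw [lintegral_const_mul' _ _ ENNReal.ofReal_ne_top, lintegral_tsum]
          · congr 1
            refine tsum_congr fun k => ?_
            rw [lintegral_indicator_const measurableSet_ball]
          · intro k
            exact (measurable_const.indicator measurableSet_ball).aemeasurable
      _ = ∑' k : ℕ, ENNReal.ofReal (t ^ d * u t k) := by
          rw [← ENNReal.tsum_mul_left]
          refine tsum_congr fun k => ?_
          rw [← ofReal_measureReal (measure_ball_lt_top.ne), ← ENNReal.ofReal_mul (by positivity),
            ← ENNReal.ofReal_mul (by positivity)]
          congr 1
          rw [hu]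
          dsimp only
          have h3 : ((2 : ℝ) ^ (-ϑ)) ^ k = ((2 : ℝ) ^ (-a)) ^ k * ((2 : ℝ) ^ k) ^ d := by
            rw [← h2a, mul_pow, ← pow_mul, ← pow_mul, mul_comm d k]
          rw [h3, div_pow]
          field_simp
      _ = ENNReal.ofReal (t ^ d * ∑' k, u t k) := by
          rw [← tsum_mul_left, ENNReal.ofReal_tsum_of_nonneg
            (fun k => mul_nonneg (by positivity) (hu0 t ht k)) ((hus t ht).mul_left _)]
  rw [div_le_iff₀ (by positivity), mul_comm]
  have hnn : 0 ≤ t ^ d * ∑' k, u t k := mul_nonneg (by positivity) (tsum_nonneg (hu0 t ht))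
  -- Without integrability the Bochner integral is zero by convention, and the bound holds
  -- trivially.
  by_cases hi : Integrable (fun ξ => ‖𝓕 (indicatorOne (t • V)) ξ‖ ^ 2) ν
  · rw [← ofReal_integral_eq_lintegral_ofReal hi (ae_of_all _ fun ξ => by positivity)] at hlint
    exact (ENNReal.ofReal_le_ofReal_iff hnn).1 hlint
  · rw [integral_undef hi]
    exact hnn

end Hyperuniformity

/-! ### Decay of Bessel integrals -/

namespace Hyperuniformity

open scoped ContDiff ENNReal ComplexConjugate

/-- Decay of solutions of the Bessel type equation `r (J'' + J) = -2 a J'`. -/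
theorem exists_abs_le_rpow_of_bessel {a : ℝ} (ha : 0 < a) {J J₁ J₂ : ℝ → ℝ}
    (h1 : ∀ r, HasDerivAt J (J₁ r) r) (h2 : ∀ r, HasDerivAt J₁ (J₂ r) r)
    (hode : ∀ r, r * (J₂ r + J r) = -(2 * a) * J₁ r) :
    ∃ C, ∀ r, 4 * a ≤ r → |J r| ≤ C * r ^ (-a) := by
  -- The energy `J² + J₁²` has derivative `-(4a/r) J₁²`, which damps only `J₁`. The cross term
  -- spreads the damping over both: `F' = -(2a/r) F - (2a/r²) J J₁`.
  set F : ℝ → ℝ := fun r => J r ^ 2 + J₁ r ^ 2 + 2 * a / r * (J r * J₁ r) with hF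
  -- The power `r^(2a)` cancels the main damping and the exponential adds `-(2a/r²) F`, leaving a
  -- derivative with the sign of `-(F + J J₁)`, which is nonpositive for `r ≥ 4a`.
  set G : ℝ → ℝ := fun r => r ^ (2 * a) * Real.exp (2 * a / r) * F r with hG
  -- For `r ≥ 4a` the coefficient `2a/r` is at most `1/2`, so the cross term cannot destroy the
  -- energy.
  have hFge : ∀ r, 4 * a ≤ r → J r ^ 2 + J₁ r ^ 2 ≤ 2 * F r := by
    intro r hr
    have hr0 : 0 < r := by linarith
    have h3 : 2 * a / r ≤ 1 / 2 := by
      rw [div_le_div_iff₀ hr0 (by norm_num)]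
      linarith
    have h4 : 0 ≤ 2 * a / r := by positivity
    have h5 : |J r * J₁ r| ≤ (J r ^ 2 + J₁ r ^ 2) / 2 := by
      rw [abs_le]
      constructor <;> nlinarith [sq_nonneg (J r + J₁ r), sq_nonneg (J r - J₁ r)]
    have h6 : -(1 / 2 * |J r * J₁ r|) ≤ 2 * a / r * (J r * J₁ r) := by
      have h7 : -(2 * a / r * |J r * J₁ r|) ≤ 2 * a / r * (J r * J₁ r) := by
        rw [← mul_neg]
        exact mul_le_mul_of_nonneg_left (neg_abs_le _) h4
      have h8 := mul_le_mul_of_nonneg_right h3 (abs_nonneg (J r * J₁ r))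
      linarith
    simp only [hF]
    nlinarith [sq_nonneg (J r), sq_nonneg (J₁ r)]
  have hF' : ∀ r, 0 < r → HasDerivAt F
      (-(2 * a / r) * F r - 2 * a / r ^ 2 * (J r * J₁ r)) r := by
    intro r hr
    have h3 : HasDerivAt (fun r : ℝ => 2 * a / r) (-(2 * a) / r ^ 2) r := by
      have := (hasDerivAt_inv hr.ne').const_mul (2 * a)
      refine this.congr_deriv ?_
      field_simp
    have h4 := (((h1 r).pow 2).add ((h2 r).pow 2)).add (h3.mul ((h1 r).mul (h2 r)))
    refine h4.congr_deriv ?_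
    have h5 : J₂ r = -J r - 2 * a / r * J₁ r := by
      have := hode r
      field_simp
      linarith
    simp only [hF, h5, Pi.mul_apply]
    field_simp
    ring
  have hG' : ∀ r, 0 < r → HasDerivAt G
      (r ^ (2 * a) * Real.exp (2 * a / r) * (-(2 * a / r ^ 2) * (F r + J r * J₁ r))) r := by
    intro r hr
    have h3 : HasDerivAt (fun r : ℝ => 2 * a / r) (-(2 * a) / r ^ 2) r := by
      have := (hasDerivAt_inv hr.ne').const_mul (2 * a)
      refine this.congr_deriv ?_
      field_simp
    have h4 : HasDerivAt (fun r : ℝ => r ^ (2 * a)) (2 * a / r * r ^ (2 * a)) r := by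
      refine (Real.hasDerivAt_rpow_const (Or.inl hr.ne')).congr_deriv ?_
      rw [Real.rpow_sub_one hr.ne']
      ring
    refine ((h4.mul h3.exp).mul (hF' r hr)).congr_deriv ?_
    simp only [Pi.mul_apply]
    ring
  have hanti : AntitoneOn G (Set.Ici (4 * a)) := by
    refine antitoneOn_of_deriv_nonpos (convex_Ici _) ?_ ?_ ?_
    · intro r hr
      exact (hG' r (by linarith [Set.mem_Ici.1 hr])).continuousAt.continuousWithinAt
    · intro r hr
      rw [interior_Ici, Set.mem_Ioi] at hr
      exact (hG' r (by linarith)).differentiableAt.differentiableWithinAt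
    · intro r hr
      rw [interior_Ici, Set.mem_Ioi] at hr
      rw [(hG' r (by linarith)).deriv]
      have hr0 : 0 < r := by linarith
      have h3 := hFge r hr.le
      have h4 : 0 ≤ F r + J r * J₁ r := by nlinarith [sq_nonneg (J r + J₁ r)]
      have h5 : 0 ≤ 2 * a / r ^ 2 * (F r + J r * J₁ r) := by positivity
      rw [neg_mul]
      exact mul_nonpos_of_nonneg_of_nonpos (by positivity) (by linarith)
  refine ⟨√(2 * G (4 * a)), fun r hr => ?_⟩
  have hr0 : 0 < r := by linarith
  have h3 := hanti Set.self_mem_Ici hr hr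
  have h4 : J r ^ 2 ≤ 2 * F r := by nlinarith [hFge r hr, sq_nonneg (J₁ r)]
  have h5 : r ^ (2 * a) * F r ≤ G (4 * a) := by
    refine le_trans ?_ h3
    have h6 : (1 : ℝ) ≤ Real.exp (2 * a / r) := Real.one_le_exp (by positivity)
    have h7 : 0 ≤ r ^ (2 * a) * F r := mul_nonneg (by positivity) (by nlinarith [sq_nonneg (J r)])
    calc r ^ (2 * a) * F r ≤ (r ^ (2 * a) * F r) * Real.exp (2 * a / r) :=
          le_mul_of_one_le_right h7 h6
      _ = G r := by simp only [hG]; ring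
  have h8 : r ^ (2 * a) = (r ^ a) ^ 2 := by
    rw [← Real.rpow_natCast, ← Real.rpow_mul hr0.le, mul_comm]
    norm_num
  rw [Real.rpow_neg hr0.le, ← div_eq_mul_inv, le_div_iff₀ (by positivity)]
  apply Real.le_sqrt_of_sq_le
  rw [mul_pow, sq_abs, ← h8]
  have : 0 < r ^ (2 * a) := by positivity
  nlinarith

/-- The integral `∫ s in -1..1, (1 - s²) ^ m cos(r s)`, a multiple of a Bessel function. -/
noncomputable def besselIntegral (m r : ℝ) : ℝ :=
  ∫ s in (-1 : ℝ)..1, (1 - s ^ 2) ^ m * Real.cos (r * s)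

/-- Differentiating twice under the integral gives `r (J'' + J) = ∫ (1 - s²)^(m+1) d(sin(rs))`.
Integration by parts, whose boundary terms vanish, turns this into `-2(m+1) J'`: the Bessel type
equation with `a = m + 1`. -/
theorem exists_besselIntegral_le {m : ℝ} (hm : 0 ≤ m) :
    ∃ C, ∀ r, 4 * (m + 1) ≤ r → |besselIntegral m r| ≤ C * r ^ (-(m + 1)) := by
  have hg : Continuous fun s : ℝ => (1 - s ^ 2) ^ m :=
    Continuous.rpow_const (by fun_prop) fun _ => Or.inr hm
  have hderiv : ∀ (u v : ℝ → ℝ) (g : ℝ → ℝ), Continuous g → (∀ x, HasDerivAt u (v x) x) →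
      Continuous v → (∀ x, |v x| ≤ 1) → ∀ r, HasDerivAt (fun r => ∫ s in (-1 : ℝ)..1, g s * u (r * s))
        (∫ s in (-1 : ℝ)..1, g s * (s * v (r * s))) r := by
    intro u v g hg hu hv hv1 r
    have huc : Continuous u := continuous_iff_continuousAt.2 fun x => (hu x).continuousAt
    refine (intervalIntegral.hasDerivAt_integral_of_dominated_loc_of_deriv_le
      (bound := fun s => |g s| * |s|) (s := Set.univ)
      (F := fun r s => g s * u (r * s)) (F' := fun r s => g s * (s * v (r * s)))
      (μ := volume) (x₀ := r) (a := -1) (b := 1) univ_mem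
      (Eventually.of_forall fun x => ?_) ?_ ?_ (ae_of_all _ fun s _ x _ => ?_) ?_
      (ae_of_all _ fun s _ x _ => ?_)).2
    · exact Continuous.aestronglyMeasurable (by fun_prop)
    · exact Continuous.intervalIntegrable (by fun_prop) _ _
    · exact Continuous.aestronglyMeasurable (by fun_prop)
    · rw [Real.norm_eq_abs, abs_mul, abs_mul]
      exact mul_le_mul_of_nonneg_left (mul_le_of_le_one_right (abs_nonneg _) (hv1 _)) (abs_nonneg _)
    · exact Continuous.intervalIntegrable (by fun_prop) _ _
    · have h1 : HasDerivAt (fun x => x * s) s x := by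
        simpa using (hasDerivAt_id x).mul_const s
      refine (((hu (x * s)).comp x h1).const_mul (g s)).congr_deriv ?_
      ring
  have h1 := hderiv Real.cos (fun x => -Real.sin x) _ hg (fun x => Real.hasDerivAt_cos x)
    (by fun_prop) fun x => by rw [abs_neg]; exact Real.abs_sin_le_one x
  have h2' := hderiv (fun x => -Real.sin x) (fun x => -Real.cos x)
    (fun s => (1 - s ^ 2) ^ m * s) (by fun_prop) (fun x => (Real.hasDerivAt_sin x).neg)
    (by fun_prop) fun x => by rw [abs_neg]; exact Real.abs_cos_le_one x
  refine exists_abs_le_rpow_of_bessel (by linarith) h1 (fun r => (h2' r).congr_of_eventuallyEq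
    (Eventually.of_forall fun r => ?_)) fun r => ?_
  · simp only [mul_assoc]
  · have hh : ∀ s : ℝ, HasDerivAt (fun s : ℝ => (1 - s ^ 2) ^ (m + 1))
        (-(2 * (m + 1)) * ((1 - s ^ 2) ^ m * s)) s := by
      intro s
      have h3 : HasDerivAt (fun s : ℝ => 1 - s ^ 2) (-(2 * s)) s := by
        simpa using ((hasDerivAt_id s).pow 2).const_sub 1
      refine (h3.rpow_const (p := m + 1) (Or.inr (by linarith))).congr_deriv ?_
      rw [add_sub_cancel_right]
      ring
    have hsin : ∀ s : ℝ, HasDerivAt (fun s : ℝ => Real.sin (r * s)) (r * Real.cos (r * s)) s := by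
      intro s
      have h3 : HasDerivAt (fun x => r * x) r s := by
        simpa using (hasDerivAt_id s).const_mul r
      refine ((Real.hasDerivAt_sin (r * s)).comp s h3).congr_deriv ?_
      ring
    have hparts := intervalIntegral.integral_mul_deriv_eq_deriv_mul (a := -1) (b := 1)
      (fun s _ => hh s) (fun s _ => hsin s)
      (Continuous.intervalIntegrable (by fun_prop) _ _)
      (Continuous.intervalIntegrable (by fun_prop) _ _)
    have hz : (0 : ℝ) ^ (m + 1) = 0 := Real.zero_rpow (by linarith)
    norm_num [hz] at hparts
    rw [besselIntegral, ← intervalIntegral.integral_add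
      (Continuous.intervalIntegrable (by fun_prop) _ _)
      (Continuous.intervalIntegrable (by fun_prop) _ _), ← intervalIntegral.integral_const_mul,
      ← intervalIntegral.integral_const_mul]
    have hl : ∫ s in (-1 : ℝ)..1, r * ((1 - s ^ 2) ^ m * s * (s * -Real.cos (r * s)) +
        (1 - s ^ 2) ^ m * Real.cos (r * s)) =
        ∫ s in (-1 : ℝ)..1, (1 - s ^ 2) ^ (m + 1) * (r * Real.cos (r * s)) := by
      refine intervalIntegral.integral_congr fun s hs => ?_
      rw [Set.uIcc_of_le (by norm_num)] at hs
      have h3 : 0 ≤ 1 - s ^ 2 := by nlinarith [hs.1, hs.2]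
      have h4 : (1 - s ^ 2) ^ (m + 1) = (1 - s ^ 2) ^ m * (1 - s ^ 2) := by
        rw [Real.rpow_add_of_nonneg h3 hm zero_le_one, Real.rpow_one]
      simp only [h4]
      ring
    rw [hl, hparts]
    refine intervalIntegral.integral_congr fun s _ => ?_
    ring

end Hyperuniformity

/-! ### Fourier smoothness of the unit ball -/

namespace Hyperuniformity

open scoped ContDiff ENNReal ComplexConjugate

/-- Any isometry sends the axis vector of length `‖ξ‖` to a vector of the same norm as `ξ`; a
reflection then carries that vector to `ξ`. -/
theorem exists_isometry_of_prod {n : ℕ} (ξ : Space (n + 1)) :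
    ∃ A : WithLp 2 (ℝ × Space n) ≃ₗᵢ[ℝ] Space (n + 1), A (WithLp.toLp 2 (‖ξ‖, 0)) = ξ := by
  have hdim : Module.finrank ℝ (WithLp 2 (ℝ × Space n)) = Module.finrank ℝ (Space (n + 1)) := by
    rw [(WithLp.linearEquiv 2 ℝ (ℝ × Space n)).finrank_eq]
    simp [add_comm]
  let B := (stdOrthonormalBasis ℝ (WithLp 2 (ℝ × Space n))).equiv
    (stdOrthonormalBasis ℝ (Space (n + 1))) (finCongr hdim)
  have hB : ‖B (WithLp.toLp 2 (‖ξ‖, 0))‖ = ‖ξ‖ := by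
    rw [B.norm_map, WithLp.prod_norm_eq_of_L2]
    simp
  refine ⟨B.trans ((ℝ ∙ (B (WithLp.toLp 2 (‖ξ‖, 0)) - ξ))ᗮ).reflection, ?_⟩
  exact Submodule.reflection_sub hB

theorem volume_slice {n : ℕ} {s : ℝ} (hs : s ∈ Set.Ioo (-1 : ℝ) 1) :
    (volume : Measure (Space n)).real {y | s ^ 2 + ‖y‖ ^ 2 < 1} =
      (volume : Measure (Space n)).real (Metric.ball 0 1) * (1 - s ^ 2) ^ ((n : ℝ) / 2) := by
  have h1 : 0 < 1 - s ^ 2 := by nlinarith [hs.1, hs.2]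
  have h2 : {y : Space n | s ^ 2 + ‖y‖ ^ 2 < 1} = Metric.ball 0 √(1 - s ^ 2) := by
    ext y
    rw [Set.mem_ofPred_eq, Metric.mem_ball, dist_zero_right, Real.lt_sqrt (norm_nonneg y)]
    constructor <;> intro h <;> linarith
  rw [h2, measureReal_def, Measure.addHaar_ball_of_pos _ _ (Real.sqrt_pos.2 h1),
    finrank_euclideanSpace_fin, ENNReal.toReal_mul, ENNReal.toReal_ofReal (by positivity), mul_comm,
    measureReal_def, Real.sqrt_eq_rpow, ← Real.rpow_natCast, ← Real.rpow_mul h1.le]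
  congr 2
  ring

theorem slice_eq_empty {n : ℕ} {s : ℝ} (hs : s ∉ Set.Ioo (-1 : ℝ) 1) :
    {y : Space n | s ^ 2 + ‖y‖ ^ 2 < 1} = ∅ := by
  ext y
  simp only [Set.mem_ofPred_eq, Set.mem_empty_iff_false, iff_false, not_lt]
  have : 1 ≤ s ^ 2 := by
    rw [one_le_sq_iff_one_le_abs]
    by_contra h
    exact hs (abs_lt.1 (not_le.1 h))
  nlinarith [sq_nonneg ‖y‖]

/-- After rotating `ξ` onto the first axis, the wave depends only on the first coordinate `s`.
Integrating out the others gives the slice volume, proportional to `(1 - s²)^(n/2)`, and the sine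
part vanishes by oddness. -/
theorem norm_fourier_ball {n : ℕ} (ξ : Space (n + 1)) :
    ‖𝓕 (indicatorOne (Metric.ball (0 : Space (n + 1)) 1)) ξ‖ =
      (volume : Measure (Space n)).real (Metric.ball 0 1) *
        |besselIntegral ((n : ℝ) / 2) (2 * Real.pi * ‖ξ‖)| := by
  obtain ⟨A, hA⟩ := exists_isometry_of_prod ξ
  set v := (volume : Measure (Space n)).real (Metric.ball 0 1)
  set e : ℝ → ℂ := fun s => Complex.exp (((-(2 * Real.pi * ‖ξ‖ * s) : ℝ) : ℂ) * Complex.I) with he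
  set S : Set (ℝ × Space n) := {z | z.1 ^ 2 + ‖z.2‖ ^ 2 < 1} with hS
  have hSm : MeasurableSet S := (isOpen_lt (by fun_prop) continuous_const).measurableSet
  have hSb : Bornology.IsBounded S := by
    refine (Metric.isBounded_closedBall (x := (0 : ℝ × Space n)) (r := 1)).subset fun z hz => ?_
    have hz' : z.1 ^ 2 + ‖z.2‖ ^ 2 < 1 := hz
    rw [Metric.mem_closedBall, dist_zero_right, Prod.norm_def, max_le_iff]
    constructor
    · rw [Real.norm_eq_abs, ← sq_le_one_iff_abs_le_one]
      nlinarith [sq_nonneg ‖z.2‖]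
    · nlinarith [sq_nonneg z.1, norm_nonneg z.2]
  have hint : Integrable (fun z : ℝ × Space n => S.indicator (fun z => e z.1) z)
      (volume.prod volume) := by
    rw [integrable_indicator_iff hSm]
    refine Measure.integrableOn_of_bounded (M := 1) ?_ (Continuous.aestronglyMeasurable ?_) ?_
    · exact hSb.measure_lt_top.ne
    · fun_prop
    · exact ae_of_all _ fun z => by rw [he]; exact (Complex.norm_exp_ofReal_mul_I _).le
  have h1 : 𝓕 (indicatorOne (Metric.ball (0 : Space (n + 1)) 1)) ξ =
      ∫ z : ℝ × Space n, S.indicator (fun z => e z.1) z := by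
    rw [fourier_eq_wave, ← A.measurePreserving.integral_comp A.toHomeomorph.measurableEmbedding,
      ← (WithLp.volume_preserving_toLp (U := ℝ) (V := Space n)).integral_comp
        (MeasurableEquiv.toLp 2 (ℝ × Space n)).measurableEmbedding]
    refine integral_congr_ae (ae_of_all _ fun z => ?_)
    dsimp only
    have h2 : wave (-ξ) (A (WithLp.toLp 2 z)) = e z.1 := by
      rw [wave, inner_neg_right]
      conv_lhs => rw [← hA, A.inner_map_map, WithLp.prod_inner_apply]
      simp only [he, inner_zero_right, add_zero]
      congr 3
      simp
      ring
    have h3 : A (WithLp.toLp 2 z) ∈ Metric.ball (0 : Space (n + 1)) 1 ↔ z ∈ S := by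
      rw [Metric.mem_ball, dist_zero_right, A.norm_map, WithLp.prod_norm_eq_of_L2,
        Real.sqrt_lt' one_pos]
      simp [hS]
    by_cases hz : z ∈ S
    · rw [Set.indicator_of_mem hz, indicatorOne, Set.indicator_of_mem (h3.2 hz), h2, mul_one]
    · rw [Set.indicator_of_notMem hz, indicatorOne,
        Set.indicator_of_notMem (fun h => hz (h3.1 h)), mul_zero]
  have h4 : ∫ z : ℝ × Space n, S.indicator (fun z => e z.1) z =
      ∫ s in (-1 : ℝ)..1, (v : ℂ) * (((1 - s ^ 2) ^ ((n : ℝ) / 2) : ℝ) : ℂ) * e s := by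
    rw [Measure.volume_eq_prod, integral_prod _ hint, intervalIntegral.integral_of_le (by norm_num),
      integral_Ioc_eq_integral_Ioo, ← integral_indicator measurableSet_Ioo]
    refine integral_congr_ae (ae_of_all _ fun s => ?_)
    have h5 : ∀ y : Space n, S.indicator (fun z => e z.1) (s, y) =
        {y : Space n | s ^ 2 + ‖y‖ ^ 2 < 1}.indicator (fun _ => e s) y := fun y => rfl
    dsimp only
    simp_rw [h5]
    by_cases hs : s ∈ Set.Ioo (-1 : ℝ) 1
    · rw [Set.indicator_of_mem hs, integral_indicator_const _
        (isOpen_lt (by fun_prop) continuous_const).measurableSet, volume_slice hs,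
        Complex.real_smul, Complex.ofReal_mul]
    · rw [Set.indicator_of_notMem hs, slice_eq_empty hs]
      simp
  have hgc : Continuous fun s : ℝ => (1 - s ^ 2) ^ ((n : ℝ) / 2) :=
    Continuous.rpow_const (by fun_prop) fun _ => Or.inr (by positivity)
  have h6 : ∫ s in (-1 : ℝ)..1, (v : ℂ) * (((1 - s ^ 2) ^ ((n : ℝ) / 2) : ℝ) : ℂ) * e s =
      v * besselIntegral ((n : ℝ) / 2) (2 * Real.pi * ‖ξ‖) := by
    have hodd : ∫ s in (-1 : ℝ)..1, (1 - s ^ 2) ^ ((n : ℝ) / 2) *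
        Real.sin (2 * Real.pi * ‖ξ‖ * s) = 0 := by
      have h7 := intervalIntegral.integral_comp_neg (a := -1) (b := 1)
        (fun s : ℝ => (1 - s ^ 2) ^ ((n : ℝ) / 2) * Real.sin (2 * Real.pi * ‖ξ‖ * s))
      simp only [neg_neg, neg_sq, mul_neg, Real.sin_neg, intervalIntegral.integral_neg] at h7
      linarith
    have h8 : ∀ s : ℝ, (v : ℂ) * (((1 - s ^ 2) ^ ((n : ℝ) / 2) : ℝ) : ℂ) * e s =
        v * ((((1 - s ^ 2) ^ ((n : ℝ) / 2) * Real.cos (2 * Real.pi * ‖ξ‖ * s) : ℝ) : ℂ) -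
          Complex.I * (((1 - s ^ 2) ^ ((n : ℝ) / 2) * Real.sin (2 * Real.pi * ‖ξ‖ * s) : ℝ) : ℂ)) := by
      intro s
      rw [he]
      dsimp only
      rw [Complex.exp_mul_I, ← Complex.ofReal_cos, ← Complex.ofReal_sin, Real.cos_neg, Real.sin_neg]
      push_cast
      ring
    simp_rw [h8]
    rw [intervalIntegral.integral_const_mul, intervalIntegral.integral_sub
      (Continuous.intervalIntegrable (by fun_prop) _ _)
      (Continuous.intervalIntegrable (by fun_prop) _ _), intervalIntegral.integral_const_mul,
      intervalIntegral.integral_ofReal, intervalIntegral.integral_ofReal, hodd, besselIntegral]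
    simp
  rw [h1, h4, h6, norm_mul, Complex.norm_real, Complex.norm_real,
    Real.norm_of_nonneg measureReal_nonneg, Real.norm_eq_abs]

/-- Euclidean balls are Fourier smooth. -/
theorem fourierSmooth_ball (d : ℕ) : FourierSmooth (Metric.ball (0 : Space d) 1) := by
  -- In dimension `n + 1` the Bessel decay exponent `n/2 + 1` equals `(d + 1)/2`, hence `ϑ = 1`.
  -- Dimension zero has a single frequency.
  refine ⟨1, one_pos, ?_⟩
  rcases d with _ | n
  · refine ⟨‖𝓕 (indicatorOne (Metric.ball (0 : Space 0) 1)) 0‖, fun ξ => ?_⟩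
    rw [Subsingleton.elim ξ 0]
    simp [indicatorOne]
  obtain ⟨C, hC⟩ := exists_besselIntegral_le (m := (n : ℝ) / 2) (by positivity)
  set v := (volume : Measure (Space n)).real (Metric.ball 0 1)
  have hexp : -(((n + 1 : ℕ) : ℝ) + 1) / 2 = -((n : ℝ) / 2 + 1) := by
    push_cast
    ring
  set a : ℝ := (n : ℝ) / 2 + 1 with ha
  have ha1 : 1 ≤ a := by
    have : (0 : ℝ) ≤ (n : ℝ) / 2 := by positivity
    linarith
  set b := l2norm ((Metric.closedBall (0 : Space (n + 1)) 1).indicator fun _ => (1 : ℂ)) *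
    l2norm (indicatorOne (Metric.ball (0 : Space (n + 1)) 1))
  have hb : ∀ ξ, ‖𝓕 (indicatorOne (Metric.ball (0 : Space (n + 1)) 1)) ξ‖ ≤ b :=
    norm_fourier_le (memLp_indicatorOne Metric.isBounded_ball measurableSet_ball) fun x hx =>
      Set.indicator_of_notMem (by simpa using hx.le) _
  have hb0 : 0 ≤ b := (norm_nonneg _).trans (hb 0)
  -- The first constant serves the frequencies where the Bessel bound applies; the second serves the
  -- remaining bounded range, where the uniform bound `b` suffices.
  refine ⟨max (v * max C 0) (b * (1 + 4 * a) ^ a), fun ξ => ?_⟩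
  change ‖𝓕 (indicatorOne (Metric.ball (0 : Space (n + 1)) 1)) ξ‖ ≤ _
  rw [hexp]
  rcases le_or_gt (4 * a) (2 * Real.pi * ‖ξ‖) with h | h
  · have h1 := hC _ h
    have h2 : 1 + ‖ξ‖ ≤ 2 * Real.pi * ‖ξ‖ := by
      have hpi := Real.pi_lt_four
      have hpi3 := Real.pi_gt_three
      nlinarith [norm_nonneg ξ]
    have h3 : (2 * Real.pi * ‖ξ‖) ^ (-a) ≤ (1 + ‖ξ‖) ^ (-a) :=
      Real.rpow_le_rpow_of_nonpos (by positivity) h2 (by linarith)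
    calc ‖𝓕 (indicatorOne (Metric.ball (0 : Space (n + 1)) 1)) ξ‖
        = v * |besselIntegral ((n : ℝ) / 2) (2 * Real.pi * ‖ξ‖)| := norm_fourier_ball ξ
      _ ≤ v * (max C 0 * (1 + ‖ξ‖) ^ (-a)) := by
          refine mul_le_mul_of_nonneg_left (h1.trans ?_) measureReal_nonneg
          exact mul_le_mul (le_max_left _ _) h3 (by positivity) (le_max_right _ _)
      _ = (v * max C 0) * (1 + ‖ξ‖) ^ (-a) := by ring
      _ ≤ _ := mul_le_mul_of_nonneg_right (le_max_left _ _) (by positivity)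
  · have h2 : 1 + ‖ξ‖ ≤ 1 + 4 * a := by
      have hpi3 := Real.pi_gt_three
      nlinarith [norm_nonneg ξ]
    have h3 : (1 + 4 * a) ^ (-a) ≤ (1 + ‖ξ‖) ^ (-a) :=
      Real.rpow_le_rpow_of_nonpos (by positivity) h2 (by linarith)
    calc ‖𝓕 (indicatorOne (Metric.ball (0 : Space (n + 1)) 1)) ξ‖ ≤ b := hb ξ
      _ = (b * (1 + 4 * a) ^ a) * (1 + 4 * a) ^ (-a) := by
          rw [mul_assoc, ← Real.rpow_add (by positivity)]
          simp
      _ ≤ (b * (1 + 4 * a) ^ a) * (1 + ‖ξ‖) ^ (-a) := by gcongr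
      _ ≤ _ := mul_le_mul_of_nonneg_right (le_max_right _ _) (by positivity)

end Hyperuniformity

/-! ### Measurability of random measures and mixed second moments -/

namespace Hyperuniformity

open scoped ENNReal ComplexConjugate

section General

variable {Ω X : Type*} [MeasurableSpace Ω] [mX : MeasurableSpace X] {P : Measure Ω}

/-- A measure-valued map is almost everywhere measurable as soon as its values on a countable
π-system inside an exhausting sequence of sets of finite measure are. -/
theorem aemeasurable_measure_of_isPiSystem {κ : Ω → Measure X} {C : Set (Set X)}
    (hCc : C.Countable) (hCpi : IsPiSystem C) (hgen : mX = MeasurableSpace.generateFrom C)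
    {B : ℕ → Set X} (hBmono : Monotone B) (hBmeas : ∀ n, MeasurableSet (B n))
    (hBU : ⋃ n, B n = Set.univ) (hfin : ∀ ω n, κ ω (B n) < ∞)
    (hC : ∀ n, ∀ s ∈ C, AEMeasurable (fun ω => κ ω (s ∩ B n)) P)
    (hB : ∀ n, AEMeasurable (fun ω => κ ω (B n)) P) : AEMeasurable κ P := by
  classical
  have hC' : ∀ n, ∀ s ∈ insert Set.univ C, AEMeasurable (fun ω => κ ω (s ∩ B n)) P := by
    rintro n s (rfl | hs)
    · simpa using hB n
    · exact hC n s hs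
  choose! g hgm hge using hC'
  have hae : ∀ᵐ ω ∂P, ∀ n, ∀ s ∈ insert Set.univ C, κ ω (s ∩ B n) = g n s ω := by
    rw [ae_all_iff]
    intro n
    rw [ae_ball_iff (hCc.insert _)]
    exact fun s hs => hge n s hs
  -- Countability of `C` gives one null set off which all evaluations agree with measurable
  -- versions. Setting the map to zero on a measurable null set containing it makes these
  -- evaluations measurable.
  set T : Set Ω := toMeasurable P {ω | ∀ n, ∀ s ∈ insert Set.univ C, κ ω (s ∩ B n) = g n s ω}ᶜ
  have hT : MeasurableSet T := measurableSet_toMeasurable _ _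
  have hT0 : P T = 0 := by
    rw [measure_toMeasurable]
    exact hae
  have hTg : ∀ ω ∉ T, ∀ n, ∀ s ∈ insert Set.univ C, κ ω (s ∩ B n) = g n s ω := by
    intro ω hω
    by_contra h
    exact hω (subset_toMeasurable _ _ h)
  set κ' : Ω → Measure X := fun ω => if ω ∈ T then 0 else κ ω with hκ'
  have hκ'm : ∀ n, ∀ s ∈ insert Set.univ C, Measurable fun ω => κ' ω (s ∩ B n) := by
    intro n s hs
    have h1 : (fun ω => κ' ω (s ∩ B n)) = fun ω => if ω ∈ T then 0 else g n s ω := by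
      ext ω
      by_cases hω : ω ∈ T
      · simp [hκ', hω]
      · simp [hκ', hω, hTg ω hω n s hs]
    rw [h1]
    exact Measurable.ite hT measurable_const (hgm n s hs)
  -- The π-λ argument needs finite measures, hence the restriction to each `B n`; exhaustion
  -- recovers the full measure.
  have hres : ∀ n, Measurable fun ω => (κ' ω).restrict (B n) := by
    intro n
    have : ∀ ω, IsFiniteMeasure ((κ' ω).restrict (B n)) := by
      intro ω
      refine ⟨?_⟩
      rw [Measure.restrict_apply_univ]
      by_cases hω : ω ∈ T
      · simp [hκ', hω]
      · simpa [hκ', hω] using hfin ω n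
    refine Measurable.measure_of_isPiSystem hgen hCpi (fun s hs => ?_) ?_
    · simp_rw [Measure.restrict_apply' (hBmeas n)]
      exact hκ'm n s (Set.mem_insert_of_mem _ hs)
    · simp_rw [Measure.restrict_apply' (hBmeas n)]
      exact hκ'm n _ (Set.mem_insert _ _)
  refine ⟨κ', Measure.measurable_of_measurable_coe _ fun s hs => ?_, ?_⟩
  · have h1 : (fun ω => κ' ω s) = fun ω => ⨆ n, (κ' ω).restrict (B n) s := by
      ext ω
      simp_rw [Measure.restrict_apply' (hBmeas _)]
      rw [← Monotone.measure_iUnion, ← Set.inter_iUnion, hBU, Set.inter_univ]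
      exact fun m n hmn => Set.inter_subset_inter_right s (hBmono hmn)
    rw [h1]
    exact Measurable.iSup fun n => (Measure.measurable_coe hs).comp (hres n)
  · have : ∀ᵐ ω ∂P, ω ∉ T := measure_eq_zero_iff_ae_notMem.1 hT0
    filter_upwards [this] with ω hω
    simp [hκ', hω]

/-- A Campbell formula. Replacing `κ` by a measurable version gives a kernel, for which integration
against the composition is iterated integration. -/
theorem integral_bind {κ : Ω → Measure X} (hκ : AEMeasurable κ P) {f : X → ℂ}
    (hf : Integrable f (P.bind κ)) :
    Integrable (fun ω => ∫ x, f x ∂κ ω) P ∧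
      ∫ x, f x ∂(P.bind κ) = ∫ ω, ∫ x, f x ∂κ ω ∂P := by
  let k : ProbabilityTheory.Kernel Ω X := ⟨hκ.mk κ, hκ.measurable_mk⟩
  have hk : P.bind κ = (k.comp (ProbabilityTheory.Kernel.const Unit P)) () := by
    rw [← Measure.comp_eq_comp_const_apply]
    exact Measure.bind_congr_right hκ.ae_eq_mk
  have hae : (fun ω => ∫ x, f x ∂k ω) =ᵐ[P] fun ω => ∫ x, f x ∂κ ω := by
    filter_upwards [hκ.ae_eq_mk] with ω hω
    rw [hω]
    rfl
  rw [hk] at hf ⊢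
  refine ⟨?_, ?_⟩
  · have := hf.integral_comp
    rw [ProbabilityTheory.Kernel.const_apply] at this
    exact this.congr hae
  · rw [ProbabilityTheory.Kernel.integral_comp hf, ProbabilityTheory.Kernel.const_apply]
    exact integral_congr_ae hae

end General

variable {d : ℕ}

theorem exists_countable_piSystem (d : ℕ) : ∃ C : Set (Set (Space d)), C.Countable ∧ IsPiSystem C ∧
    Set.univ ∈ C ∧ MeasurableSpace.generateFrom C = WithLp.measurableSpace 2 (Fin d → ℝ) ∧
    ∀ s ∈ C, MeasurableSet s := by
  set B := TopologicalSpace.countableBasis (Space d) with hB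
  have hm : ∀ s ∈ Set.sInter '' {F | F ⊆ B ∧ F.Finite}, MeasurableSet s := by
    rintro _ ⟨F, ⟨hF, hFf⟩, rfl⟩
    exact MeasurableSet.sInter hFf.countable fun t ht =>
      ((TopologicalSpace.isBasis_countableBasis (Space d)).isOpen (hF ht)).measurableSet
  refine ⟨Set.sInter '' {F | F ⊆ B ∧ F.Finite}, ?_, ?_, ?_, le_antisymm ?_ ?_, hm⟩
  · refine Set.Countable.image ?_ _
    have := Set.countable_ofPred_finite_subset (TopologicalSpace.countable_countableBasis (Space d))
    simpa only [and_comm] using this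
  · rintro _ ⟨F, ⟨hF, hFf⟩, rfl⟩ _ ⟨G, ⟨hG, hGf⟩, rfl⟩ -
    exact ⟨F ∪ G, ⟨Set.union_subset hF hG, hFf.union hGf⟩, Set.sInter_union F G⟩
  · exact ⟨∅, ⟨Set.empty_subset _, Set.finite_empty⟩, Set.sInter_empty⟩
  · exact MeasurableSpace.generateFrom_le hm
  · rw [(BorelSpace.measurable_eq : WithLp.measurableSpace 2 (Fin d → ℝ) = borel (Space d)),
      (TopologicalSpace.isBasis_countableBasis (Space d)).borel_eq_generateFrom]
    refine MeasurableSpace.generateFrom_mono fun s hs => ?_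
    exact ⟨{s}, ⟨Set.singleton_subset_iff.2 hs, Set.finite_singleton s⟩, Set.sInter_singleton s⟩

theorem iUnion_ball_natCast : ⋃ n : ℕ, Metric.ball (0 : Space d) n = Set.univ := by
  ext x
  simp

theorem monotone_ball_natCast : Monotone fun n : ℕ => Metric.ball (0 : Space d) n :=
  fun _ _ h => Metric.ball_subset_ball (Nat.cast_le.2 h)

section RandomMeasures

variable {Ω : Type*} [MeasurableSpace Ω] [AddAction (Space d) Ω] {P : Measure Ω}

/-- A stationary, locally square-integrable random positive measure. -/
structure IsStationaryL2 (P : Measure Ω) (a : Ω → Measure (Space d)) : Prop where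
  locallyFinite : ∀ ω, IsLocallyFiniteMeasure (a ω)
  aemeasurable_apply : ∀ B, Bornology.IsBounded B → MeasurableSet B →
    AEMeasurable (fun ω => a ω B) P
  equivariant : ∀ (g : Space d) ω, a (g +ᵥ ω) = (a ω).map (fun x => g + x)
  moment : ∀ B, Bornology.IsBounded B → MeasurableSet B → ∫⁻ ω, a ω B ^ 2 ∂P < ∞

variable {a b : Ω → Measure (Space d)}

theorem IsStationaryL2.aemeasurable (ha : IsStationaryL2 P a) : AEMeasurable a P := by
  have := ha.locallyFinite
  obtain ⟨C, hCc, hCpi, hCu, hCg, hCm⟩ := exists_countable_piSystem d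
  refine aemeasurable_measure_of_isPiSystem hCc hCpi
    hCg.symm monotone_ball_natCast
    (fun n => measurableSet_ball) iUnion_ball_natCast (fun ω n => measure_ball_lt_top)
    (fun n s hs => ha.aemeasurable_apply _ (Metric.isBounded_ball.subset Set.inter_subset_right)
      ((hCm s hs).inter measurableSet_ball))
    fun n => ha.aemeasurable_apply _ Metric.isBounded_ball measurableSet_ball

theorem IsStationaryL2.aemeasurable_prod (ha : IsStationaryL2 P a) (hb : IsStationaryL2 P b) :
    AEMeasurable (fun ω => (a ω).prod (b ω)) P := by
  have := ha.locallyFinite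
  have := hb.locallyFinite
  obtain ⟨C, hCc, hCpi, hCu, hCg, hCm⟩ := exists_countable_piSystem d
  have hCs : IsCountablySpanning C := ⟨fun _ => Set.univ, fun _ => hCu, Set.iUnion_const _⟩
  refine aemeasurable_measure_of_isPiSystem (C := Set.image2 (· ×ˢ ·) C C)
    (B := fun n : ℕ => Metric.ball (0 : Space d) n ×ˢ Metric.ball (0 : Space d) n)
    (hCc.image2 hCc _) (hCpi.prod hCpi) ?_
    (fun m n h => Set.prod_mono (monotone_ball_natCast h) (monotone_ball_natCast h))
    (fun n => measurableSet_ball.prod measurableSet_ball) ?_ (fun ω n => ?_) ?_ ?_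
  · exact (generateFrom_eq_prod hCg hCg hCs hCs).symm
  · ext z
    simp only [Set.mem_iUnion, Set.mem_prod, Metric.mem_ball, dist_zero_right, Set.mem_univ,
      iff_true]
    obtain ⟨n, hn⟩ := exists_nat_gt (max ‖z.1‖ ‖z.2‖)
    exact ⟨n, max_lt_iff.1 hn⟩
  · rw [Measure.prod_prod]
    exact ENNReal.mul_lt_top measure_ball_lt_top measure_ball_lt_top
  · rintro n _ ⟨s, hs, t, ht, rfl⟩
    simp_rw [Set.prod_inter_prod, Measure.prod_prod]
    exact (ha.aemeasurable_apply _ (Metric.isBounded_ball.subset Set.inter_subset_right)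
      ((hCm s hs).inter measurableSet_ball)).mul
      (hb.aemeasurable_apply _ (Metric.isBounded_ball.subset Set.inter_subset_right)
      ((hCm t ht).inter measurableSet_ball))
  · intro n
    simp_rw [Measure.prod_prod]
    exact (ha.aemeasurable_apply _ Metric.isBounded_ball measurableSet_ball).mul
      (hb.aemeasurable_apply _ Metric.isBounded_ball measurableSet_ball)

/-- The mixed second moment measure of two random measures. -/
noncomputable def mixedMoment (P : Measure Ω) (a b : Ω → Measure (Space d)) :
    Measure (Space d × Space d) :=
  P.bind fun ω => (a ω).prod (b ω)

/-- Local square-integrability enters through `xy ≤ x² + y²` on a product of balls. -/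
theorem IsStationaryL2.isLocallyFiniteMeasure_mixedMoment (ha : IsStationaryL2 P a)
    (hb : IsStationaryL2 P b) : IsLocallyFiniteMeasure (mixedMoment P a b) := by
  have := ha.locallyFinite
  have := hb.locallyFinite
  refine ⟨fun z => ⟨Metric.ball z.1 1 ×ˢ Metric.ball z.2 1,
    prod_mem_nhds (Metric.ball_mem_nhds _ one_pos) (Metric.ball_mem_nhds _ one_pos), ?_⟩⟩
  rw [mixedMoment, Measure.bind_apply (measurableSet_ball.prod measurableSet_ball)
    (ha.aemeasurable_prod hb)]
  simp_rw [Measure.prod_prod]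
  have h1 := ha.moment (Metric.ball z.1 1) Metric.isBounded_ball measurableSet_ball
  have h2 := hb.moment (Metric.ball z.2 1) Metric.isBounded_ball measurableSet_ball
  refine lt_of_le_of_lt (lintegral_mono (g := fun ω => a ω (Metric.ball z.1 1) ^ 2 +
    b ω (Metric.ball z.2 1) ^ 2) fun ω => ?_) ?_
  · dsimp only
    rcases le_total (a ω (Metric.ball z.1 1)) (b ω (Metric.ball z.2 1)) with h | h
    · exact (mul_le_mul_left h _).trans ((sq _).symm.le.trans le_add_self)
    · exact (mul_le_mul_right h _).trans ((sq _).symm.le.trans le_self_add)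
  · rw [lintegral_add_left' ((ha.aemeasurable_apply _ Metric.isBounded_ball
      measurableSet_ball).pow_const 2)]
    exact ENNReal.add_lt_top.2 ⟨h1, h2⟩

/-- Equivariance turns a diagonal shift of the argument into a shift of `ω`, which the invariance of
`P` absorbs. -/
theorem IsStationaryL2.lintegral_mixedMoment_shift [MeasurableConstVAdd (Space d) Ω]
    [VAddInvariantMeasure (Space d) Ω P] (ha : IsStationaryL2 P a)
    (hb : IsStationaryL2 P b) (v : Space d) {F : Space d × Space d → ℝ≥0∞} (hF : Measurable F) :
    ∫⁻ z, F (v + z.1, v + z.2) ∂(mixedMoment P a b) = ∫⁻ z, F z ∂(mixedMoment P a b) := by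
  have := ha.locallyFinite
  have := hb.locallyFinite
  have hm := ha.aemeasurable_prod hb
  have hshift : Measurable fun z : Space d × Space d => (v + z.1, v + z.2) := by fun_prop
  have hv : Measurable fun x : Space d => v + x := measurable_const_add v
  rw [mixedMoment, Measure.lintegral_bind (f := fun z : Space d × Space d => F (v + z.1, v + z.2)) hm
    (hF.comp hshift).aemeasurable,
    Measure.lintegral_bind hm hF.aemeasurable]
  have h1 : ∀ ω, ∫⁻ z, F (v + z.1, v + z.2) ∂(a ω).prod (b ω) =
      ∫⁻ z, F z ∂(a (v +ᵥ ω)).prod (b (v +ᵥ ω)) := by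
    intro ω
    rw [ha.equivariant, hb.equivariant, Measure.map_prod_map _ _ hv hv, lintegral_map hF (hv.prodMap hv)]
    rfl
  simp_rw [h1]
  have h2 : AEMeasurable (fun ω => ∫⁻ z, F z ∂(a ω).prod (b ω)) P :=
    (Measure.measurable_lintegral hF).comp_aemeasurable hm
  have hmp := measurePreserving_vadd v P
  rw [← lintegral_map' (f := fun ω => ∫⁻ z, F z ∂(a ω).prod (b ω)) (by rwa [hmp.map_eq])
    hmp.measurable.aemeasurable, hmp.map_eq]

end RandomMeasures

end Hyperuniformity

/-! ### Disintegration of diagonally invariant measures -/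

namespace Hyperuniformity

open scoped ENNReal ComplexConjugate

variable {d : ℕ}

theorem IsBoundedCompactBorel.memLp {f : Space d → ℂ} (hf : IsBoundedCompactBorel f)
    (q : ℝ≥0∞) (μ : Measure (Space d)) [IsLocallyFiniteMeasure μ] : MemLp f q μ := by
  obtain ⟨hm, ⟨C, hC⟩, K, hK, hf0⟩ := hf
  have h1 : f = K.indicator f := by
    ext x
    by_cases hx : x ∈ K
    · simp [hx]
    · simp [hx, hf0 x hx]
  rw [h1, memLp_indicator_iff_restrict hK.measurableSet]
  have : IsFiniteMeasure (μ.restrict K) := ⟨by simpa using hK.measure_lt_top⟩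
  exact MemLp.of_bound hm.aestronglyMeasurable C (ae_of_all _ hC)

theorem IsBoundedCompactBorel.integrable {f : Space d → ℂ} (hf : IsBoundedCompactBorel f)
    (μ : Measure (Space d)) [IsLocallyFiniteMeasure μ] : Integrable f μ :=
  memLp_one_iff_integrable.1 (hf.memLp 1 μ)

theorem IsBoundedCompactBorel.exists_vanishesOutside {f : Space d → ℂ}
    (hf : IsBoundedCompactBorel f) : ∃ R > 0, VanishesOutside f R := by
  obtain ⟨-, -, K, hK, hf0⟩ := hf
  obtain ⟨R, hR⟩ := hK.isBounded.subset_closedBall 0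
  refine ⟨max R 1, by positivity, fun x hx => hf0 x fun hxK => ?_⟩
  have := hR hxK
  rw [mem_closedBall_zero_iff] at this
  exact absurd (this.trans (le_max_left R 1)) (not_le.2 hx)

theorem VanishesOutside.isBoundedCompactBorel {f : Space d → ℂ} {R C : ℝ}
    (hR : VanishesOutside f R) (hm : Measurable f) (hC : ∀ x, ‖f x‖ ≤ C) :
    IsBoundedCompactBorel f := by
  refine ⟨hm, ⟨C, hC⟩, Metric.closedBall 0 R, isCompact_closedBall _ _, fun x hx => hR x ?_⟩
  rwa [mem_closedBall_zero_iff, not_le] at hx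

theorem isBoundedCompactBorel_of_continuous {f : Space d → ℂ} (hf : Continuous f)
    (hs : HasCompactSupport f) : IsBoundedCompactBorel f :=
  ⟨hf.measurable, hf.bounded_above_of_compact_support hs, tsupport f, hs,
    fun _ hx => image_eq_zero_of_notMem_tsupport hx⟩

theorem isBoundedCompactBorel_indicatorOne {A : Set (Space d)} (hA : Bornology.IsBounded A)
    (hAm : MeasurableSet A) : IsBoundedCompactBorel (indicatorOne A) := by
  refine ⟨measurable_const.indicator hAm, ⟨1, fun x => ?_⟩, closure A, hA.isCompact_closure,
    fun x hx => Set.indicator_of_notMem (fun h => hx (subset_closure h)) _⟩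
  by_cases hx : x ∈ A <;> simp [indicatorOne, hx]

theorem IsBoundedCompactBorel.autoconvolution {f : Space d → ℂ} (hf : IsBoundedCompactBorel f) :
    IsBoundedCompactBorel (autoconvolution f) := by
  obtain ⟨R, hR, hs⟩ := hf.exists_vanishesOutside
  have h2 := hf.memLp 2 volume
  exact hs.autoconvolution.isBoundedCompactBorel (continuous_autoconvolution h2 hR hs).measurable
    (norm_autoconvolution_le h2)

theorem integral_autoconvolution {f : Space d → ℂ} (hf : Integrable f) :
    ∫ x, autoconvolution f x = ((‖∫ x, f x‖ ^ 2 : ℝ) : ℂ) := by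
  have h := fourier_autoconvolution hf 0
  simpa [Real.fourier_eq] using h

/-- The normalized indicator function of the unit ball, with values in `[0, ∞]`. -/
noncomputable def unitBallDensity (d : ℕ) : Space d → ℝ≥0∞ :=
  (Metric.ball 0 1).indicator fun _ => (volume (Metric.ball (0 : Space d) 1))⁻¹

theorem volume_unitBall_ne_zero : volume (Metric.ball (0 : Space d) 1) ≠ 0 :=
  (Metric.measure_ball_pos _ _ one_pos).ne'

theorem measurable_unitBallDensity : Measurable (unitBallDensity d) :=
  measurable_const.indicator measurableSet_ball

theorem lintegral_unitBallDensity : ∫⁻ x, unitBallDensity d x = 1 := by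
  rw [unitBallDensity, lintegral_indicator measurableSet_ball, setLIntegral_const,
    ENNReal.inv_mul_cancel volume_unitBall_ne_zero measure_ball_lt_top.ne]

theorem unitBallDensity_lt_top (x : Space d) : unitBallDensity d x < ∞ := by
  by_cases hx : x ∈ Metric.ball (0 : Space d) 1
  · rw [unitBallDensity, Set.indicator_of_mem hx]
    exact ENNReal.inv_lt_top.2 (pos_iff_ne_zero.2 volume_unitBall_ne_zero)
  · simp [unitBallDensity, Set.indicator_of_notMem hx]

theorem ballDensity_eq (x : Space d) : ballDensity d x = ((unitBallDensity d x).toReal : ℂ) := by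
  by_cases hx : x ∈ Metric.ball (0 : Space d) 1
  · rw [unitBallDensity, ballDensity, Set.indicator_of_mem hx, Set.indicator_of_mem hx,
      ENNReal.toReal_inv]
    rfl
  · simp [unitBallDensity, ballDensity, Set.indicator_of_notMem hx]

/-- The image under `(x, y) ↦ x - y` of a measure on pairs, with `y` averaged over the unit
ball. -/
noncomputable def reducedMeasure (M : Measure (Space d × Space d)) : Measure (Space d) :=
  (M.withDensity fun z => unitBallDensity d z.2).map fun z => z.1 - z.2

variable {M : Measure (Space d × Space d)}

theorem lintegral_reducedMeasure {F : Space d → ℝ≥0∞} (hF : Measurable F) :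
    ∫⁻ u, F u ∂reducedMeasure M = ∫⁻ z, unitBallDensity d z.2 * F (z.1 - z.2) ∂M := by
  have hρ := measurable_unitBallDensity (d := d)
  rw [reducedMeasure, lintegral_map hF (by fun_prop), lintegral_withDensity_eq_lintegral_mul _
    (by fun_prop) (by fun_prop)]
  rfl

theorem integral_reducedMeasure {f : Space d → ℂ} (hf : Measurable f) :
    ∫ u, f u ∂reducedMeasure M = ∫ z, f (z.1 - z.2) * ballDensity d z.2 ∂M := by
  have hρ : Measurable fun z : Space d × Space d => unitBallDensity d z.2 :=
    measurable_unitBallDensity.comp measurable_snd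
  have hsub : Measurable fun z : Space d × Space d => z.1 - z.2 := by fun_prop
  have h1 := integral_withDensity_eq_integral_toReal_smul hρ (μ := M)
    (ae_of_all _ fun z => unitBallDensity_lt_top z.2) fun z : Space d × Space d => f (z.1 - z.2)
  rw [reducedMeasure, integral_map hsub.aemeasurable hf.aestronglyMeasurable, h1]
  refine integral_congr_ae (ae_of_all _ fun z => ?_)
  dsimp only
  rw [ballDensity_eq, Complex.real_smul, mul_comm]

theorem measure_prod_closedBall_lt_top [IsLocallyFiniteMeasure M] (R S : ℝ) :
    M (Metric.closedBall 0 R ×ˢ Metric.closedBall 0 S) < ∞ :=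
  ((isCompact_closedBall 0 R).prod (isCompact_closedBall 0 S)).measure_lt_top

instance isLocallyFiniteMeasure_reducedMeasure [IsLocallyFiniteMeasure M] :
    IsLocallyFiniteMeasure (reducedMeasure M) := by
  refine ⟨fun x => ⟨Metric.ball x 1, Metric.ball_mem_nhds _ one_pos, ?_⟩⟩
  rw [← lintegral_indicator_one measurableSet_ball, lintegral_reducedMeasure
    (measurable_one.indicator measurableSet_ball)]
  set K := Metric.closedBall (0 : Space d) (‖x‖ + 2) ×ˢ Metric.closedBall (0 : Space d) 1
  have hK : MeasurableSet K := measurableSet_closedBall.prod measurableSet_closedBall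
  refine lt_of_le_of_lt (lintegral_mono (g := K.indicator fun _ =>
    (volume (Metric.ball (0 : Space d) 1))⁻¹) fun z => ?_) ?_
  · by_cases h1 : z.1 - z.2 ∈ Metric.ball x 1
    · by_cases h2 : z.2 ∈ Metric.ball (0 : Space d) 1
      · have hz : z ∈ K := by
          rw [mem_ball_iff_norm] at h1
          rw [mem_ball_zero_iff] at h2
          refine ⟨?_, by simpa using h2.le⟩
          rw [mem_closedBall_zero_iff]
          calc ‖z.1‖ = ‖(z.1 - z.2 - x) + x + z.2‖ := by congr 1; abel
            _ ≤ ‖z.1 - z.2 - x‖ + ‖x‖ + ‖z.2‖ := norm_add₃_le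
            _ ≤ ‖x‖ + 2 := by linarith
        simp [unitBallDensity, Set.indicator_of_mem h1, Set.indicator_of_mem h2,
          Set.indicator_of_mem hz]
      · simp [unitBallDensity, Set.indicator_of_notMem h2]
    · simp [Set.indicator_of_notMem h1]
  · rw [lintegral_indicator hK, setLIntegral_const]
    exact ENNReal.mul_lt_top (ENNReal.inv_lt_top.2 (pos_iff_ne_zero.2 volume_unitBall_ne_zero))
      (measure_prod_closedBall_lt_top _ _)

/-- Invariance of a measure on pairs under diagonal translations. -/
def IsDiagonallyInvariant (M : Measure (Space d × Space d)) : Prop :=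
  ∀ (v : Space d) (F : Space d × Space d → ℝ≥0∞), Measurable F →
    ∫⁻ z, F (v + z.1, v + z.2) ∂M = ∫⁻ z, F z ∂M

/-- In the coordinates `(x - y, y)` an invariant measure is a product with Lebesgue measure. To see
it, insert `1 = ∫ ρ(y - w) dw`, exchange the integrals, translate diagonally by `w`, and substitute
in `w`. -/
theorem IsDiagonallyInvariant.eq_map [SFinite M] (hM : IsDiagonallyInvariant M) :
    M = ((reducedMeasure M).prod volume).map fun z => (z.1 + z.2, z.2) := by
  have : SFinite (reducedMeasure M) := by unfold reducedMeasure; infer_instance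
  refine Measure.ext_of_lintegral _ fun F hF => ?_
  have hρ := measurable_unitBallDensity (d := d)
  rw [lintegral_map hF (by fun_prop), lintegral_prod _ (by fun_prop), lintegral_reducedMeasure
    (Measurable.lintegral_prod_right' (f := fun z : Space d × Space d => F (z.1 + z.2, z.2))
      (by fun_prop))]
  calc ∫⁻ z, F z ∂M = ∫⁻ z, ∫⁻ w, unitBallDensity d (z.2 - w) * F z ∂volume ∂M := by
        refine lintegral_congr fun z => ?_
        rw [lintegral_mul_const _ (by fun_prop), lintegral_sub_left_eq_self (unitBallDensity d) z.2,
          lintegral_unitBallDensity, one_mul]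
    _ = ∫⁻ w, ∫⁻ z, unitBallDensity d (z.2 - w) * F z ∂M ∂volume :=
        lintegral_lintegral_swap (by fun_prop)
    _ = ∫⁻ w, ∫⁻ z, unitBallDensity d z.2 * F (w + z.1, w + z.2) ∂M ∂volume := by
        refine lintegral_congr fun w => ?_
        rw [← hM w _ (by fun_prop)]
        simp
    _ = ∫⁻ z, ∫⁻ w, unitBallDensity d z.2 * F (w + z.1, w + z.2) ∂volume ∂M :=
        lintegral_lintegral_swap (by fun_prop)
    _ = _ := by
        refine lintegral_congr fun z => ?_
        rw [lintegral_const_mul _ (by fun_prop)]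
        congr 1
        rw [← lintegral_sub_right_eq_self _ z.2]
        refine lintegral_congr fun w => ?_
        rw [sub_add_cancel, sub_add_comm, add_comm (z.1 - z.2)]

theorem integrable_mul_conj [IsLocallyFiniteMeasure M] {f g : Space d → ℂ}
    (hf : IsBoundedCompactBorel f) (hg : IsBoundedCompactBorel g) :
    Integrable (fun z : Space d × Space d => f z.1 * conj (g z.2)) M := by
  obtain ⟨hfm, ⟨C, hC⟩, K, hK, hf0⟩ := hf
  obtain ⟨hgm, ⟨D, hD⟩, L, hL, hg0⟩ := hg
  have hm : Measurable fun z : Space d × Space d => f z.1 * conj (g z.2) :=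
    (hfm.comp measurable_fst).mul (Complex.continuous_conj.measurable.comp
      (hgm.comp measurable_snd))
  have h1 : (fun z : Space d × Space d => f z.1 * conj (g z.2)) =
      (K ×ˢ L).indicator fun z => f z.1 * conj (g z.2) := by
    ext z
    by_cases hz : z ∈ K ×ˢ L
    · simp [hz]
    · rw [Set.indicator_of_notMem hz]
      by_cases hz1 : z.1 ∈ K
      · rw [hg0 z.2 fun h => hz ⟨hz1, h⟩]
        simp
      · rw [hf0 z.1 hz1, zero_mul]
  rw [h1, integrable_indicator_iff (hK.measurableSet.prod hL.measurableSet)]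
  refine Measure.integrableOn_of_bounded (hK.prod hL).measure_lt_top.ne hm.aestronglyMeasurable
    (M := C * D) (ae_of_all _ fun z => ?_)
  rw [norm_mul, RCLike.norm_conj]
  exact mul_le_mul (hC _) (hD _) (norm_nonneg _) ((norm_nonneg _).trans (hC z.1))

/-- In product coordinates the integrand is `f(u + y) conj(f(y))`, whose integral over `y` is the
autoconvolution at `u`. -/
theorem IsDiagonallyInvariant.integral_mul_conj [SFinite M] [IsLocallyFiniteMeasure M]
    (hM : IsDiagonallyInvariant M) {f : Space d → ℂ} (hf : IsBoundedCompactBorel f) :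
    ∫ z, f z.1 * conj (f z.2) ∂M = ∫ u, autoconvolution f u ∂reducedMeasure M := by
  have hi := integrable_mul_conj (M := M) hf hf
  have : SFinite (reducedMeasure M) := by unfold reducedMeasure; infer_instance
  have hT : Measurable fun z : Space d × Space d => (z.1 + z.2, z.2) := by fun_prop
  have hfm : Measurable fun z : Space d × Space d => f z.1 * conj (f z.2) :=
    (hf.1.comp measurable_fst).mul (Complex.continuous_conj.measurable.comp
      (hf.1.comp measurable_snd))
  rw [hM.eq_map] at hi
  conv_lhs => rw [hM.eq_map]
  have hi' := (integrable_map_measure hfm.aestronglyMeasurable hT.aemeasurable).1 hi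
  rw [integral_map hT.aemeasurable hfm.aestronglyMeasurable, autoconvolution_eq]
  exact integral_prod _ hi'

end Hyperuniformity

/-! ### Mean measures, and the positive and negative parts of a random measure -/

namespace Hyperuniformity

open scoped ENNReal ComplexConjugate

variable {d : ℕ} {Ω : Type*} [MeasurableSpace Ω] [AddAction (Space d) Ω] {P : Measure Ω}

section Stationary

variable {a b : Ω → Measure (Space d)}

theorem IsStationaryL2.isDiagonallyInvariant_mixedMoment [MeasurableConstVAdd (Space d) Ω]
    [VAddInvariantMeasure (Space d) Ω P] (ha : IsStationaryL2 P a) (hb : IsStationaryL2 P b) :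
    IsDiagonallyInvariant (mixedMoment P a b) :=
  fun v _ hF => ha.lintegral_mixedMoment_shift hb v hF

theorem IsStationaryL2.isLocallyFiniteMeasure_bind [IsProbabilityMeasure P]
    (ha : IsStationaryL2 P a) : IsLocallyFiniteMeasure (P.bind a) := by
  refine ⟨fun x => ⟨Metric.ball x 1, Metric.ball_mem_nhds _ one_pos, ?_⟩⟩
  rw [Measure.bind_apply measurableSet_ball ha.aemeasurable]
  have h := ha.moment (Metric.ball x 1) Metric.isBounded_ball measurableSet_ball
  refine lt_of_le_of_lt (lintegral_mono (g := fun ω => 1 + a ω (Metric.ball x 1) ^ 2)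
    fun ω => ?_) ?_
  · rcases le_total (a ω (Metric.ball x 1)) 1 with h1 | h1
    · exact h1.trans le_self_add
    · exact (le_self_pow h1 two_ne_zero).trans le_add_self
  · rw [lintegral_add_left' aemeasurable_const]
    simpa using h

/-- The mean measure is locally finite and translation invariant, so uniqueness of Haar measure
applies. -/
theorem IsStationaryL2.exists_bind_eq_smul [MeasurableConstVAdd (Space d) Ω]
    [VAddInvariantMeasure (Space d) Ω P] [IsProbabilityMeasure P] (ha : IsStationaryL2 P a) :
    ∃ c : NNReal, P.bind a = c • volume := by
  have := ha.isLocallyFiniteMeasure_bind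
  have : (P.bind a).IsAddLeftInvariant := by
    refine ⟨fun v => ?_⟩
    have hv : Measurable fun x : Space d => v + x := measurable_const_add v
    refine Measure.ext_of_lintegral _ fun F hF => ?_
    rw [lintegral_map hF hv, Measure.lintegral_bind (f := fun x => F (v + x)) ha.aemeasurable
      (hF.comp hv).aemeasurable,
      Measure.lintegral_bind ha.aemeasurable hF.aemeasurable]
    have h1 : ∀ ω, ∫⁻ x, F (v + x) ∂a ω = ∫⁻ x, F x ∂a (v +ᵥ ω) := by
      intro ω
      rw [ha.equivariant, lintegral_map hF hv]
    simp_rw [h1]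
    have h2 : AEMeasurable (fun ω => ∫⁻ x, F x ∂a ω) P :=
      (Measure.measurable_lintegral hF).comp_aemeasurable ha.aemeasurable
    have hmp := measurePreserving_vadd v P
    rw [← lintegral_map' (f := fun ω => ∫⁻ x, F x ∂a ω) (by rwa [hmp.map_eq])
      hmp.measurable.aemeasurable, hmp.map_eq]
  exact ⟨_, Measure.isAddLeftInvariant_eq_smul (P.bind a) volume⟩

end Stationary

namespace InvariantRandomMeasure

variable (p : InvariantRandomMeasure d Ω)

/-- The random measure of positive parts. -/
def posPart (ω : Ω) : Measure (Space d) := (p.toFun ω).pos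

/-- The random measure of negative parts. -/
def negPart (ω : Ω) : Measure (Space d) := (p.toFun ω).neg

instance (ω : Ω) : IsLocallyFiniteMeasure (p.posPart ω) := (p.toFun ω).locallyFinite_pos

instance (ω : Ω) : IsLocallyFiniteMeasure (p.negPart ω) := (p.toFun ω).locallyFinite_neg

theorem integral_eq (ω : Ω) (f : Space d → ℂ) :
    (p.toFun ω).integral f = ∫ x, f x ∂p.posPart ω - ∫ x, f x ∂p.negPart ω := rfl

theorem measurable_integral {f : Space d → ℂ} (hf : IsBoundedCompactBorel f) :
    Measurable fun ω => (p.toFun ω).integral f := by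
  have h1 : Measurable fun μ : SignedRadonMeasure d => μ.integral f := by
    rw [BorelSpace.measurable_eq (α := ℂ)]
    exact Measurable.of_comap_le (le_iSup (fun g : {g : Space d → ℂ // IsBoundedCompactBorel g} =>
      MeasurableSpace.comap (fun μ : SignedRadonMeasure d => μ.integral g.1) (borel ℂ)) ⟨f, hf⟩)
  exact h1.comp p.measurable_toFun

variable {B : Set (Space d)}

theorem integral_indicatorOne (hBm : MeasurableSet B) (ω : Ω) :
    (p.toFun ω).integral (indicatorOne B) = ((p.toFun ω).value B : ℂ) := by
  simp only [SignedRadonMeasure.integral, indicatorOne, SignedRadonMeasure.value,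
    integral_indicator_const _ hBm]
  simp

theorem measurable_value (hB : Bornology.IsBounded B) (hBm : MeasurableSet B) :
    Measurable fun ω => (p.toFun ω).value B := by
  have h := p.measurable_integral (isBoundedCompactBorel_indicatorOne hB hBm)
  simp_rw [p.integral_indicatorOne hBm] at h
  exact Complex.measurable_re.comp h

theorem totalVariation_apply (ω : Ω) :
    (p.toFun ω).totalVariation B = p.posPart ω B + p.negPart ω B := by
  simp [SignedRadonMeasure.totalVariation, posPart, negPart]

theorem totalVariation_real (hB : Bornology.IsBounded B) (ω : Ω) :
    (p.toFun ω).totalVariation.real B = (p.posPart ω).real B + (p.negPart ω).real B := by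
  rw [Measure.real, p.totalVariation_apply,
    ENNReal.toReal_add hB.measure_lt_top.ne hB.measure_lt_top.ne]
  rfl

/-- The σ-algebra only makes the signed values `p_ω(B)` measurable. Almost everywhere measurability
of `|p_ω|(B)` comes with the square-integrability hypothesis, and this half-sum transfers it to the
positive part. -/
theorem posPart_apply (hB : Bornology.IsBounded B) (ω : Ω) : p.posPart ω B =
    ENNReal.ofReal (((p.toFun ω).totalVariation.real B + (p.toFun ω).value B) / 2) := by
  rw [p.totalVariation_real hB, SignedRadonMeasure.value, ← posPart, ← negPart]
  ring_nf
  rw [ofReal_measureReal hB.measure_lt_top.ne]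

theorem negPart_apply (hB : Bornology.IsBounded B) (ω : Ω) : p.negPart ω B =
    ENNReal.ofReal (((p.toFun ω).totalVariation.real B - (p.toFun ω).value B) / 2) := by
  rw [p.totalVariation_real hB, SignedRadonMeasure.value, ← posPart, ← negPart]
  ring_nf
  rw [ofReal_measureReal hB.measure_lt_top.ne]

variable {p}

theorem _root_.Hyperuniformity.LocallySquareIntegrable.lintegral_sq_lt_top
    (hp : LocallySquareIntegrable p P) (hB : Bornology.IsBounded B) (hBm : MeasurableSet B) :
    ∫⁻ ω, (p.posPart ω B + p.negPart ω B) ^ 2 ∂P < ∞ := by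
  have h := lintegral_rpow_enorm_lt_top_of_eLpNorm_lt_top two_ne_zero ENNReal.ofNat_ne_top
    (hp B hB hBm).eLpNorm_lt_top
  refine lt_of_le_of_lt (le_of_eq (lintegral_congr fun ω => ?_)) h
  have hfin : (p.toFun ω).totalVariation B ≠ ∞ := by
    rw [p.totalVariation_apply]
    exact (ENNReal.add_lt_top.2 ⟨hB.measure_lt_top, hB.measure_lt_top⟩).ne
  rw [← p.totalVariation_apply, Real.enorm_eq_ofReal measureReal_nonneg, ofReal_measureReal hfin]
  simp

theorem isStationaryL2_posPart (hp : LocallySquareIntegrable p P) : IsStationaryL2 P p.posPart where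
  locallyFinite _ := inferInstance
  aemeasurable_apply B hB hBm := by
    simp_rw [p.posPart_apply hB]
    exact (((hp B hB hBm).1.aemeasurable.add
      (p.measurable_value hB hBm).aemeasurable).div_const 2).ennreal_ofReal
  equivariant g ω := by simp only [posPart, p.equivariant]; rfl
  moment B hB hBm := lt_of_le_of_lt (lintegral_mono fun ω => pow_le_pow_left₀ zero_le
    le_self_add 2) (hp.lintegral_sq_lt_top hB hBm)

theorem isStationaryL2_negPart (hp : LocallySquareIntegrable p P) : IsStationaryL2 P p.negPart where
  locallyFinite _ := inferInstance
  aemeasurable_apply B hB hBm := by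
    simp_rw [p.negPart_apply hB]
    exact (((hp B hB hBm).1.aemeasurable.sub
      (p.measurable_value hB hBm).aemeasurable).div_const 2).ennreal_ofReal
  equivariant g ω := by simp only [negPart, p.equivariant]; rfl
  moment B hB hBm := lt_of_le_of_lt (lintegral_mono fun ω => pow_le_pow_left₀ zero_le
    le_add_self 2) (hp.lintegral_sq_lt_top hB hBm)

end InvariantRandomMeasure

end Hyperuniformity

/-! ### The centered autocorrelation as a pairing, and the variance formula -/

namespace Hyperuniformity

open scoped ENNReal ComplexConjugate

variable {d : ℕ} {Ω : Type*} [MeasurableSpace Ω] [AddAction (Space d) Ω] {P : Measure Ω}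

/-- Functions of two variables integrable against every locally finite measure. -/
def IsLocallyIntegrableTest (F : Space d × Space d → ℂ) : Prop :=
  ∀ M : Measure (Space d × Space d), IsLocallyFiniteMeasure M → Integrable F M

theorem isLocallyIntegrableTest_mul_conj {f g : Space d → ℂ} (hf : IsBoundedCompactBorel f)
    (hg : IsBoundedCompactBorel g) :
    IsLocallyIntegrableTest fun z : Space d × Space d => f z.1 * conj (g z.2) :=
  fun _ _ => integrable_mul_conj hf hg

theorem isBoundedCompactBorel_ballDensity : IsBoundedCompactBorel (ballDensity d) := by
  have h : ballDensity d = fun x => indicatorOne (Metric.ball 0 1) x *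
      (((volume.real (Metric.ball (0 : Space d) 1))⁻¹ : ℝ) : ℂ) := by
    ext x
    by_cases hx : x ∈ Metric.ball (0 : Space d) 1
    · simp [ballDensity, indicatorOne, Set.indicator_of_mem hx]
    · simp [ballDensity, indicatorOne, Set.indicator_of_notMem hx]
  obtain ⟨hm, ⟨C, hC⟩, K, hK, h0⟩ :=
    isBoundedCompactBorel_indicatorOne (Metric.isBounded_ball (x := (0 : Space d)) (r := 1))
      measurableSet_ball
  rw [h]
  refine ⟨hm.mul_const _, ⟨C * ‖(((volume.real (Metric.ball (0 : Space d) 1))⁻¹ : ℝ) : ℂ)‖,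
    fun x => ?_⟩, K, hK, fun x hx => by simp [h0 x hx]⟩
  rw [norm_mul]
  gcongr
  exact hC x

/-- If `x - y` and `y` are confined to balls of radii `R` and `S`, then `x` lies in the ball of
radius `R + S`, so the function is a bounded multiple of an integrable product. -/
theorem isLocallyIntegrableTest_sub_mul {f : Space d → ℂ} (hf : IsBoundedCompactBorel f) :
    IsLocallyIntegrableTest fun z : Space d × Space d => f (z.1 - z.2) * ballDensity d z.2 := by
  intro M hM
  have hρ := isBoundedCompactBorel_ballDensity (d := d)
  obtain ⟨R, hR, hfR⟩ := hf.exists_vanishesOutside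
  obtain ⟨S, hS, hρS⟩ := hρ.exists_vanishesOutside
  obtain ⟨hfm, ⟨C, hC⟩, -⟩ := hf
  have hχ := isBoundedCompactBorel_indicatorOne (Metric.isBounded_closedBall
    (x := (0 : Space d)) (r := R + S)) measurableSet_closedBall
  have h1 := integrable_mul_conj (M := M) hχ hρ
  have h2 : (fun z : Space d × Space d => f (z.1 - z.2) * ballDensity d z.2) = fun z =>
      f (z.1 - z.2) * (indicatorOne (Metric.closedBall 0 (R + S)) z.1 *
        conj (ballDensity d z.2)) := by
    ext z
    have hc : conj (ballDensity d z.2) = ballDensity d z.2 := by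
      rw [ballDensity_eq, Complex.conj_ofReal]
    rw [hc]
    by_cases hz : z.1 ∈ Metric.closedBall (0 : Space d) (R + S)
    · rw [indicatorOne, Set.indicator_of_mem hz, one_mul]
    · rw [indicatorOne, Set.indicator_of_notMem hz, zero_mul]
      by_cases hz2 : S < ‖z.2‖
      · rw [hρS _ hz2]
      · rw [hfR, zero_mul, mul_zero]
        rw [mem_closedBall_zero_iff, not_le] at hz
        have := norm_sub_norm_le z.1 z.2
        linarith
  rw [h2]
  exact h1.bdd_mul (hfm.comp (by fun_prop)).aestronglyMeasurable (ae_of_all _ fun z => hC _)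

instance isLocallyFiniteMeasure_add (μ ν : Measure (Space d)) [IsLocallyFiniteMeasure μ]
    [IsLocallyFiniteMeasure ν] : IsLocallyFiniteMeasure (μ + ν) := by
  refine ⟨fun x => ⟨Metric.ball x 1, Metric.ball_mem_nhds _ one_pos, ?_⟩⟩
  rw [Measure.add_apply]
  exact ENNReal.add_lt_top.2 ⟨measure_ball_lt_top, measure_ball_lt_top⟩

namespace InvariantRandomMeasure

variable {p : InvariantRandomMeasure d Ω}

theorem integralProd_eq (p : InvariantRandomMeasure d Ω) {F : Space d × Space d → ℂ}
    (hF : IsLocallyIntegrableTest F) (ω : Ω) :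
    (p.toFun ω).integralProd (fun x y => F (x, y)) =
      (∫ z, F z ∂(p.posPart ω).prod (p.posPart ω) - ∫ z, F z ∂(p.posPart ω).prod (p.negPart ω)) -
      (∫ z, F z ∂(p.negPart ω).prod (p.posPart ω) -
        ∫ z, F z ∂(p.negPart ω).prod (p.negPart ω)) := by
  have hpp := hF ((p.posPart ω).prod (p.posPart ω)) inferInstance
  have hpn := hF ((p.posPart ω).prod (p.negPart ω)) inferInstance
  have hnp := hF ((p.negPart ω).prod (p.posPart ω)) inferInstance
  have hnn := hF ((p.negPart ω).prod (p.negPart ω)) inferInstance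
  rw [integral_prod _ hpp, integral_prod _ hpn, integral_prod _ hnp, integral_prod _ hnn,
    ← integral_sub hpp.integral_prod_left hpn.integral_prod_left,
    ← integral_sub hnp.integral_prod_left hnn.integral_prod_left]
  rfl

theorem integralProd_mul_conj (p : InvariantRandomMeasure d Ω) (f : Space d → ℂ) (ω : Ω) :
    (p.toFun ω).integralProd (fun x y => f x * conj (f y)) =
      ((‖(p.toFun ω).integral f‖ ^ 2 : ℝ) : ℂ) := by
  have h1 : ∀ x, (p.toFun ω).integral (fun y => f x * conj (f y)) =
      f x * conj ((p.toFun ω).integral f) := by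
    intro x
    rw [integral_eq, integral_eq, integral_const_mul, integral_const_mul, integral_conj,
      integral_conj, ← mul_sub, map_sub]
  rw [SignedRadonMeasure.integralProd]
  simp_rw [h1]
  rw [integral_eq, integral_mul_const, integral_mul_const, ← sub_mul, ← integral_eq,
    Complex.mul_conj, Complex.normSq_eq_norm_sq]

/-- Splitting both factors into positive and negative parts expresses the signed second moment
through four positive, locally finite measures, to each of which the disintegration applies. -/
theorem secondMoment_eq (hp : LocallySquareIntegrable p P) {F : Space d × Space d → ℂ}
    (hF : IsLocallyIntegrableTest F) :
    Integrable (fun ω => (p.toFun ω).integralProd fun x y => F (x, y)) P ∧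
    secondMoment p P (fun x y => F (x, y)) =
      (∫ z, F z ∂mixedMoment P p.posPart p.posPart - ∫ z, F z ∂mixedMoment P p.posPart p.negPart) -
      (∫ z, F z ∂mixedMoment P p.negPart p.posPart -
        ∫ z, F z ∂mixedMoment P p.negPart p.negPart) := by
  have h₁ := isStationaryL2_posPart hp
  have h₂ := isStationaryL2_negPart hp
  obtain ⟨ipp, epp⟩ := integral_bind (h₁.aemeasurable_prod h₁)
    (hF _ (h₁.isLocallyFiniteMeasure_mixedMoment h₁))
  obtain ⟨ipn, epn⟩ := integral_bind (h₁.aemeasurable_prod h₂)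
    (hF _ (h₁.isLocallyFiniteMeasure_mixedMoment h₂))
  obtain ⟨inp, enp⟩ := integral_bind (h₂.aemeasurable_prod h₁)
    (hF _ (h₂.isLocallyFiniteMeasure_mixedMoment h₁))
  obtain ⟨inn, enn⟩ := integral_bind (h₂.aemeasurable_prod h₂)
    (hF _ (h₂.isLocallyFiniteMeasure_mixedMoment h₂))
  simp_rw [secondMoment, p.integralProd_eq hF, mixedMoment, epp, epn, enp, enn]
  refine ⟨(ipp.sub ipn).sub (inp.sub inn), ?_⟩
  rw [← integral_sub ipp ipn, ← integral_sub inp inn]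
  exact integral_sub (ipp.sub ipn) (inp.sub inn)

theorem memLp_integral (hp : LocallySquareIntegrable p P) {f : Space d → ℂ}
    (hf : IsBoundedCompactBorel f) : MemLp (fun ω => (p.toFun ω).integral f) 2 P := by
  rw [memLp_two_iff_integrable_sq_norm (p.measurable_integral hf).aestronglyMeasurable]
  have h := (secondMoment_eq hp (isLocallyIntegrableTest_mul_conj hf hf)).1
  simp only [integralProd_mul_conj] at h
  exact h.re

/-- The positive part of the centered autocorrelation. -/
noncomputable def autocorrelationPos (p : InvariantRandomMeasure d Ω) (P : Measure Ω) :
    Measure (Space d) :=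
  reducedMeasure (mixedMoment P p.posPart p.posPart) +
    reducedMeasure (mixedMoment P p.negPart p.negPart)

/-- The negative part of the centered autocorrelation. -/
noncomputable def autocorrelationNeg (p : InvariantRandomMeasure d Ω) (P : Measure Ω) :
    Measure (Space d) :=
  reducedMeasure (mixedMoment P p.posPart p.negPart) +
    reducedMeasure (mixedMoment P p.negPart p.posPart) +
    (Real.toNNReal (intensity p P ^ 2)) • volume

theorem isLocallyFiniteMeasure_autocorrelationPos (hp : LocallySquareIntegrable p P) :
    IsLocallyFiniteMeasure (autocorrelationPos p P) := by
  have h₁ := isStationaryL2_posPart hp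
  have h₂ := isStationaryL2_negPart hp
  have := h₁.isLocallyFiniteMeasure_mixedMoment h₁
  have := h₂.isLocallyFiniteMeasure_mixedMoment h₂
  unfold autocorrelationPos
  infer_instance

theorem isLocallyFiniteMeasure_autocorrelationNeg (hp : LocallySquareIntegrable p P) :
    IsLocallyFiniteMeasure (autocorrelationNeg p P) := by
  have h₁ := isStationaryL2_posPart hp
  have h₂ := isStationaryL2_negPart hp
  have := h₁.isLocallyFiniteMeasure_mixedMoment h₂
  have := h₂.isLocallyFiniteMeasure_mixedMoment h₁
  unfold autocorrelationNeg
  infer_instance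

theorem pairing_eq (hp : LocallySquareIntegrable p P) {f : Space d → ℂ}
    (hf : IsBoundedCompactBorel f) :
    pairing (autocorrelationPos p P) (autocorrelationNeg p P) f =
      (∫ x, f x ∂reducedMeasure (mixedMoment P p.posPart p.posPart) -
        ∫ x, f x ∂reducedMeasure (mixedMoment P p.posPart p.negPart)) -
      (∫ x, f x ∂reducedMeasure (mixedMoment P p.negPart p.posPart) -
        ∫ x, f x ∂reducedMeasure (mixedMoment P p.negPart p.negPart)) -
      (intensity p P : ℂ) ^ 2 * ∫ x, f x := by
  have h₁ := isStationaryL2_posPart hp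
  have h₂ := isStationaryL2_negPart hp
  have := h₁.isLocallyFiniteMeasure_mixedMoment h₁
  have := h₁.isLocallyFiniteMeasure_mixedMoment h₂
  have := h₂.isLocallyFiniteMeasure_mixedMoment h₁
  have := h₂.isLocallyFiniteMeasure_mixedMoment h₂
  rw [pairing, autocorrelationPos, autocorrelationNeg,
    integral_add_measure (hf.integrable _) (hf.integrable _),
    integral_add_measure (hf.integrable _) (hf.integrable _),
    integral_add_measure (hf.integrable _) (hf.integrable _), integral_smul_nnreal_measure]
  simp only [NNReal.smul_def, Real.coe_toNNReal _ (sq_nonneg (intensity p P)), Complex.real_smul]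
  push_cast
  ring

theorem centeredAutocorrelation_eq_pairing (hp : LocallySquareIntegrable p P) {f : Space d → ℂ}
    (hf : IsBoundedCompactBorel f) : centeredAutocorrelation p P f =
      pairing (autocorrelationPos p P) (autocorrelationNeg p P) f := by
  rw [pairing_eq hp hf, centeredAutocorrelation, autocorrelation,
    (secondMoment_eq hp (isLocallyIntegrableTest_sub_mul hf)).2]
  simp only [integral_reducedMeasure hf.1]

variable [MeasurableConstVAdd (Space d) Ω] [VAddInvariantMeasure (Space d) Ω P]
  [IsProbabilityMeasure P]

/-- Both parts have mean measures proportional to Lebesgue measure; testing on the unit ball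
identifies the difference of the two constants with the intensity. -/
theorem integral_eq_intensity_mul (hp : LocallySquareIntegrable p P) {f : Space d → ℂ}
    (hf : IsBoundedCompactBorel f) :
    ∫ ω, (p.toFun ω).integral f ∂P = (intensity p P : ℂ) * ∫ x, f x := by
  have h₁ := isStationaryL2_posPart hp
  have h₂ := isStationaryL2_negPart hp
  obtain ⟨c₁, hc₁⟩ := h₁.exists_bind_eq_smul
  obtain ⟨c₂, hc₂⟩ := h₂.exists_bind_eq_smul
  have := h₁.isLocallyFiniteMeasure_bind
  have := h₂.isLocallyFiniteMeasure_bind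
  have key : ∀ {g : Space d → ℂ}, IsBoundedCompactBorel g →
      ∫ ω, (p.toFun ω).integral g ∂P = ((c₁ - c₂ : ℝ) : ℂ) * ∫ x, g x := by
    intro g hg
    obtain ⟨i₁, e₁⟩ := integral_bind h₁.aemeasurable (hg.integrable (P.bind p.posPart))
    obtain ⟨i₂, e₂⟩ := integral_bind h₂.aemeasurable (hg.integrable (P.bind p.negPart))
    simp_rw [integral_eq]
    rw [integral_sub i₁ i₂, ← e₁, ← e₂, hc₁, hc₂, integral_smul_nnreal_measure,
      integral_smul_nnreal_measure]
    simp [NNReal.smul_def, sub_mul]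
  rw [key hf]
  congr 2
  have hb := key (isBoundedCompactBorel_indicatorOne (Metric.isBounded_ball
    (x := (0 : Space d)) (r := 1)) measurableSet_ball)
  simp_rw [p.integral_indicatorOne measurableSet_ball] at hb
  rw [integral_complex_ofReal, indicatorOne, integral_indicator_const _ measurableSet_ball] at hb
  have hb' : ∫ ω, (p.toFun ω).value (Metric.ball 0 1) ∂P =
      (c₁ - c₂ : ℝ) * volume.real (Metric.ball (0 : Space d) 1) := by
    have : ((∫ ω, (p.toFun ω).value (Metric.ball 0 1) ∂P : ℝ) : ℂ) =
      (((c₁ - c₂ : ℝ) * volume.real (Metric.ball (0 : Space d) 1) : ℝ) : ℂ) := by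
      rw [hb]
      simp
    exact_mod_cast this
  have hv : volume.real (Metric.ball (0 : Space d) 1) ≠ 0 :=
    (ENNReal.toReal_pos volume_unitBall_ne_zero measure_ball_lt_top.ne).ne'
  rw [intensity, hb', mul_div_cancel_right₀ _ hv]

/-- Disintegration turns the pairing of the four reduced moments with `f * f^*` into `𝔼|p(f)|²`. The
Lebesgue term is the squared mean, because `∫ f * f^* = |∫ f|²`. -/
theorem pairing_autoconvolution (hp : LocallySquareIntegrable p P) {f : Space d → ℂ}
    (hf : IsBoundedCompactBorel f) :
    pairing (autocorrelationPos p P) (autocorrelationNeg p P) (autoconvolution f) =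
      ((∫ ω, ‖(p.toFun ω).integral f‖ ^ 2 ∂P - ‖∫ ω, (p.toFun ω).integral f ∂P‖ ^ 2 : ℝ) : ℂ) := by
  have h₁ := isStationaryL2_posPart hp
  have h₂ := isStationaryL2_negPart hp
  have := h₁.isLocallyFiniteMeasure_mixedMoment h₁
  have := h₁.isLocallyFiniteMeasure_mixedMoment h₂
  have := h₂.isLocallyFiniteMeasure_mixedMoment h₁
  have := h₂.isLocallyFiniteMeasure_mixedMoment h₂
  have h := (secondMoment_eq hp (isLocallyIntegrableTest_mul_conj hf hf)).2
  rw [(h₁.isDiagonallyInvariant_mixedMoment h₁).integral_mul_conj hf,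
    (h₁.isDiagonallyInvariant_mixedMoment h₂).integral_mul_conj hf,
    (h₂.isDiagonallyInvariant_mixedMoment h₁).integral_mul_conj hf,
    (h₂.isDiagonallyInvariant_mixedMoment h₂).integral_mul_conj hf] at h
  rw [pairing_eq hp hf.autoconvolution, ← h, integral_eq_intensity_mul hp hf,
    integral_autoconvolution (hf.integrable _), secondMoment]
  simp only [integralProd_mul_conj]
  rw [integral_complex_ofReal, norm_mul, mul_pow, Complex.norm_real, Real.norm_eq_abs, sq_abs]
  push_cast
  ring

theorem isPosDefPairing (hp : LocallySquareIntegrable p P) :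
    IsPosDefPairing (autocorrelationPos p P) (autocorrelationNeg p P) := by
  intro f hf hs
  have hb := isBoundedCompactBorel_of_continuous hf hs
  refine ⟨_, ?_, pairing_autoconvolution hp hb⟩
  have hL := (memLp_integral hp hb).norm
  -- Nonnegativity for complex `f` follows from `|𝔼 p(f)|² ≤ (𝔼|p(f)|)² ≤ 𝔼|p(f)|²`, the second
  -- inequality being that the real variable `|p(f)|` has nonnegative variance.
  have h1 := ProbabilityTheory.variance_nonneg (fun ω => ‖(p.toFun ω).integral f‖) P
  rw [ProbabilityTheory.variance_eq_sub hL] at h1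
  have h2 := norm_integral_le_integral_norm (μ := P) fun ω => (p.toFun ω).integral f
  have h3 := pow_le_pow_left₀ (norm_nonneg _) h2 2
  simp only [Pi.pow_apply] at h1
  linarith

theorem pairing_autoconvolution_indicatorOne (hp : LocallySquareIntegrable p P)
    {A : Set (Space d)} (hA : Bornology.IsBounded A) (hAm : MeasurableSet A) :
    pairing (autocorrelationPos p P) (autocorrelationNeg p P) (autoconvolution (indicatorOne A)) =
      (numberVariance p P A : ℂ) := by
  have hb := isBoundedCompactBorel_indicatorOne hA hAm
  have hL := memLp_integral hp hb
  rw [pairing_autoconvolution hp hb]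
  simp only [p.integral_indicatorOne hAm, Complex.norm_real, Real.norm_eq_abs, sq_abs] at hL ⊢
  have hL' : MemLp (fun ω => (p.toFun ω).value A) 2 P := hL.re
  rw [numberVariance, ProbabilityTheory.variance_eq_sub hL', integral_complex_ofReal, Complex.norm_real,
    Real.norm_eq_abs, sq_abs]
  rfl

end InvariantRandomMeasure

end Hyperuniformity

/-! ### The spectral formula for the variance and its consequences -/

namespace Hyperuniformity

open scoped ENNReal ComplexConjugate

variable {d : ℕ}

/-- The small-scale decay of a measure on dilates of a set does not depend on the bounded
neighbourhood of the origin. -/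
theorem tendsto_measure_smul_of_mem_interior {ν : Measure (Space d)} [IsLocallyFiniteMeasure ν]
    {W W' : Set (Space d)} (hW : Bornology.IsBounded W) (hW0 : 0 ∈ interior W)
    (hW' : Bornology.IsBounded W')
    (h : Tendsto (fun t : ℝ => ν.real (t • W) / t ^ d) (𝓝[>] 0) (𝓝 0)) :
    Tendsto (fun t : ℝ => ν.real (t • W') / t ^ d) (𝓝[>] 0) (𝓝 0) := by
  obtain ⟨r, hr, hrW⟩ := Metric.mem_nhds_iff.1 (mem_interior_iff_mem_nhds.1 hW0)
  obtain ⟨R, hR, hRW⟩ := hW'.subset_ball_lt 0 0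
  -- With `B_r ⊆ W` and `W' ⊆ B_R`, the dilate `t W'` lies in `B_{tR}`, the dilate of `B_r` by
  -- `(R/r) t`, and hence in `((R/r) t) W`.
  have hs : Tendsto (fun t : ℝ => R / r * t) (𝓝[>] 0) (𝓝[>] 0) := by
    refine tendsto_nhdsWithin_iff.2 ⟨?_, ?_⟩
    · have : Tendsto (fun t : ℝ => R / r * t) (𝓝 0) (𝓝 (R / r * 0)) :=
        (continuous_const.mul continuous_id).tendsto 0
      rw [mul_zero] at this
      exact this.mono_left nhdsWithin_le_nhds
    · filter_upwards [self_mem_nhdsWithin] with t ht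
      exact mul_pos (div_pos hR hr) ht
  have h1 := (h.comp hs).const_mul ((R / r) ^ d)
  rw [mul_zero] at h1
  refine tendsto_of_tendsto_of_tendsto_of_le_of_le' tendsto_const_nhds h1 ?_ ?_
  · filter_upwards [self_mem_nhdsWithin] with t ht
    have : (0 : ℝ) < t := ht
    positivity
  · filter_upwards [self_mem_nhdsWithin] with t ht
    have ht0 : (0 : ℝ) < t := ht
    have hsub : t • W' ⊆ (R / r * t) • W := by
      refine (Set.smul_set_mono hRW).trans (Set.Subset.trans ?_ (Set.smul_set_mono hrW))
      rw [smul_ball ht0.ne', smul_ball (by positivity), smul_zero, smul_zero,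
        Real.norm_of_nonneg ht0.le, Real.norm_of_nonneg (by positivity)]
      refine Metric.ball_subset_ball (le_of_eq ?_)
      field_simp
    have hle := measureReal_mono (μ := ν) hsub (hW.smul₀ _).measure_lt_top.ne
    simp only [Function.comp_apply]
    rw [mul_pow, ← mul_div_assoc, mul_div_mul_left _ _ (by positivity)]
    gcongr

namespace InvariantRandomMeasure

variable {Ω : Type*} [MeasurableSpace Ω] [AddAction (Space d) Ω] {P : Measure Ω}
  {p : InvariantRandomMeasure d Ω}

theorem spectrallyHyperuniform_iff : SpectrallyHyperuniform p P ↔ Tendsto (fun t : ℝ =>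
    (centeredDiffraction p P).real (Metric.ball 0 t) / t ^ d) (𝓝[>] 0) (𝓝 0) := by
  refine tendsto_congr' ?_
  filter_upwards [self_mem_nhdsWithin] with t ht
  rw [smul_unitBall_of_pos ht]

variable [MeasurableConstVAdd (Space d) Ω] [VAddInvariantMeasure (Space d) Ω P]
  [IsProbabilityMeasure P]

/-- The diffraction is a chosen transform, with default zero, so existence has to be proved before
the definition carries information. Afterwards only the defining formula is used; uniqueness is
never needed. -/
theorem isFourierTransformOf_centeredDiffraction (hp : LocallySquareIntegrable p P) :
    IsFourierTransformOf (centeredDiffraction p P) (centeredAutocorrelation p P) := by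
  have := isLocallyFiniteMeasure_autocorrelationPos hp
  have := isLocallyFiniteMeasure_autocorrelationNeg hp
  have hex : ∃ ν, IsFourierTransformOf ν (centeredAutocorrelation p P) := by
    obtain ⟨ν, hν, h⟩ := (isPosDefPairing hp).exists_isSmoothFourierTransform
    refine ⟨ν, hν, fun f hf hs => ?_⟩
    obtain ⟨R, hR, hfR⟩ := exists_vanishesOutside hs
    rw [centeredAutocorrelation_eq_pairing hp
      (isBoundedCompactBorel_of_continuous hf hs).autoconvolution]
    exact h.integral_eq (memLp_of_continuous hf hs 2) hR hfR
  rw [centeredDiffraction, fourierTransform, dif_pos hex]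
  exact hex.choose_spec

theorem isLocallyFiniteMeasure_centeredDiffraction (hp : LocallySquareIntegrable p P) :
    IsLocallyFiniteMeasure (centeredDiffraction p P) :=
  (isFourierTransformOf_centeredDiffraction hp).1

theorem isSmoothFourierTransform_centeredDiffraction (hp : LocallySquareIntegrable p P) :
    IsSmoothFourierTransform (centeredDiffraction p P) (autocorrelationPos p P)
      (autocorrelationNeg p P) := by
  intro f hf hs
  rw [← centeredAutocorrelation_eq_pairing hp
    (isBoundedCompactBorel_of_continuous hf.continuous hs).autoconvolution]
  exact (isFourierTransformOf_centeredDiffraction hp).2 f hf.continuous hs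

/-- The spectral formula for the variance: the extension of the Fourier formula to compactly
supported `L²` functions, applied to an indicator. -/
theorem integral_centeredDiffraction_indicatorOne (hp : LocallySquareIntegrable p P)
    {A : Set (Space d)} (hA : Bornology.IsBounded A) (hAm : MeasurableSet A) :
    Integrable (fun ξ => ‖𝓕 (indicatorOne A) ξ‖ ^ 2) (centeredDiffraction p P) ∧
      ∫ ξ, ‖𝓕 (indicatorOne A) ξ‖ ^ 2 ∂centeredDiffraction p P = numberVariance p P A := by
  have := isLocallyFiniteMeasure_autocorrelationPos hp
  have := isLocallyFiniteMeasure_autocorrelationNeg hp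
  have hb := isBoundedCompactBorel_indicatorOne hA hAm
  obtain ⟨R, hR, hfR⟩ := hb.exists_vanishesOutside
  obtain ⟨hi, he⟩ := (isSmoothFourierTransform_centeredDiffraction hp).integral_eq
    (hb.memLp 2 volume) hR hfR
  rw [pairing_autoconvolution_indicatorOne hp hA hAm] at he
  exact ⟨hi, Complex.ofReal_injective he⟩

theorem integral_centeredDiffraction_smul (hp : LocallySquareIntegrable p P)
    {V : Set (Space d)} (hV : Bornology.IsBounded V) (hVm : MeasurableSet V) {t : ℝ} (ht : 0 < t) :
    Integrable (fun ξ => ‖𝓕 (indicatorOne (t • V)) ξ‖ ^ 2) (centeredDiffraction p P) ∧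
      ∫ ξ, ‖𝓕 (indicatorOne (t • V)) ξ‖ ^ 2 ∂centeredDiffraction p P =
        numberVariance p P (t • V) :=
  integral_centeredDiffraction_indicatorOne hp (hV.smul₀ t) (hVm.const_smul_of_ne_zero ht.ne')

theorem geometricallyHyperuniformWrt_iff (hp : LocallySquareIntegrable p P)
    {V : Set (Space d)} (hV : Bornology.IsBounded V) (hVm : MeasurableSet V) :
    GeometricallyHyperuniformWrt p P V ↔ Tendsto (fun t : ℝ =>
      (∫ ξ, ‖𝓕 (indicatorOne (t • V)) ξ‖ ^ 2 ∂centeredDiffraction p P) / t ^ d) atTop (𝓝 0) := by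
  refine tendsto_congr' ?_
  filter_upwards [eventually_gt_atTop 0] with t ht
  rw [(integral_centeredDiffraction_smul hp hV hVm ht).2]

theorem spectrallyHyperuniform_of_geometricallyHyperuniformWrt (hp : LocallySquareIntegrable p P)
    {V : Set (Space d)} (hV : Bornology.IsBounded V) (hVm : MeasurableSet V) (hV0 : 0 < volume V)
    (h : GeometricallyHyperuniformWrt p P V) : SpectrallyHyperuniform p P := by
  have := isLocallyFiniteMeasure_centeredDiffraction hp
  exact spectrallyHyperuniform_iff.2 (tendsto_measure_ball_of_tendsto_integral hV hVm hV0
    (fun t ht => (integral_centeredDiffraction_smul hp hV hVm ht).1)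
    ((geometricallyHyperuniformWrt_iff hp hV hVm).1 h))

theorem geometricallyHyperuniformWrt_of_spectrallyHyperuniform (hp : LocallySquareIntegrable p P)
    (h : SpectrallyHyperuniform p P) {V : Set (Space d)} (hV : Bornology.IsBounded V)
    (hVm : MeasurableSet V) (hVs : FourierSmooth V) : GeometricallyHyperuniformWrt p P V := by
  have := isLocallyFiniteMeasure_autocorrelationPos hp
  have := isLocallyFiniteMeasure_autocorrelationNeg hp
  have := isLocallyFiniteMeasure_centeredDiffraction hp
  obtain ⟨A, hA⟩ := (isSmoothFourierTransform_centeredDiffraction hp).exists_measure_ball_le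
  exact (geometricallyHyperuniformWrt_iff hp hV hVm).2
    (tendsto_integral_of_tendsto_measure_ball hA (spectrallyHyperuniform_iff.1 h) hVs)

theorem SpectrallyHyperuniformWrt.of_mem_interior (hp : LocallySquareIntegrable p P)
    {W W' : Set (Space d)} (hW : Bornology.IsBounded W) (hW0 : 0 ∈ interior W)
    (hW' : Bornology.IsBounded W') (h : SpectrallyHyperuniformWrt p P W) :
    SpectrallyHyperuniformWrt p P W' := by
  have := isLocallyFiniteMeasure_centeredDiffraction hp
  exact tendsto_measure_smul_of_mem_interior hW hW0 hW' h

end InvariantRandomMeasure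

end Hyperuniformity


/-! ### The main theorem -/

theorem mainTheorem1 (d : ℕ) {Ω : Type*} [MeasurableSpace Ω]
    [AddAction (EuclideanSpace ℝ (Fin d)) Ω]
    [MeasurableConstVAdd (EuclideanSpace ℝ (Fin d)) Ω]
    (P : Measure Ω) [IsProbabilityMeasure P]
    [VAddInvariantMeasure (EuclideanSpace ℝ (Fin d)) Ω P]
    (p : Hyperuniformity.InvariantRandomMeasure d Ω)
    (hp : Hyperuniformity.LocallySquareIntegrable p P) :
    (∀ V : Set (EuclideanSpace ℝ (Fin d)), Bornology.IsBounded V → MeasurableSet V →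
      0 < volume V → Hyperuniformity.GeometricallyHyperuniformWrt p P V →
      Hyperuniformity.SpectrallyHyperuniform p P) ∧
    (∀ W : Set (EuclideanSpace ℝ (Fin d)), Bornology.IsBounded W → MeasurableSet W →
      0 ∈ interior W → Hyperuniformity.SpectrallyHyperuniformWrt p P W →
      (∀ W' : Set (EuclideanSpace ℝ (Fin d)), Bornology.IsBounded W' → MeasurableSet W' →
        0 ∈ interior W' → Hyperuniformity.SpectrallyHyperuniformWrt p P W') ∧
      Hyperuniformity.SpectrallyHyperuniform p P) ∧
    (Hyperuniformity.SpectrallyHyperuniform p P →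
      ∀ V : Set (EuclideanSpace ℝ (Fin d)), Bornology.IsBounded V → MeasurableSet V →
        Hyperuniformity.FourierSmooth V → Hyperuniformity.GeometricallyHyperuniformWrt p P V) ∧
    (Hyperuniformity.GeometricallyHyperuniform p P ↔
      Hyperuniformity.SpectrallyHyperuniform p P) := by
  refine ⟨fun V hV hVm hV0 h =>
      Hyperuniformity.InvariantRandomMeasure.spectrallyHyperuniform_of_geometricallyHyperuniformWrt hp hV hVm hV0 h,
    fun W hW _ hW0 h => ⟨fun W' hW' _ _ => Hyperuniformity.InvariantRandomMeasure.SpectrallyHyperuniformWrt.of_mem_interior hp hW hW0 hW' h,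
      Hyperuniformity.InvariantRandomMeasure.SpectrallyHyperuniformWrt.of_mem_interior hp hW hW0 Metric.isBounded_ball h⟩,
    fun h V hV hVm hVs => Hyperuniformity.InvariantRandomMeasure.geometricallyHyperuniformWrt_of_spectrallyHyperuniform hp h hV hVm hVs,
    fun h => ?_, fun h => ?_⟩
  · exact Hyperuniformity.InvariantRandomMeasure.spectrallyHyperuniform_of_geometricallyHyperuniformWrt hp Metric.isBounded_ball
      measurableSet_ball (Metric.measure_ball_pos _ _ one_pos) h
  · exact Hyperuniformity.InvariantRandomMeasure.geometricallyHyperuniformWrt_of_spectrallyHyperuniform hp h Metric.isBounded_ball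
      measurableSet_ball (Hyperuniformity.fourierSmooth_ball d)
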